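/- **Theorem 1.** Fix $\delta_1\in(0,\pi/2)$ and $\beta\ge 1/\sin^2\delta_1$, and set $$\Phi(\psi)=\int_{\pi/2}^{\psi}\frac{ds}{(\beta\sin^2 s-1)^{1/2}\sin s},\qquad F(\psi)=\arccos\Big(\sqrt{\tfrac{\beta}{\beta-1}}\,\cos\psi\Big).$$ Then $\Phi$ is smooth on $(\delta_1,\pi-\delta_1)$, with $\Phi'(\psi)=(\beta\sin^2\psi-1)^{-1/2}(\sin\psi)^{-1}$, and the following holds for all functions $u_0,\psi_0$ of $r>0$ such that $u_0$ is measurable, $\psi_0$ is locally absolutely continuous on $(0,\infty)$, and $$\int_0^\infty u_0^2\,r\,dr<\infty,\qquad \int_0^\infty(\psi_0')^2\,r\,dr<\infty,\qquad \delta_1<\psi_0(r)<\pi-\delta_1 .$$ Let $e_\theta=(-x_2/|x|,x_1/|x|)$, let $S(\psi,\phi)=(\sin\psi\cos\phi,\sin\psi\sin\phi,\cos\psi)$, and take the initial data $$\mathbf u_0(x)=u_0(|x|)e_\theta,\qquad \mathbf d_0(x)=S\big(\psi_0(|x|),\Phi(\psi_0(|x|))\big),\qquad x\in\mathbb R^2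 .$$ Let $\Gamma_n(t,x)=(4\pi t)^{-n/2}e^{-|x|^2/4t}$ be the heat kernel on $\mathbb R^n$. For $t>0$ and $r\ge 0$ define $$v(t,x)=\int_{\mathbb R^2}\Gamma_2(t,x-y)F(\psi_0(|y|))\,dy,\qquad \psi(t,r)=\arccos\Big(\sqrt{\tfrac{\beta-1}{\beta}}\cos v(t,(r,0))\Big),$$ $$u(t,r)=r\int_{\mathbb R^4}\Gamma_4(t,(r,0,0,0)-y)\frac{u_0(|y|)}{|y|}\,dy,\qquad d(t,r)=S\big(\psi(t,r),\Phi(\psi(t,r))\big),$$ $$p(t,r)=\int_0^r\Big(\frac{u^2(t,s)}{s}-\frac{|d_r(t,s)|^2}{s}\Big)ds-|d_r(t,r)|^2 ,$$ and set $\mathbf u(t,x)=u(t,|x|)e_\theta$, $\mathbf d(t,x)=d(t,|x|)$, $\mathbf p(t,x)=p(t,|x|)$. Then: 1. The integral in $p$ converges, $\mathbf u,\mathbf d,\mathbf p$ are smooth on $(0,\infty)\times\mathbb R^2$, and there they satisfy the incompressible liquid crystal system $$\mathbf u_t+\mathbf u\cdot\nabla\mathbf u+\nabla \mathbf p=\Delta\mathbf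 u-\nabla\cdot(\nabla\mathbf d\otimes\nabla\mathbf d),\quad \mathbf d_t+\mathbf u\cdot\nabla\mathbf d=\Delta\mathbf d+|\nabla\mathbf d|^2\mathbf d,\quad \nabla\cdot\mathbf u=0,\quad |\mathbf d|=1,$$ where the $i$-th component of $\nabla\cdot(\nabla\mathbf d\otimes\nabla\mathbf d)$ is $\sum_j\partial_j(\partial_i\mathbf d\cdot\partial_j\mathbf d)$. 2. $\psi(t,r)\in(\delta_1,\pi-\delta_1)$ and $F(\psi(t,|x|))=v(t,x)$. For $t,r>0$, $$\psi_t=\psi_{rr}+\tfrac1r\psi_r-\frac{\cos\psi}{(\beta\sin^2\psi-1)\sin\psi}\,\psi_r^2,\qquad F(\psi)_t=F(\psi)_{rr}+\tfrac1rF(\psi)_r,\qquad \Big(\frac ur\Big)_t=\Big(\frac ur\Big)_{rr}+\frac3r\Big(\frac ur\Big)_r .$$ 3. $\|\mathbf u(t)\|_{L^2}\le\|\mathbf u_0\|_{L^2}<\infty$ for all $t>0$. As $t\to0^+$, $\mathbf u(t)\to\mathbf u_0$ in $L^2(\mathbb R^2)$ and $\mathbf d(t,x)\to\mathbf d_0(x)$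 for every $x\ne0$. 4. If $\beta>1/\sin^2\delta_1$, then $\nabla\mathbf d_0\in L^2(\mathbb R^2)$. Whenever $\nabla\mathbf d_0\in L^2(\mathbb R^2)$, one has $\|\nabla\mathbf d(t)\|_{L^2}\le\|\nabla\mathbf d_0\|_{L^2}$ for all $t>0$, and $\mathbf d(t)-\mathbf d_0\to0$ and $\nabla\mathbf d(t)-\nabla\mathbf d_0\to0$ in $L^2(\mathbb R^2)$ as $t\to0^+$. 5. The length (one-dimensional Hausdorff measure) of the image curve $\mathbf d(t,\mathbb R^2)\subset\mathbb S^2$, with $\mathbf d(0)=\mathbf d_0$, is non-increasing in $t\ge0$. -/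

import Mathlib

open Set Filter Topology MeasureTheory
open scoped ContDiff

noncomputable section

namespace LiquidCrystal

/-- The plane, with its Euclidean norm. -/
abbrev E2 : Type := EuclideanSpace ℝ (Fin 2)

/-- Euclidean three-space, which contains the sphere of orientations. -/
abbrev E3 : Type := EuclideanSpace ℝ (Fin 3)

/-- Euclidean four-space. -/
abbrev E4 : Type := EuclideanSpace ℝ (Fin 4)

/-! ### The liquid crystal system in the plane -/

/-- The partial derivative `∂_i f` of a function on the plane. -/
def pd {V : Type*} [NormedAddCommGroup V] [NormedSpace ℝ V] (i : Fin 2) (f : E2 → V) (x : E2) : V :=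
  fderiv ℝ f x (EuclideanSpace.single i 1)

/-- `|∇ d|² = ∑ i, |∂_i d|²`. -/
def gradSq (d : E2 → E3) (x : E2) : ℝ := ∑ i : Fin 2, ‖pd i d x‖ ^ 2

/-- The vector field `∇ · (∇ d ⊗ ∇ d)`, with `i`-th component `∑ j, ∂_j (∂_i d · ∂_j d)`. -/
def elasticForce (d : E2 → E3) (x : E2) : E2 :=
  WithLp.toLp 2 fun i : Fin 2 =>
    ∑ j : Fin 2, pd j (fun y => inner ℝ (pd i d y) (pd j d y)) x

/-- Global solutions `(u, d, p)` of the two-dimensional incompressible liquid crystal system that are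
smooth on `(0, ∞) × ℝ²` and satisfy the equations there in the classical sense. The
term `fderiv ℝ f x (u t x)` is `u · ∇ f`. -/
structure IsClassicalSolution (u : ℝ → E2 → E2) (d : ℝ → E2 → E3) (p : ℝ → E2 → ℝ) : Prop where
  smooth_u : ContDiffOn ℝ ∞ (fun z : ℝ × E2 => u z.1 z.2) (Ioi 0 ×ˢ univ)
  smooth_d : ContDiffOn ℝ ∞ (fun z : ℝ × E2 => d z.1 z.2) (Ioi 0 ×ˢ univ)
  smooth_p : ContDiffOn ℝ ∞ (fun z : ℝ × E2 => p z.1 z.2) (Ioi 0 ×ˢ univ)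
  momentum : ∀ t > 0, ∀ x,
    deriv (fun s => u s x) t + fderiv ℝ (u t) x (u t x) + gradient (p t) x
      = Laplacian.laplacian (u t) x - elasticForce (d t) x
  orientation : ∀ t > 0, ∀ x,
    deriv (fun s => d s x) t + fderiv ℝ (d t) x (u t x)
      = Laplacian.laplacian (d t) x + gradSq (d t) x • d t x
  incompressible : ∀ t > 0, ∀ x, ∑ j : Fin 2, pd j (fun y => u t y j) x = 0
  unit : ∀ t > 0, ∀ x, ‖d t x‖ = 1

/-- `∫ |v|² dx`, as an extended nonnegative number. -/
def sqNorm {V : Type*} [NormedAddCommGroup V] (v : E2 → V) : ENNReal :=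
  ∫⁻ x, ‖v x‖ₑ ^ 2

/-- `∫ |∇ d|² dx`, as an extended nonnegative number. -/
def dirichlet (d : E2 → E3) : ENNReal :=
  ∑ i : Fin 2, sqNorm (pd i d)

/-- The velocity field `w(|x|) e_θ`, where `e_θ = (-x₂/|x|, x₁/|x|)`. -/
def swirl (w : ℝ → ℝ) (x : E2) : E2 := w ‖x‖ • !₂[-(x 1 / ‖x‖), x 0 / ‖x‖]

/-- The unit vector with polar angle `ψ` and azimuth `φ`. -/
def sph (ψ φ : ℝ) : E3 :=
  !₂[Real.sin ψ * Real.cos φ, Real.sin ψ * Real.sin φ, Real.cos ψ]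

/-! ### The explicit solution -/

/-- The azimuth as a function of the polar angle:
`Φ(ψ) = ∫_{π/2}^ψ (β sin² s - 1)^{-1/2} (sin s)⁻¹ ds`. -/
def Phi (β ψ : ℝ) : ℝ :=
  ∫ s in (Real.pi / 2)..ψ, 1 / (Real.sqrt (β * Real.sin s ^ 2 - 1) * Real.sin s)

/-- The Hopf–Cole type substitution `F(ψ) = arccos (√(β / (β - 1)) cos ψ)`. -/
def hopfCole (β ψ : ℝ) : ℝ := Real.arccos (Real.sqrt (β / (β - 1)) * Real.cos ψ)

/-- The inverse substitution `v ↦ arccos (√((β - 1) / β) cos v)`. -/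
def hopfColeInv (β v : ℝ) : ℝ := Real.arccos (Real.sqrt ((β - 1) / β) * Real.cos v)

/-- The heat flow on `ℝⁿ` for `t > 0`: the convolution of `f` with the Gaussian heat kernel. -/
def heatFlow {n : ℕ} (f : EuclideanSpace ℝ (Fin n) → ℝ) (t : ℝ) (x : EuclideanSpace ℝ (Fin n)) : ℝ :=
  ∫ y, (4 * Real.pi * t) ^ (-(n : ℝ) / 2) * Real.exp (-‖x - y‖ ^ 2 / (4 * t)) * f y

/-- The polar angle `ψ(t, r)` for `t > 0`: `F(ψ(t, ·))` is the heat flow on `ℝ²` of `F(ψ₀)`. -/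
def psi (β : ℝ) (ψ₀ : ℝ → ℝ) (t r : ℝ) : ℝ :=
  hopfColeInv β (heatFlow (fun y : E2 => hopfCole β (ψ₀ ‖y‖)) t (EuclideanSpace.single 0 r))

/-- The angular velocity profile `u(t, r)` for `t > 0`: `u / r` is the heat flow on `ℝ⁴` of
`u₀(|y|) / |y|`. -/
def uRad (u₀ : ℝ → ℝ) (t r : ℝ) : ℝ :=
  r * heatFlow (fun y : E4 => u₀ ‖y‖ / ‖y‖) t (EuclideanSpace.single 0 r)

/-- The orientation `d(t, r)` for `t > 0`. -/
def dRad (β : ℝ) (ψ₀ : ℝ → ℝ) (t r : ℝ) : E3 := sph (psi β ψ₀ t r) (Phi β (psi β ψ₀ t r))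

/-- The integrand `u² / s - |d_r|² / s` of the pressure formula. -/
def pIntegrand (β : ℝ) (u₀ ψ₀ : ℝ → ℝ) (t s : ℝ) : ℝ :=
  1 / s * uRad u₀ t s ^ 2 - 1 / s * ‖deriv (dRad β ψ₀ t) s‖ ^ 2

/-- The pressure `p(t, r) = ∫₀^r (u² / s - |d_r|² / s) ds - |d_r(t, r)|²` for `t > 0`. -/
def pRad (β : ℝ) (u₀ ψ₀ : ℝ → ℝ) (t r : ℝ) : ℝ :=
  (∫ s in (0 : ℝ)..r, pIntegrand β u₀ ψ₀ t s) - ‖deriv (dRad β ψ₀ t) r‖ ^ 2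

/-- The velocity field `u(t, |x|) e_θ`, for `t > 0`. -/
def velocity (u₀ : ℝ → ℝ) (t : ℝ) (x : E2) : E2 := swirl (uRad u₀ t) x

/-- The orientation field `d(t, |x|)`, for `t > 0`. -/
def director (β : ℝ) (ψ₀ : ℝ → ℝ) (t : ℝ) (x : E2) : E3 := dRad β ψ₀ t ‖x‖

/-- The pressure `p(t, |x|)`, for `t > 0`. -/
def pressure (β : ℝ) (u₀ ψ₀ : ℝ → ℝ) (t : ℝ) (x : E2) : ℝ := pRad β u₀ ψ₀ t ‖x‖

/-- The initial orientation, with polar angle `ψ₀(|x|)` and azimuth `Φ(ψ₀(|x|))`. -/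
def director₀ (β : ℝ) (ψ₀ : ℝ → ℝ) (x : E2) : E3 := sph (ψ₀ ‖x‖) (Phi β (ψ₀ ‖x‖))

/-- The length of the image curve of an orientation field: the one-dimensional Hausdorff measure of
its image. -/
def imageLength (d : E2 → E3) : ENNReal := Measure.hausdorffMeasure 1 (range d)

/-- Admissible radial data: `u₀` is measurable with `∫ u₀² r dr < ∞`, and `ψ₀` is locally absolutely
continuous on `(0, ∞)` with `∫ (ψ₀')² r dr < ∞` and `δ₁ < ψ₀ < π - δ₁`. -/
structure AdmissibleData (δ₁ : ℝ) (u₀ ψ₀ : ℝ → ℝ) : Prop where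
  measurable_u : AEStronglyMeasurable u₀ (volume.restrict (Ioi 0))
  energy_u : IntegrableOn (fun r => u₀ r ^ 2 * r) (Ioi 0)
  ac_psi : ∀ a b : ℝ, 0 < a → a < b → AbsolutelyContinuousOnInterval ψ₀ a b
  energy_psi : IntegrableOn (fun r => deriv ψ₀ r ^ 2 * r) (Ioi 0)
  range_psi : ∀ r > 0, ψ₀ r ∈ Ioo δ₁ (Real.pi - δ₁)

end LiquidCrystal

end

open LiquidCrystal

open Set Filter Topology MeasureTheory
open scoped ContDiff

noncomputable section

namespace LiquidCrystal

/-! The choice of `Φ` makes `S(ψ, Φ(ψ))` run along a great circle `γ` of the sphere, and `v = F(ψ)`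
is its arc length parameter (`sph_Phi_eq_greatCircle`). The director is thus `γ(v)` with `|γ'| = 1`
and `γ'' = -γ`, so `Δd = Δv γ' - |∇v|² γ` and `|∇d| = |∇v|`. The nonlinear term `|∇d|² d` cancels
the normal part of `Δd`. Since `v` is radial and the velocity is tangential to circles, `u · ∇d =
0`. The orientation equation is therefore the planar heat equation for `v`.

Write the velocity as `W Jx`, where `J` is the rotation by a right angle and `W = u / r` is radial.
The convection term is `-W² x`, the elastic force is a radial multiple of `x`, and `Δ(W Jx) = (ΔW +
2 W_r / r) Jx`. The tangential part of the momentum equation is the radial heat equation of `ℝ⁴` for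
`W`, and the pressure absorbs the radial part. The system decouples into two linear heat equations
(`isClassicalSolution_of_radial`).

Smoothness at the origin needs quotients by `r` in smooth form. `W` is a four-dimensional heat flow
restricted to a plane. From `(r v_r)_r = r Δv` one gets `v_r / r = ∫₀¹ σ Δv(σx) dσ`, and the
pressure is an average of the same kind (`radialMean`). The heat flow is smooth in `(t, x)` because,
up to an explicit factor, it is a Laplace type integral in `(x / 2t, -1 / 4t)`
(`HasExpMoments.contDiffOn`).

The remaining statements come from the heat flow as the average of `f(x - √t z)` over a fixed
Gaussian in `z`. Jensen's inequality gives the `L²` contraction, and continuity of translations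
gives `L²` convergence. The kinetic energy in the plane is a multiple of the `L²` norm of `u / r` on
`ℝ⁴` (`sqNorm_swirl`). The gradient of the heat flow is the heat flow of the weak gradient
(`pd_heatFlow_profile`), and `γ` has unit speed, so the elastic energy is treated in the same way.
Averages of a function stay in the interval of its values, so by the semigroup law the image arcs
are nested and their lengths decrease. -/

/-! ### The heat flow as an average over a fixed Gaussian -/

/-- The Gaussian heat kernel at time `t`. -/
def heatKernel (n : ℕ) (t : ℝ) (z : EuclideanSpace ℝ (Fin n)) : ℝ :=
  (4 * Real.pi * t) ^ (-(n : ℝ) / 2) * Real.exp (-‖z‖ ^ 2 / (4 * t))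

/-- The Gaussian probability measure with the heat kernel at time one as density. -/
def heatMeasure (n : ℕ) : Measure (EuclideanSpace ℝ (Fin n)) :=
  volume.withDensity fun z => ENNReal.ofReal (heatKernel n 1 z)

variable {n : ℕ}

lemma heatKernel_pos {t : ℝ} (ht : 0 < t) (z : EuclideanSpace ℝ (Fin n)) : 0 < heatKernel n t z := by
  unfold heatKernel; positivity

lemma continuous_heatKernel (t : ℝ) : Continuous (heatKernel n t) := by
  unfold heatKernel; fun_prop

lemma integral_gaussian_norm {t : ℝ} (ht : 0 < t) :
    ∫ z : EuclideanSpace ℝ (Fin n), Real.exp (-‖z‖ ^ 2 / (4 * t))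
      = (4 * Real.pi * t) ^ ((n : ℝ) / 2) := by
  have h := GaussianFourier.integral_rexp_neg_mul_sq_norm
    (V := EuclideanSpace ℝ (Fin n)) (b := 1 / (4 * t)) (by positivity)
  rw [finrank_euclideanSpace_fin] at h
  convert h using 2
  · ext z; congr 1; field_simp
  · field_simp

lemma integral_heatKernel {t : ℝ} (ht : 0 < t) : ∫ z, heatKernel n t z = 1 := by
  unfold heatKernel
  rw [integral_const_mul, integral_gaussian_norm ht, ← Real.rpow_add (by positivity)]
  simp [neg_div]

lemma integrable_heatKernel {t : ℝ} (ht : 0 < t) : Integrable (heatKernel n t) := by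
  by_contra h
  have := integral_heatKernel (n := n) ht
  rw [integral_undef h] at this
  exact zero_ne_one this

instance : IsProbabilityMeasure (heatMeasure n) := by
  constructor
  rw [heatMeasure, withDensity_apply _ MeasurableSet.univ, setLIntegral_univ,
    ← ofReal_integral_eq_lintegral_ofReal (integrable_heatKernel one_pos)
      (ae_of_all _ fun z => (heatKernel_pos one_pos z).le), integral_heatKernel one_pos]
  simp

lemma measurable_heatKernel_ofReal :
    Measurable fun z : EuclideanSpace ℝ (Fin n) => ENNReal.ofReal (heatKernel n 1 z) :=
  (continuous_heatKernel 1).measurable.ennreal_ofReal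

lemma heatMeasure_absolutelyContinuous : heatMeasure n ≪ volume :=
  withDensity_absolutelyContinuous _ _

lemma heatKernel_smul {t : ℝ} (ht : 0 < t) (z : EuclideanSpace ℝ (Fin n)) :
    (√t) ^ n * heatKernel n t (√t • z) = heatKernel n 1 z := by
  unfold heatKernel
  have h1 : -‖√t • z‖ ^ 2 / (4 * t) = -‖z‖ ^ 2 / (4 * 1) := by
    rw [norm_smul, mul_pow, Real.norm_of_nonneg (Real.sqrt_nonneg t), Real.sq_sqrt ht.le]
    field_simp
  have h2 : (√t) ^ n = t ^ ((n : ℝ) / 2) := by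
    rw [Real.sqrt_eq_rpow, ← Real.rpow_natCast, ← Real.rpow_mul ht.le]; congr 1; ring
  rw [h1, h2, Real.mul_rpow (by positivity) ht.le, neg_div, Real.rpow_neg ht.le]
  have : t ^ ((n : ℝ) / 2) ≠ 0 := by positivity
  field_simp

lemma heatFlow_eq_integral_heatKernel (f : EuclideanSpace ℝ (Fin n) → ℝ) (t : ℝ)
    (x : EuclideanSpace ℝ (Fin n)) : heatFlow f t x = ∫ y, heatKernel n t (x - y) * f y := rfl

lemma integral_heatMeasure (g : EuclideanSpace ℝ (Fin n) → ℝ) :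
    ∫ z, g z ∂heatMeasure n = ∫ z, heatKernel n 1 z * g z := by
  rw [heatMeasure, integral_withDensity_eq_integral_toReal_smul measurable_heatKernel_ofReal
    (ae_of_all _ fun z => ENNReal.ofReal_lt_top)]
  refine integral_congr_ae (ae_of_all _ fun z => ?_)
  simp [ENNReal.toReal_ofReal (heatKernel_pos one_pos z).le]

/-- The substitution `y = x - √t z` moves the time dependence from the kernel to the argument of
`f`, so that estimates of the flow become estimates of translations. -/
lemma heatFlow_eq_integral_heatMeasure (f : EuclideanSpace ℝ (Fin n) → ℝ) {t : ℝ} (ht : 0 < t)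
    (x : EuclideanSpace ℝ (Fin n)) :
    heatFlow f t x = ∫ z, f (x - √t • z) ∂heatMeasure n := by
  have hs : 0 < √t := Real.sqrt_pos.2 ht
  rw [integral_heatMeasure, heatFlow_eq_integral_heatKernel,
    ← integral_sub_left_eq_self (fun y => heatKernel n t (x - y) * f y) volume x]
  have h := Measure.integral_comp_smul (volume : Measure (EuclideanSpace ℝ (Fin n)))
    (fun z => heatKernel n t z * f (x - z)) (√t)
  rw [finrank_euclideanSpace_fin, abs_of_pos (by positivity), smul_eq_mul, inv_mul_eq_div,
    eq_div_iff (by positivity), mul_comm, ← integral_const_mul] at h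
  simp only [sub_sub_cancel]
  rw [← h]
  refine integral_congr_ae (ae_of_all _ fun z => ?_)
  simp only [← mul_assoc, heatKernel_smul ht]

/-- The data are controlled only almost everywhere; this carries measurability and almost everywhere
bounds over to the Gaussian average. -/
lemma quasiMeasurePreserving_sub_smul {t : ℝ} (ht : 0 < t) (x : EuclideanSpace ℝ (Fin n)) :
    Measure.QuasiMeasurePreserving (fun z => x - √t • z) (heatMeasure n) volume := by
  have hs : √t ≠ 0 := (Real.sqrt_pos.2 ht).ne'
  have h1 : Measure.QuasiMeasurePreserving (fun z : EuclideanSpace ℝ (Fin n) => √t • z)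
      volume volume := by
    refine ⟨by fun_prop, ?_⟩
    rw [Measure.map_addHaar_smul _ hs]
    exact Measure.smul_absolutelyContinuous
  have h2 : Measure.QuasiMeasurePreserving (fun z : EuclideanSpace ℝ (Fin n) => x - z)
      volume volume := quasiMeasurePreserving_sub_left volume x
  exact (h2.comp h1).mono_left heatMeasure_absolutelyContinuous

/-! ### L² estimates for the heat flow -/

lemma eLpNorm_two_sq_eq_lintegral {Ω V : Type*} [MeasurableSpace Ω] {μ : Measure Ω}
    [NormedAddCommGroup V] (g : Ω → V) : eLpNorm g 2 μ ^ 2 = ∫⁻ z, ‖g z‖ₑ ^ 2 ∂μ := by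
  rw [eLpNorm_eq_lintegral_rpow_enorm_toReal (by norm_num) (by norm_num), ← ENNReal.rpow_natCast,
    ← ENNReal.rpow_mul]
  norm_num

lemma memLp_two_iff_lintegral {Ω V : Type*} [MeasurableSpace Ω] {μ : Measure Ω}
    [NormedAddCommGroup V] {g : Ω → V} (hg : AEStronglyMeasurable g μ) :
    MemLp g 2 μ ↔ ∫⁻ z, ‖g z‖ₑ ^ 2 ∂μ < ⊤ := by
  rw [← eLpNorm_two_sq_eq_lintegral, ENNReal.pow_lt_top_iff]
  simp [MemLp, hg]

lemma enorm_add_sq_le {V : Type*} [NormedAddCommGroup V] (a b : V) :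
    ‖a + b‖ₑ ^ 2 ≤ 2 * ‖a‖ₑ ^ 2 + 2 * ‖b‖ₑ ^ 2 := by
  have h : ‖a + b‖ ^ 2 ≤ 2 * ‖a‖ ^ 2 + 2 * ‖b‖ ^ 2 := by
    nlinarith [norm_add_le a b, norm_nonneg (a + b), norm_nonneg a, norm_nonneg b,
      sq_nonneg (‖a‖ - ‖b‖)]
  simp only [← ofReal_norm]
  rw [← ENNReal.ofReal_pow (norm_nonneg _), ← ENNReal.ofReal_pow (norm_nonneg _),
    ← ENNReal.ofReal_pow (norm_nonneg _), ← ENNReal.ofReal_ofNat, ← ENNReal.ofReal_mul (by norm_num),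
    ← ENNReal.ofReal_mul (by norm_num), ← ENNReal.ofReal_add (by positivity) (by positivity)]
  exact ENNReal.ofReal_le_ofReal h

lemma enorm_sub_sq_le {V : Type*} [NormedAddCommGroup V] (a b : V) :
    ‖a - b‖ₑ ^ 2 ≤ 2 * ‖a‖ₑ ^ 2 + 2 * ‖b‖ₑ ^ 2 := by
  simpa [sub_eq_add_neg] using enorm_add_sq_le a (-b)

/-- Jensen's inequality, from `‖·‖₁ ≤ ‖·‖₂` on a probability space. Integrability need not be
assumed, because a finite right side forces it. -/
lemma enorm_integral_sub_sq_le {Ω : Type*} [MeasurableSpace Ω] {μ : Measure Ω}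
    [IsProbabilityMeasure μ] {g : Ω → ℝ} (hg : AEStronglyMeasurable g μ) (c : ℝ) :
    ‖(∫ z, g z ∂μ) - c‖ₑ ^ 2 ≤ ∫⁻ z, ‖g z - c‖ₑ ^ 2 ∂μ := by
  have hgc : AEStronglyMeasurable (fun z => g z - c) μ := hg.sub aestronglyMeasurable_const
  by_cases hi : Integrable g μ
  · have h1 : (∫ z, g z ∂μ) - c = ∫ z, (g z - c) ∂μ := by
      rw [integral_sub hi (integrable_const c)]; simp
    have h2 := eLpNorm_le_eLpNorm_of_exponent_le (p := 1) (q := 2) (by norm_num) hgc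
    rw [h1]
    calc ‖∫ z, (g z - c) ∂μ‖ₑ ^ 2 ≤ (eLpNorm (fun z => g z - c) 1 μ) ^ 2 := by
          gcongr
          rw [eLpNorm_one_eq_lintegral_enorm]
          exact enorm_integral_le_lintegral_enorm _
      _ ≤ (eLpNorm (fun z => g z - c) 2 μ) ^ 2 := by gcongr
      _ = _ := by
          rw [eLpNorm_two_sq_eq_lintegral]
  -- Were this finite, `g - c` would lie in `L²`, hence in `L¹`, and `g` would be integrable.
  · have : ∫⁻ z, ‖g z - c‖ₑ ^ 2 ∂μ = ⊤ := by
      by_contra hne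
      have hm : MemLp (fun z => g z - c) 2 μ :=
        (memLp_two_iff_lintegral hgc).2 (lt_top_iff_ne_top.2 hne)
      exact hi (((hm.integrable (by norm_num)).add (integrable_const c)).congr
        (ae_of_all _ fun z => by simp))
    simp [this]

/-- Joint measurability for Tonelli. As `f` is measurable only up to null sets, it is needed that
`(x, z) ↦ x - √t z` pulls null sets back to null sets, which holds in `z` for each fixed `x`. -/
lemma aemeasurable_translate_sub {f g : EuclideanSpace ℝ (Fin n) → ℝ}
    (hf : AEStronglyMeasurable f) {t : ℝ} (ht : 0 < t) (hg : AEStronglyMeasurable g) :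
    AEMeasurable (fun p : EuclideanSpace ℝ (Fin n) × EuclideanSpace ℝ (Fin n) =>
        ‖f (p.1 - √t • p.2) - g p.1‖ₑ ^ 2) (volume.prod (heatMeasure n)) := by
  have h0 : Measure.QuasiMeasurePreserving
      (fun p : EuclideanSpace ℝ (Fin n) × EuclideanSpace ℝ (Fin n) => p.1 - √t • p.2)
      (volume.prod (heatMeasure n)) volume := by
    refine ⟨by fun_prop, ?_⟩
    refine Measure.AbsolutelyContinuous.mk fun s hs h0 => ?_
    rw [Measure.map_apply (by fun_prop) hs, Measure.prod_apply (hs.preimage (by fun_prop)),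
      lintegral_eq_zero_iff (measurable_measure_prodMk_left (hs.preimage (by fun_prop)))]
    exact ae_of_all _ fun x => (quasiMeasurePreserving_sub_smul ht x).preimage_null h0
  have h1 : AEStronglyMeasurable (fun p : EuclideanSpace ℝ (Fin n) × EuclideanSpace ℝ (Fin n) =>
      f (p.1 - √t • p.2) - g p.1) (volume.prod (heatMeasure n)) :=
    (hf.comp_quasiMeasurePreserving h0).sub hg.comp_fst
  exact h1.enorm.pow_const 2

/-- Jensen at each `x`, then Tonelli. The choice `g = 0` gives the contraction in `L²`, the choice
`g = f` the convergence to the data. -/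
lemma lintegral_heatFlow_sub_le {f : EuclideanSpace ℝ (Fin n) → ℝ}
    (hf : AEStronglyMeasurable f) {t : ℝ} (ht : 0 < t) {g : EuclideanSpace ℝ (Fin n) → ℝ}
    (hg : AEStronglyMeasurable g) :
    ∫⁻ x, ‖heatFlow f t x - g x‖ₑ ^ 2
      ≤ ∫⁻ z, (∫⁻ x, ‖f (x - √t • z) - g x‖ₑ ^ 2) ∂heatMeasure n := by
  rw [← lintegral_lintegral_swap]
  · refine lintegral_mono fun x => ?_
    rw [heatFlow_eq_integral_heatMeasure f ht]
    exact enorm_integral_sub_sq_le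
      (hf.comp_quasiMeasurePreserving (quasiMeasurePreserving_sub_smul ht x)) _
  · exact aemeasurable_translate_sub hf ht hg

lemma lintegral_heatFlow_sq_le {f : EuclideanSpace ℝ (Fin n) → ℝ}
    (hf : AEStronglyMeasurable f) {t : ℝ} (ht : 0 < t) :
    ∫⁻ x, ‖heatFlow f t x‖ₑ ^ 2 ≤ ∫⁻ x, ‖f x‖ₑ ^ 2 := by
  have h := lintegral_heatFlow_sub_le hf ht (aestronglyMeasurable_const (b := (0 : ℝ)))
  simp only [sub_zero] at h
  refine h.trans_eq ?_
  simp_rw [lintegral_sub_right_eq_self (fun x => ‖f x‖ₑ ^ 2)]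
  simp

/-- Continuity of translations in `L²`, obtained from the continuity of composition with measure
preserving maps. -/
lemma tendsto_lintegral_translate_sub {f : EuclideanSpace ℝ (Fin n) → ℝ} (hf : MemLp f 2) :
    Tendsto (fun h : EuclideanSpace ℝ (Fin n) => ∫⁻ x, ‖f (x - h) - f x‖ₑ ^ 2) (𝓝 0) (𝓝 0) := by
  let E := EuclideanSpace ℝ (Fin n)
  let g : E → C(E, E) := fun h => ⟨fun x => x - h, by fun_prop⟩
  have hg : Continuous g := ContinuousMap.continuous_of_continuous_uncurry _ (by
    simp only [g]; change Continuous fun p : E × E => p.2 - p.1; fun_prop)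
  have hmp : ∀ h : E, MeasurePreserving (g h) volume volume := fun h =>
    measurePreserving_sub_right volume h
  have : Fact ((1 : ENNReal) ≤ 2) := ⟨by norm_num⟩
  have h1 := Filter.Tendsto.compMeasurePreservingLp (l := 𝓝 (0 : E))
    (tendsto_const_nhds (x := hf.toLp f)) (hg.tendsto 0) hmp (hmp 0) (by norm_num)
  rw [tendsto_iff_edist_tendsto_0] at h1
  have h2 := (ENNReal.continuous_pow 2).tendsto 0 |>.comp h1
  simp only [ne_eq, OfNat.ofNat_ne_zero, not_false_eq_true, zero_pow] at h2
  refine h2.congr fun h => ?_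
  simp only [Function.comp]
  rw [Lp.edist_def, eLpNorm_two_sq_eq_lintegral]
  refine lintegral_congr_ae ?_
  have e0 := hf.coeFn_toLp
  filter_upwards [Lp.coeFn_compMeasurePreserving (hf.toLp f) (hmp h),
    Lp.coeFn_compMeasurePreserving (hf.toLp f) (hmp 0),
    (hmp h).quasiMeasurePreserving.ae_eq_comp e0, (hmp 0).quasiMeasurePreserving.ae_eq_comp e0]
    with x a1 a2 a3 a4
  rw [Pi.sub_apply, a1, a2, a3, a4]
  simp [g]

/-- For each `z` the translation error at `√t z` tends to zero, and it never exceeds `4 ‖f‖²`;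
dominated convergence in `z` concludes. -/
lemma tendsto_lintegral_heatFlow_sub {f : EuclideanSpace ℝ (Fin n) → ℝ} (hf : MemLp f 2) :
    Tendsto (fun t => ∫⁻ x, ‖heatFlow f t x - f x‖ₑ ^ 2) (𝓝[>] 0) (𝓝 0) := by
  have key : Tendsto (fun t => ∫⁻ z, (∫⁻ x, ‖f (x - √t • z) - f x‖ₑ ^ 2) ∂heatMeasure n)
      (𝓝[>] 0) (𝓝 (∫⁻ _, 0 ∂heatMeasure n)) := by
    have hfin : ∫⁻ x, ‖f x‖ₑ ^ 2 < ⊤ := (memLp_two_iff_lintegral hf.1).1 hf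
    refine tendsto_of_seq_tendsto fun u hu => ?_
    refine tendsto_lintegral_of_dominated_convergence'
      (fun _ => (2 * ∫⁻ x, ‖f x‖ₑ ^ 2) + 2 * ∫⁻ x, ‖f x‖ₑ ^ 2) (fun k => ?_) (fun k => ?_) ?_ ?_
    · rcases lt_or_ge 0 (u k) with ht | ht
      · exact (aemeasurable_translate_sub hf.1 ht hf.1).prod_swap.lintegral_prod_right'
      -- A sequence tending to `0` from the right may begin with nonpositive terms; there `√(u k) =
      -- 0` and the integrand vanishes.
      · simp [Real.sqrt_eq_zero_of_nonpos ht]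
    · refine ae_of_all _ fun z => ?_
      have : ∫⁻ x, ‖f x‖ₑ ^ 2 = ∫⁻ x, ‖f (x - √(u k) • z)‖ₑ ^ 2 :=
        (lintegral_sub_right_eq_self (fun x => ‖f x‖ₑ ^ 2) _).symm
      nth_rw 1 [this]
      rw [← lintegral_const_mul' _ _ (by norm_num), ← lintegral_const_mul' _ _ (by norm_num),
        ← lintegral_add_right' _ ((hf.1.enorm.pow_const 2).const_mul 2)]
      exact lintegral_mono fun x => enorm_sub_sq_le _ _
    · rw [lintegral_const]
      simp [ENNReal.mul_eq_top, hfin.ne]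
    · refine ae_of_all _ fun z => ?_
      have : Tendsto (fun t : ℝ => √t • z) (𝓝 0) (𝓝 (√0 • z)) := by
        apply Continuous.tendsto; fun_prop
      simp only [Real.sqrt_zero, zero_smul] at this
      exact (tendsto_lintegral_translate_sub hf).comp
        ((this.mono_left nhdsWithin_le_nhds).comp hu)
  rw [lintegral_zero] at key
  refine tendsto_of_tendsto_of_tendsto_of_le_of_le' tendsto_const_nhds key
    (Eventually.of_forall fun t => zero_le) ?_
  filter_upwards [self_mem_nhdsWithin] with t ht
  exact lintegral_heatFlow_sub_le hf.1 ht hf.1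

/-! ### Bounded data: initial values, range, radial symmetry and semigroup law -/

lemma integrable_comp_sub_smul {f : EuclideanSpace ℝ (Fin n) → ℝ}
    (hf : AEStronglyMeasurable f) {C : ℝ} (hC : ∀ᵐ y, |f y| ≤ C) {t : ℝ} (ht : 0 < t)
    (x : EuclideanSpace ℝ (Fin n)) : Integrable (fun z => f (x - √t • z)) (heatMeasure n) :=
  Integrable.of_bound (hf.comp_quasiMeasurePreserving (quasiMeasurePreserving_sub_smul ht x)) C
    ((quasiMeasurePreserving_sub_smul ht x).ae (p := fun y => |f y| ≤ C) hC)

lemma tendsto_heatFlow_of_continuousAt {f : EuclideanSpace ℝ (Fin n) → ℝ}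
    (hf : AEStronglyMeasurable f) {C : ℝ} (hC : ∀ᵐ y, |f y| ≤ C) {x : EuclideanSpace ℝ (Fin n)}
    (hx : ContinuousAt f x) : Tendsto (fun t => heatFlow f t x) (𝓝[>] 0) (𝓝 (f x)) := by
  have key : Tendsto (fun t => ∫ z, f (x - √t • z) ∂heatMeasure n) (𝓝[>] 0)
      (𝓝 (∫ _, f x ∂heatMeasure n)) := by
    refine tendsto_integral_filter_of_dominated_convergence (fun _ => C) ?_ ?_
      (integrable_const C) ?_
    · filter_upwards [self_mem_nhdsWithin] with t ht
      exact hf.comp_quasiMeasurePreserving (quasiMeasurePreserving_sub_smul ht x)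
    · filter_upwards [self_mem_nhdsWithin] with t ht
      exact (quasiMeasurePreserving_sub_smul ht x).ae (p := fun y => |f y| ≤ C) hC
    · refine ae_of_all _ fun z => ?_
      have h : Tendsto (fun t : ℝ => x - √t • z) (𝓝[>] 0) (𝓝 x) := by
        have : Tendsto (fun t : ℝ => x - √t • z) (𝓝 0) (𝓝 (x - √0 • z)) := by
          apply Continuous.tendsto; fun_prop
        simp only [Real.sqrt_zero, zero_smul, sub_zero] at this
        exact this.mono_left nhdsWithin_le_nhds
      exact hx.tendsto.comp h
  simp only [integral_const, probReal_univ, one_smul] at key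
  refine key.congr' ?_
  filter_upwards [self_mem_nhdsWithin] with t ht
  exact (heatFlow_eq_integral_heatMeasure f ht x).symm

/-- The difference is positive on a set of full measure. The strict inequality is what keeps
averages inside open or half-open intervals. -/
lemma lt_integral_of_ae_lt {Ω : Type*} [MeasurableSpace Ω] {μ : Measure Ω} [IsProbabilityMeasure μ]
    {g : Ω → ℝ} (hg : Integrable g μ) {a : ℝ} (h : ∀ᵐ z ∂μ, a < g z) : a < ∫ z, g z ∂μ := by
  have h1 : 0 < ∫ z, (g z - a) ∂μ := by
    rw [integral_pos_iff_support_of_nonneg_ae (h.mono fun z hz => (sub_pos.2 hz).le)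
      (hg.sub (integrable_const a))]
    have : Function.support (fun z => g z - a) =ᵐ[μ] univ := by
      filter_upwards [h] with z hz
      exact propext ⟨fun _ => mem_univ z, fun _ => (sub_pos.2 hz).ne'⟩
    rw [measure_congr this]; simp
  rw [integral_sub hg (integrable_const a)] at h1
  simpa using h1

lemma heatFlow_mem_Ioo {f : EuclideanSpace ℝ (Fin n) → ℝ} (hf : AEStronglyMeasurable f)
    {a b : ℝ} (h : ∀ᵐ y, f y ∈ Ioo a b) {t : ℝ} (ht : 0 < t) (x : EuclideanSpace ℝ (Fin n)) :
    heatFlow f t x ∈ Ioo a b := by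
  have hC : ∀ᵐ y, |f y| ≤ max |a| |b| := h.mono fun y hy => abs_le_max_abs_abs hy.1.le hy.2.le
  have hi := integrable_comp_sub_smul hf hC ht x
  have h' := (quasiMeasurePreserving_sub_smul ht x).ae (p := fun y => f y ∈ Ioo a b) h
  rw [heatFlow_eq_integral_heatMeasure f ht]
  refine ⟨lt_integral_of_ae_lt hi (h'.mono fun z hz => hz.1), ?_⟩
  have := lt_integral_of_ae_lt hi.neg (a := -b) (h'.mono fun z hz => neg_lt_neg hz.2)
  simp only [Pi.neg_apply, integral_neg] at this
  linarith

/-- The heat flow stays in the range of a function with almost all its values in an interval. -/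
lemma heatFlow_mem_of_ordConnected {f : EuclideanSpace ℝ (Fin n) → ℝ} (hf : AEStronglyMeasurable f)
    {s : Set ℝ} (hs : s.OrdConnected) {C : ℝ} (hC : ∀ y ∈ s, |y| ≤ C) (h : ∀ᵐ y, f y ∈ s)
    {t : ℝ} (ht : 0 < t) (x : EuclideanSpace ℝ (Fin n)) : heatFlow f t x ∈ s := by
  have hC' : ∀ᵐ y, |f y| ≤ C := h.mono fun y hy => hC _ hy
  have hi := integrable_comp_sub_smul hf hC' ht x
  have h' := (quasiMeasurePreserving_sub_smul ht x).ae (p := fun y => f y ∈ s) h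
  rw [heatFlow_eq_integral_heatMeasure f ht]
  set m := ∫ z, f (x - √t • z) ∂heatMeasure n with hm
  -- Otherwise `f > m` almost everywhere, and the mean `m` would exceed itself. With the symmetric
  -- bound, `m` lies between two points of the interval `s`.
  have h1 : ∃ y ∈ s, y ≤ m := by
    by_contra! hc
    exact lt_irrefl _ (lt_integral_of_ae_lt hi (a := m) (h'.mono fun z hz => hc _ hz))
  have h2 : ∃ y ∈ s, m ≤ y := by
    by_contra! hc
    have := lt_integral_of_ae_lt hi.neg (a := -m)
      (h'.mono fun z hz => neg_lt_neg (hc _ hz))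
    simp only [Pi.neg_apply, integral_neg] at this
    exact lt_irrefl _ this
  obtain ⟨y1, hy1, hy1'⟩ := h1
  obtain ⟨y2, hy2, hy2'⟩ := h2
  exact hs.out hy1 hy2 ⟨hy1', hy2'⟩

/-- The reflection in the perpendicular bisector of `x` and `x'` exchanges the two points and
preserves volume and norms. -/
lemma heatFlow_eq_of_norm_eq (h : ℝ → ℝ) (t : ℝ) {x x' : EuclideanSpace ℝ (Fin n)}
    (hx : ‖x‖ = ‖x'‖) : heatFlow (fun y => h ‖y‖) t x = heatFlow (fun y => h ‖y‖) t x' := by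
  let R := (ℝ ∙ (x - x'))ᗮ.reflection
  have hR : R x = x' := Submodule.reflection_sub hx
  rw [heatFlow_eq_integral_heatKernel, heatFlow_eq_integral_heatKernel,
    ← R.measurePreserving.integral_comp R.toHomeomorph.measurableEmbedding
      (fun y => heatKernel n t (x' - y) * h ‖y‖)]
  refine integral_congr_ae (ae_of_all _ fun y => ?_)
  have e : ‖x - y‖ = ‖R x - R y‖ := by rw [← map_sub, LinearIsometryEquiv.norm_map]
  simp only [← hR, heatKernel, LinearIsometryEquiv.norm_map, e]

/-- Completing the square in `w`: the second factor on the right is a normalized Gaussian in `w`, so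
integration leaves the semigroup law. -/
lemma heatKernel_mul_heatKernel {s t : ℝ} (hs : 0 < s) (ht : 0 < t)
    (x y w : EuclideanSpace ℝ (Fin n)) :
    heatKernel n s (x - w) * heatKernel n t (w - y) = heatKernel n (s + t) (x - y)
      * heatKernel n (s * t / (s + t)) (w - (s + t)⁻¹ • (t • x + s • y)) := by
  have hst : 0 < s + t := by positivity
  unfold heatKernel
  have e1 : (4 * Real.pi * s) ^ (-(n : ℝ) / 2) * (4 * Real.pi * t) ^ (-(n : ℝ) / 2)
      = (4 * Real.pi * (s + t)) ^ (-(n : ℝ) / 2)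
        * (4 * Real.pi * (s * t / (s + t))) ^ (-(n : ℝ) / 2) := by
    rw [← Real.mul_rpow (by positivity) (by positivity),
      ← Real.mul_rpow (by positivity) (by positivity)]
    congr 1; field_simp
  have e2 : -‖x - w‖ ^ 2 / (4 * s) + -‖w - y‖ ^ 2 / (4 * t) = -‖x - y‖ ^ 2 / (4 * (s + t))
      + -‖w - (s + t)⁻¹ • (t • x + s • y)‖ ^ 2 / (4 * (s * t / (s + t))) := by
    simp only [← real_inner_self_eq_norm_sq, inner_sub_left, inner_sub_right, inner_smul_left,
      inner_smul_right, inner_add_left, inner_add_right, real_inner_comm x w, real_inner_comm x y,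
      real_inner_comm w y, conj_trivial]
    field_simp
    ring
  rw [mul_mul_mul_comm, ← Real.exp_add, e1, e2, Real.exp_add]
  ring

lemma integral_heatKernel_mul_heatKernel {s t : ℝ} (hs : 0 < s) (ht : 0 < t)
    (x y : EuclideanSpace ℝ (Fin n)) :
    ∫ w, heatKernel n s (x - w) * heatKernel n t (w - y) = heatKernel n (s + t) (x - y) := by
  simp_rw [heatKernel_mul_heatKernel hs ht]
  rw [integral_const_mul, integral_sub_right_eq_self (heatKernel n (s * t / (s + t))),
    integral_heatKernel (by positivity), mul_one]

lemma heatFlow_add {f : EuclideanSpace ℝ (Fin n) → ℝ} (hf : AEStronglyMeasurable f) {C : ℝ}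
    (hC : ∀ᵐ y, |f y| ≤ C) {s t : ℝ} (hs : 0 < s) (ht : 0 < t) (x : EuclideanSpace ℝ (Fin n)) :
    heatFlow f (s + t) x = heatFlow (heatFlow f t) s x := by
  have hswap := integral_integral_swap (μ := volume) (ν := volume)
    (f := fun w y : EuclideanSpace ℝ (Fin n) =>
      heatKernel n s (x - w) * (heatKernel n t (w - y) * f y)) ?_
  · simp only [heatFlow_eq_integral_heatKernel]
    simp_rw [integral_const_mul] at hswap
    rw [hswap]
    refine integral_congr_ae (ae_of_all _ fun y => ?_)
    simp_rw [← mul_assoc]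
    rw [integral_mul_const, integral_heatKernel_mul_heatKernel hs ht]
  · have hm : AEStronglyMeasurable (fun p : EuclideanSpace ℝ (Fin n) × EuclideanSpace ℝ (Fin n) =>
        heatKernel n s (x - p.1) * (heatKernel n t (p.1 - p.2) * f p.2)) (volume.prod volume) := by
      refine AEStronglyMeasurable.mul ?_ (AEStronglyMeasurable.mul ?_ hf.comp_snd)
      · exact ((continuous_heatKernel s).comp (by fun_prop)).aestronglyMeasurable
      · exact ((continuous_heatKernel t).comp (by fun_prop)).aestronglyMeasurable
    -- In the variables `w` and `y - w` this is a product of integrable functions of one variable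
    -- each.
    have hb : Integrable (fun p : EuclideanSpace ℝ (Fin n) × EuclideanSpace ℝ (Fin n) =>
        heatKernel n s (x - p.1) * heatKernel n t (p.1 - p.2)) (volume.prod volume) := by
      have h1 := ((integrable_heatKernel (n := n) hs).comp_sub_left x).mul_prod
        (integrable_heatKernel (n := n) ht)
      refine ((measurePreserving_prod_sub_swap volume
        volume).integrable_comp_of_integrable h1).swap.congr (ae_of_all _ fun p => ?_)
      simp [Prod.swap, heatKernel, norm_sub_rev p.2 p.1]
    refine (hb.mul_const C).mono' hm ?_
    have hC' : ∀ᵐ p : EuclideanSpace ℝ (Fin n) × EuclideanSpace ℝ (Fin n)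
        ∂(volume.prod volume), |f p.2| ≤ C :=
      Measure.quasiMeasurePreserving_snd.ae (p := fun y => |f y| ≤ C) hC
    filter_upwards [hC'] with p hp
    simp only [Function.uncurry]
    rw [← mul_assoc, norm_mul, Real.norm_of_nonneg
      (mul_nonneg (heatKernel_pos hs _).le (heatKernel_pos ht _).le), Real.norm_eq_abs]
    exact mul_le_mul_of_nonneg_left hp
      (mul_nonneg (heatKernel_pos hs _).le (heatKernel_pos ht _).le)

/-! ### Smoothness of exponential integrals -/

section ExpIntegral

variable {α : Type} [MeasurableSpace α] {μ : Measure α} {H : Type} [NormedAddCommGroup H]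
  [NormedSpace ℝ H] {V : Type} [NormedAddCommGroup V] [NormedSpace ℝ V]

/-- The density `g` has exponential moments of the exponents `Y`, locally uniformly on `U`. -/
structure HasExpMoments (μ : Measure α) (Y : α → H →L[ℝ] ℝ) (U : Set H) (g : α → V) : Prop where
  aestronglyMeasurable : AEStronglyMeasurable g μ
  integrable : ∀ z ∈ U, ∃ ε > 0, Integrable (fun a => Real.exp (Y a z + ε * ‖Y a‖) * ‖g a‖) μ

/-- The exponential integral `∫ exp (Y a z) g a da`. -/
def expIntegral (μ : Measure α) (Y : α → H →L[ℝ] ℝ) (g : α → V) (z : H) : V :=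
  ∫ a, Real.exp (Y a z) • g a ∂μ

variable {Y : α → H →L[ℝ] ℝ} {U : Set H} {g : α → V}

/-- The extra factor `‖Y‖` is absorbed by `s ≤ exp s` at the price of half of `ε`. The class of
densities is therefore stable under differentiation. -/
lemma HasExpMoments.smulRight (hY : AEStronglyMeasurable Y μ) (hg : HasExpMoments μ Y U g) :
    HasExpMoments μ Y U (fun a => (Y a).smulRight (g a)) := by
  have hm : AEStronglyMeasurable (fun a => (Y a).smulRight (g a)) μ :=
    (ContinuousLinearMap.smulRightL ℝ H V).aestronglyMeasurable_comp₂ hY hg.aestronglyMeasurable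
  refine ⟨hm, fun z hz => ?_⟩
  obtain ⟨ε, hε, hi⟩ := hg.integrable z hz
  refine ⟨ε / 2, half_pos hε, (hi.const_mul (2 / ε)).mono' ?_ (ae_of_all _ fun a => ?_)⟩
  · have : AEStronglyMeasurable (fun a => Y a z) μ := by fun_prop
    exact (Real.continuous_exp.comp_aestronglyMeasurable
      (this.add (hY.norm.const_mul _))).mul hm.norm
  · rw [Real.norm_of_nonneg (by positivity), ContinuousLinearMap.norm_smulRight_apply]
    have h1 : ε / 2 * ‖Y a‖ ≤ Real.exp (ε / 2 * ‖Y a‖) :=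
      (by linarith : ε / 2 * ‖Y a‖ ≤ ε / 2 * ‖Y a‖ + 1).trans (Real.add_one_le_exp _)
    have h2 : Real.exp (Y a z + ε * ‖Y a‖)
        = Real.exp (Y a z + ε / 2 * ‖Y a‖) * Real.exp (ε / 2 * ‖Y a‖) := by
      rw [← Real.exp_add]; congr 1; ring
    rw [h2]
    calc _ = 2 / ε * (Real.exp (Y a z + ε / 2 * ‖Y a‖) * (ε / 2 * ‖Y a‖) * ‖g a‖) := by
          field_simp
      _ ≤ _ := by gcongr

/-- Differentiation under the integral. On the ball of radius `ε` around `z` the exponent is at most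
`Y z + ε ‖Y‖`, which supplies the dominating function. -/
lemma HasExpMoments.hasFDerivAt (hY : AEStronglyMeasurable Y μ) (hg : HasExpMoments μ Y U g)
    {z : H} (hz : z ∈ U) :
    HasFDerivAt (expIntegral μ Y g) (expIntegral μ Y (fun a => (Y a).smulRight (g a)) z) z := by
  have hg' := hg.smulRight hY
  obtain ⟨ε, hε, hi⟩ := hg'.integrable z hz
  obtain ⟨ε', hε', hi'⟩ := hg.integrable z hz
  have hmY : ∀ z, AEStronglyMeasurable (fun a => Real.exp (Y a z)) μ := fun z =>
    Real.continuous_exp.comp_aestronglyMeasurable (by fun_prop)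
  refine hasFDerivAt_integral_of_dominated_of_fderiv_le (s := Metric.ball z ε)
    (F' := fun x a => Real.exp (Y a x) • (Y a).smulRight (g a))
    (bound := fun a => Real.exp (Y a z + ε * ‖Y a‖) * ‖(Y a).smulRight (g a)‖)
    (Metric.ball_mem_nhds z hε) ?_ ?_ ?_ ?_ hi ?_
  · exact Eventually.of_forall fun x => (hmY x).smul hg.aestronglyMeasurable
  · refine hi'.mono' ((hmY z).smul hg.aestronglyMeasurable) (ae_of_all _ fun a => ?_)
    rw [norm_smul, Real.norm_of_nonneg (Real.exp_nonneg _)]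
    gcongr
    have : 0 ≤ ε' * ‖Y a‖ := by positivity
    linarith
  · exact (hmY z).smul hg'.aestronglyMeasurable
  · refine ae_of_all _ fun a x hx => ?_
    rw [norm_smul, Real.norm_of_nonneg (Real.exp_nonneg _)]
    gcongr
    have h1 : Y a x = Y a z + Y a (x - z) := by rw [map_sub]; ring
    have h2 : Y a (x - z) ≤ ε * ‖Y a‖ :=
      calc Y a (x - z) ≤ ‖Y a (x - z)‖ := Real.le_norm_self _
        _ ≤ ‖Y a‖ * ‖x - z‖ := (Y a).le_opNorm _
        _ ≤ ‖Y a‖ * ε := by gcongr; exact (mem_ball_iff_norm.1 hx).le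
        _ = _ := mul_comm _ _
    linarith
  · refine ae_of_all _ fun a x _ => ?_
    have h := ((Y a).hasFDerivAt (x := x)).exp.smul_const (g a)
    convert h using 1
    ext w
    simp [smul_smul]

/-- The derivative is again an exponential integral, with density `Y ⊗ g`. The induction on the
order lets the target space vary, since each derivative takes values in a space of linear maps. -/
lemma HasExpMoments.contDiffOn (hY : AEStronglyMeasurable Y μ) (hU : IsOpen U)
    (hg : HasExpMoments μ Y U g) : ContDiffOn ℝ ∞ (expIntegral μ Y g) U := by
  refine contDiffOn_infty.2 fun k => ?_
  induction k generalizing V with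
  | zero =>
    exact contDiffOn_zero.2 fun z hz =>
      (hg.hasFDerivAt hY hz).continuousAt.continuousWithinAt
  | succ k ih =>
    rw [Nat.cast_succ, contDiffOn_succ_iff_fderiv_of_isOpen hU]
    refine ⟨fun z hz => (hg.hasFDerivAt hY hz).differentiableAt.differentiableWithinAt,
      fun h => by simp at h, ?_⟩
    exact (ih (hg.smulRight hY)).congr fun z hz => (hg.hasFDerivAt hY hz).fderiv

lemma HasExpMoments.hasDerivAt_comp {g : α → ℝ} (hY : AEStronglyMeasurable Y μ)
    (hg : HasExpMoments μ Y U g) {z : ℝ → H} {z' : H} {τ : ℝ} (hz : HasDerivAt z z' τ)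
    (hU : z τ ∈ U) (hi : Integrable (fun a => Real.exp (Y a (z τ)) • (Y a).smulRight (g a)) μ) :
    HasDerivAt (fun τ => expIntegral μ Y g (z τ)) (expIntegral μ Y (fun a => Y a z' * g a) (z τ))
      τ := by
  refine ((hg.hasFDerivAt hY hU).comp_hasDerivAt τ hz).congr_deriv ?_
  unfold expIntegral
  rw [ContinuousLinearMap.integral_apply hi]
  simp

lemma HasExpMoments.integrable_exp_smul (hY : AEStronglyMeasurable Y μ)
    (hg : HasExpMoments μ Y U g) {z : H} (hz : z ∈ U) :
    Integrable (fun a => Real.exp (Y a z) • g a) μ := by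
  obtain ⟨ε, hε, hi⟩ := hg.integrable z hz
  have hm : AEStronglyMeasurable (fun a => Real.exp (Y a z)) μ :=
    Real.continuous_exp.comp_aestronglyMeasurable (by fun_prop)
  refine hi.mono' (hm.smul hg.aestronglyMeasurable) (ae_of_all _ fun a => ?_)
  rw [norm_smul, Real.norm_of_nonneg (Real.exp_nonneg _)]
  gcongr
  have : 0 ≤ ε * ‖Y a‖ := by positivity
  linarith

end ExpIntegral

/-! ### Smoothness of the heat flow and the heat equation -/

variable {n : ℕ}

/-- The function `f` is integrable against all Gaussians. -/
structure GaussianIntegrable (f : EuclideanSpace ℝ (Fin n) → ℝ) : Prop where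
  aestronglyMeasurable : AEStronglyMeasurable f
  integrable : ∀ c d : ℝ, 0 < d → Integrable fun y => Real.exp (c * ‖y‖ - d * ‖y‖ ^ 2) * ‖f y‖

lemma exp_linear_sub_quadratic_le (c : ℝ) {d : ℝ} (hd : 0 < d) (r : ℝ) :
    Real.exp (c * r - d * r ^ 2) ≤ Real.exp (c ^ 2 / (2 * d)) * Real.exp (-(d / 2) * r ^ 2) := by
  rw [← Real.exp_add]
  gcongr
  have : c ^ 2 / (2 * d) + -(d / 2) * r ^ 2 - (c * r - d * r ^ 2) = (c - d * r) ^ 2 / (2 * d) := by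
    field_simp; ring
  nlinarith [show 0 ≤ (c - d * r) ^ 2 / (2 * d) by positivity]

lemma integrable_exp_neg_mul_norm_sq {d : ℝ} (hd : 0 < d) :
    Integrable fun y : EuclideanSpace ℝ (Fin n) => Real.exp (-d * ‖y‖ ^ 2) := by
  by_contra h
  have := GaussianFourier.integral_rexp_neg_mul_sq_norm (V := EuclideanSpace ℝ (Fin n)) hd
  rw [integral_undef h] at this
  have h2 : 0 < (Real.pi / d) ^ ((Module.finrank ℝ (EuclideanSpace ℝ (Fin n)) : ℝ) / 2) := by
    positivity
  exact h2.ne this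

lemma integrable_exp_linear_sub_quadratic (c : ℝ) {d : ℝ} (hd : 0 < d) :
    Integrable fun y : EuclideanSpace ℝ (Fin n) => Real.exp (c * ‖y‖ - d * ‖y‖ ^ 2) := by
  refine ((integrable_exp_neg_mul_norm_sq (half_pos hd)).const_mul
    (Real.exp (c ^ 2 / (2 * d)))).mono' (by fun_prop) (ae_of_all _ fun y => ?_)
  rw [Real.norm_of_nonneg (Real.exp_nonneg _)]
  exact exp_linear_sub_quadratic_le c hd _

lemma GaussianIntegrable.of_bound {f : EuclideanSpace ℝ (Fin n) → ℝ}
    (hf : AEStronglyMeasurable f) {C : ℝ} (hC : ∀ᵐ y, |f y| ≤ C) : GaussianIntegrable f := by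
  refine ⟨hf, fun c d hd => ?_⟩
  exact (integrable_exp_linear_sub_quadratic c hd).mul_bdd (c := C) hf.norm
    (hC.mono fun y hy => by simpa using hy)

/-- Cauchy–Schwarz against the Gaussian. This covers the angular velocity `u₀(|y|) / |y|` on `ℝ⁴`,
which is in `L²` but need not be bounded. -/
lemma GaussianIntegrable.of_memLp_two {f : EuclideanSpace ℝ (Fin n) → ℝ} (hf : MemLp f 2) :
    GaussianIntegrable f := by
  refine ⟨hf.1, fun c d hd => ?_⟩
  have h : MemLp (fun y : EuclideanSpace ℝ (Fin n) => Real.exp (c * ‖y‖ - d * ‖y‖ ^ 2)) 2 := by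
    rw [memLp_two_iff_integrable_sq (by fun_prop)]
    refine (integrable_exp_linear_sub_quadratic (2 * c) (mul_pos two_pos hd)).congr
      (ae_of_all _ fun y => ?_)
    simp only [← Real.exp_nat_mul]; congr 1; push_cast; ring
  exact h.integrable_mul hf.norm

/-- Exponential growth only raises the linear coefficient `c`. The moments `y_i f`, which appear in
derivatives of the heat flow, stay in the class. -/
lemma GaussianIntegrable.mul {f q : EuclideanSpace ℝ (Fin n) → ℝ} (hf : GaussianIntegrable f)
    (hq : Continuous q) {A : ℝ} (hA : ∀ y, |q y| ≤ A * Real.exp ‖y‖) :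
    GaussianIntegrable fun y => q y * f y := by
  refine ⟨hq.aestronglyMeasurable.mul hf.1, fun c d hd => ?_⟩
  refine ((hf.2 (c + 1) d hd).const_mul A).mono' ?_ (ae_of_all _ fun y => ?_)
  · refine AEStronglyMeasurable.mul (by fun_prop) (hq.aestronglyMeasurable.mul hf.1).norm
  · rw [norm_mul, norm_norm, norm_mul, Real.norm_of_nonneg (Real.exp_nonneg _), Real.norm_eq_abs]
    have : Real.exp ((c + 1) * ‖y‖ - d * ‖y‖ ^ 2)
        = Real.exp (c * ‖y‖ - d * ‖y‖ ^ 2) * Real.exp ‖y‖ := by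
      rw [← Real.exp_add]; congr 1; ring
    rw [this]
    calc _ ≤ Real.exp (c * ‖y‖ - d * ‖y‖ ^ 2) * ((A * Real.exp ‖y‖) * ‖f y‖) := by
          gcongr; exact hA y
      _ = _ := by ring

lemma GaussianIntegrable.coord_mul {f : EuclideanSpace ℝ (Fin n) → ℝ} (hf : GaussianIntegrable f)
    (i : Fin n) : GaussianIntegrable fun y => y i * f y := by
  refine hf.mul (by fun_prop) (A := 1) fun y => ?_
  rw [one_mul, ← Real.norm_eq_abs]
  exact (PiLp.norm_apply_le y i).trans (by linarith [Real.add_one_le_exp ‖y‖])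

lemma GaussianIntegrable.add {f g : EuclideanSpace ℝ (Fin n) → ℝ} (hf : GaussianIntegrable f)
    (hg : GaussianIntegrable g) : GaussianIntegrable fun y => f y + g y := by
  refine ⟨hf.1.add hg.1, fun c d hd => ((hf.2 c d hd).add (hg.2 c d hd)).mono' ?_
    (ae_of_all _ fun y => ?_)⟩
  · exact AEStronglyMeasurable.mul (by fun_prop) (hf.1.add hg.1).norm
  · rw [Real.norm_of_nonneg (by positivity), Pi.add_apply, ← mul_add]
    gcongr
    exact norm_add_le _ _

lemma GaussianIntegrable.const_mul {f : EuclideanSpace ℝ (Fin n) → ℝ} (hf : GaussianIntegrable f)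
    (c : ℝ) : GaussianIntegrable fun y => c * f y :=
  hf.mul continuous_const (A := |c|) fun y =>
    le_mul_of_one_le_right (abs_nonneg c) (Real.one_le_exp (norm_nonneg y))

/-- The exponent of the Gaussian kernel, as a linear form in `(x / 2t, -1 / 4t)`. -/
def gaussExponent (y : EuclideanSpace ℝ (Fin n)) : EuclideanSpace ℝ (Fin n) × ℝ →L[ℝ] ℝ :=
  (innerSL ℝ y).comp (ContinuousLinearMap.fst ℝ _ _) + ‖y‖ ^ 2 • ContinuousLinearMap.snd ℝ _ _

@[simp] lemma gaussExponent_apply (y : EuclideanSpace ℝ (Fin n))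
    (z : EuclideanSpace ℝ (Fin n) × ℝ) : gaussExponent y z = inner ℝ y z.1 + ‖y‖ ^ 2 * z.2 := by
  simp [gaussExponent]

lemma continuous_gaussExponent : Continuous (gaussExponent (n := n)) := by
  unfold gaussExponent
  refine Continuous.add ?_ (by fun_prop)
  exact (innerSL ℝ).continuous.clm_comp continuous_const

lemma norm_gaussExponent_le (y : EuclideanSpace ℝ (Fin n)) :
    ‖gaussExponent y‖ ≤ ‖y‖ + ‖y‖ ^ 2 := by
  refine ContinuousLinearMap.opNorm_le_bound _ (by positivity) fun z => ?_
  rw [gaussExponent_apply]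
  calc ‖inner ℝ y z.1 + ‖y‖ ^ 2 * z.2‖ ≤ ‖y‖ * ‖z.1‖ + ‖y‖ ^ 2 * ‖z.2‖ := by
        refine (norm_add_le _ _).trans (add_le_add (norm_inner_le_norm _ _) ?_)
        simp
    _ ≤ ‖y‖ * ‖z‖ + ‖y‖ ^ 2 * ‖z‖ := by gcongr <;> simp [Prod.norm_def]
    _ = _ := by ring

lemma aestronglyMeasurable_gaussExponent :
    AEStronglyMeasurable (gaussExponent (n := n)) volume :=
  continuous_gaussExponent.aestronglyMeasurable

lemma GaussianIntegrable.hasExpMoments {f : EuclideanSpace ℝ (Fin n) → ℝ}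
    (hf : GaussianIntegrable f) : HasExpMoments volume gaussExponent {z | z.2 < 0} f := by
  -- As `‖Y y‖ ≤ |y| + |y|²`, this `ε` uses up half of the quadratic decay `z.2 |y|²` and leaves the
  -- other half.
  refine ⟨hf.1, fun z (hz : z.2 < 0) => ⟨-z.2 / 2, by linarith, ?_⟩⟩
  refine (hf.2 (‖z.1‖ + -z.2 / 2) (-z.2 / 2) (by linarith)).mono' ?_ (ae_of_all _ fun y => ?_)
  · have h1 := continuous_gaussExponent (n := n)
    refine AEStronglyMeasurable.mul ?_ hf.1.norm
    refine (Continuous.rexp ?_).aestronglyMeasurable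
    exact (h1.clm_apply continuous_const).add (continuous_const.mul h1.norm)
  · rw [Real.norm_of_nonneg (by positivity), gaussExponent_apply]
    gcongr
    have h1 := (real_inner_le_norm y z.1)
    have h2 := mul_le_mul_of_nonneg_left (norm_gaussExponent_le y)
      (show 0 ≤ -z.2 / 2 by linarith)
    nlinarith

/-- The prefactor of the exponential integral that gives the heat flow. -/
def gaussPrefactor (t : ℝ) (x : EuclideanSpace ℝ (Fin n)) : ℝ :=
  (4 * Real.pi * t) ^ (-(n : ℝ) / 2) * Real.exp (-‖x‖ ^ 2 / (4 * t))

/-- Expanding `|x - y|²` leaves an exponent that is linear in `(x / 2t, -1 / 4t)`, apart from a term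
free of `y`. -/
lemma heatFlow_eq_expIntegral (f : EuclideanSpace ℝ (Fin n) → ℝ) {t : ℝ} (ht : 0 < t)
    (x : EuclideanSpace ℝ (Fin n)) :
    heatFlow f t x = gaussPrefactor t x
      * expIntegral volume gaussExponent f ((2 * t)⁻¹ • x, -(4 * t)⁻¹) := by
  unfold heatFlow expIntegral gaussPrefactor
  rw [← integral_const_mul]
  refine integral_congr_ae (ae_of_all _ fun y => ?_)
  simp only [gaussExponent_apply, smul_eq_mul, inner_smul_right]
  have : -‖x - y‖ ^ 2 / (4 * t) = -‖x‖ ^ 2 / (4 * t)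
      + ((2 * t)⁻¹ * inner ℝ y x + ‖y‖ ^ 2 * -(4 * t)⁻¹) := by
    rw [norm_sub_sq_real, real_inner_comm]; field_simp; ring
  rw [this, Real.exp_add]
  ring

lemma GaussianIntegrable.contDiffOn_heatFlow {f : EuclideanSpace ℝ (Fin n) → ℝ}
    (hf : GaussianIntegrable f) :
    ContDiffOn ℝ ∞ (fun z : ℝ × EuclideanSpace ℝ (Fin n) => heatFlow f z.1 z.2)
      (Ioi 0 ×ˢ univ) := by
  have hU : IsOpen {z : EuclideanSpace ℝ (Fin n) × ℝ | z.2 < 0} :=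
    isOpen_lt continuous_snd continuous_const
  have h1 := hf.hasExpMoments.contDiffOn aestronglyMeasurable_gaussExponent hU
  have h2 : ContDiffOn ℝ ∞ (fun z : ℝ × EuclideanSpace ℝ (Fin n) =>
      ((2 * z.1)⁻¹ • z.2, -(4 * z.1)⁻¹)) (Ioi 0 ×ˢ univ) := by
    intro z hz
    have hz1 : z.1 ≠ 0 := (show 0 < z.1 from hz.1).ne'
    refine ContDiffAt.contDiffWithinAt (ContDiffAt.prodMk ?_ ?_)
    · exact ((contDiffAt_const.mul contDiffAt_fst).inv (by simpa using hz1)).smul contDiffAt_snd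
    · exact ((contDiffAt_const.mul contDiffAt_fst).inv (by simpa using hz1)).neg
  have h3 : ContDiffOn ℝ ∞ (fun z : ℝ × EuclideanSpace ℝ (Fin n) => gaussPrefactor z.1 z.2)
      (Ioi 0 ×ˢ univ) := by
    intro z hz
    have hz1 : 0 < z.1 := hz.1
    refine ContDiffAt.contDiffWithinAt (ContDiffAt.mul ?_ (ContDiffAt.exp ?_))
    · exact (contDiffAt_const.mul contDiffAt_fst).rpow_const_of_ne (by positivity)
    · exact (contDiffAt_snd.norm_sq ℝ).neg.div (contDiffAt_const.mul contDiffAt_fst)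
        (by positivity)
  refine (h3.mul (h1.comp h2 fun z hz => ?_)).congr fun z hz => heatFlow_eq_expIntegral f hz.1 z.2
  have hz1 : 0 < z.1 := hz.1
  simp [hz1]

lemma GaussianIntegrable.hasDerivAt_expIntegral {f : EuclideanSpace ℝ (Fin n) → ℝ}
    (hf : GaussianIntegrable f) {z : ℝ → EuclideanSpace ℝ (Fin n) × ℝ}
    {z' : EuclideanSpace ℝ (Fin n) × ℝ} {τ : ℝ} (hz : HasDerivAt z z' τ) (hτ : (z τ).2 < 0) :
    HasDerivAt (fun τ => expIntegral volume gaussExponent f (z τ))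
      (expIntegral volume gaussExponent (fun y => gaussExponent y z' * f y) (z τ)) τ :=
  hf.hasExpMoments.hasDerivAt_comp aestronglyMeasurable_gaussExponent hz hτ
    ((hf.hasExpMoments.smulRight aestronglyMeasurable_gaussExponent).integrable_exp_smul
      aestronglyMeasurable_gaussExponent hτ)

lemma GaussianIntegrable.integrable_heatKernel_mul {f : EuclideanSpace ℝ (Fin n) → ℝ}
    (hf : GaussianIntegrable f) {t : ℝ} (ht : 0 < t) (x : EuclideanSpace ℝ (Fin n)) :
    Integrable fun y => heatKernel n t (x - y) * f y := by
  refine ((hf.2 (‖x‖ / (2 * t)) (1 / (4 * t)) (by positivity)).const_mul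
    ((4 * Real.pi * t) ^ (-(n : ℝ) / 2))).mono' ?_ (ae_of_all _ fun y => ?_)
  · exact (((continuous_heatKernel t).comp
      (continuous_const.sub continuous_id)).aestronglyMeasurable).mul hf.1
  · rw [norm_mul, Real.norm_of_nonneg (heatKernel_pos ht _).le, heatKernel, mul_assoc]
    gcongr
    have h := abs_norm_sub_norm_le x y
    have h2 : (‖x‖ - ‖y‖) ^ 2 ≤ ‖x - y‖ ^ 2 := sq_le_sq' (by linarith [abs_le.1 h]) (by linarith [abs_le.1 h])
    have h3 : ‖x‖ / (2 * t) * ‖y‖ - 1 / (4 * t) * ‖y‖ ^ 2 - -‖x - y‖ ^ 2 / (4 * t)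
        = (‖x - y‖ ^ 2 - (‖x‖ - ‖y‖) ^ 2 + ‖x‖ ^ 2) / (4 * t) := by field_simp; ring
    have h4 : 0 ≤ (‖x - y‖ ^ 2 - (‖x‖ - ‖y‖) ^ 2 + ‖x‖ ^ 2) / (4 * t) := by
      apply div_nonneg <;> nlinarith [sq_nonneg ‖x‖]
    linarith

lemma GaussianIntegrable.heatFlow_finset_sum {ι : Type*} (s : Finset ι)
    {f : ι → EuclideanSpace ℝ (Fin n) → ℝ} (hf : ∀ i ∈ s, GaussianIntegrable (f i)) {t : ℝ}
    (ht : 0 < t) (x : EuclideanSpace ℝ (Fin n)) :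
    heatFlow (fun y => ∑ i ∈ s, f i y) t x = ∑ i ∈ s, heatFlow (f i) t x := by
  simp only [heatFlow_eq_integral_heatKernel, Finset.mul_sum]
  exact integral_finsetSum _ fun i hi => (hf i hi).integrable_heatKernel_mul ht x

lemma GaussianIntegrable.heatFlow_add_apply {f g : EuclideanSpace ℝ (Fin n) → ℝ}
    (hf : GaussianIntegrable f) (hg : GaussianIntegrable g) {t : ℝ} (ht : 0 < t)
    (x : EuclideanSpace ℝ (Fin n)) :
    heatFlow (fun y => f y + g y) t x = heatFlow f t x + heatFlow g t x := by
  simp only [heatFlow_eq_integral_heatKernel, mul_add]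
  exact integral_add (hf.integrable_heatKernel_mul ht x) (hg.integrable_heatKernel_mul ht x)

lemma heatFlow_const_mul (f : EuclideanSpace ℝ (Fin n) → ℝ) (c t : ℝ)
    (x : EuclideanSpace ℝ (Fin n)) : heatFlow (fun y => c * f y) t x = c * heatFlow f t x := by
  simp only [heatFlow_eq_integral_heatKernel, mul_left_comm _ c]
  exact integral_const_mul _ _

/-- The directional derivative of the heat flow along a coordinate axis. -/
lemma GaussianIntegrable.hasDerivAt_heatFlow_add_smul {f : EuclideanSpace ℝ (Fin n) → ℝ}
    (hf : GaussianIntegrable f) {t : ℝ} (ht : 0 < t) (x : EuclideanSpace ℝ (Fin n)) (i : Fin n) :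
    HasDerivAt (fun s : ℝ => heatFlow f t (x + s • EuclideanSpace.single i (1 : ℝ)))
      ((2 * t)⁻¹ * (heatFlow (fun y => y i * f y) t x - x i * heatFlow f t x)) 0 := by
  let e : EuclideanSpace ℝ (Fin n) := EuclideanSpace.single i (1 : ℝ)
  have hl : HasDerivAt (fun s : ℝ => x + s • e) e 0 := by
    simpa using ((hasDerivAt_id (0 : ℝ)).smul_const e).const_add x
  have hz : HasDerivAt (fun s : ℝ => ((2 * t)⁻¹ • (x + s • e), -(4 * t)⁻¹))
      ((2 * t)⁻¹ • e, (0 : ℝ)) 0 := (hl.fun_const_smul (2 * t)⁻¹).prodMk (hasDerivAt_const _ _)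
  have h1 := hf.hasDerivAt_expIntegral hz (by simpa using ht)
  have h2 : HasDerivAt (fun s : ℝ => gaussPrefactor t (x + s • e))
      (gaussPrefactor t x * (-(2 * t)⁻¹ * x i)) 0 := by
    have h3 := ((hl.norm_sq.neg.div_const (4 * t)).exp).const_mul
      ((4 * Real.pi * t) ^ (-(n : ℝ) / 2))
    refine h3.congr_deriv ?_
    simp [gaussPrefactor, e, EuclideanSpace.inner_single_right]
    field_simp
    ring
  have h4 := h2.mul h1
  simp only [zero_smul, add_zero] at h4
  refine (h4.congr_of_eventuallyEq (Eventually.of_forall fun s =>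
    heatFlow_eq_expIntegral f ht (x + s • e))).congr_deriv ?_
  have e1 : (fun y => gaussExponent y ((2 * t)⁻¹ • e, (0 : ℝ)) * f y)
      = fun y => (2 * t)⁻¹ * (y i * f y) := by
    ext y
    simp [e, EuclideanSpace.inner_single_right, inner_smul_right, mul_assoc]
  rw [e1]
  have e2 := heatFlow_eq_expIntegral (fun y => (2 * t)⁻¹ * (y i * f y)) ht x
  rw [heatFlow_const_mul] at e2
  rw [mul_sub, e2, heatFlow_eq_expIntegral f ht x]
  ring

/-- The time derivative of the heat flow. -/
lemma GaussianIntegrable.hasDerivAt_heatFlow {f : EuclideanSpace ℝ (Fin n) → ℝ}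
    (hf : GaussianIntegrable f) {t : ℝ} (ht : 0 < t) (x : EuclideanSpace ℝ (Fin n)) :
    HasDerivAt (fun s : ℝ => heatFlow f s x)
      ((-n / (2 * t) + ‖x‖ ^ 2 / (4 * t ^ 2)) * heatFlow f t x
        - 2 / (4 * t ^ 2) * ∑ i, x i * heatFlow (fun y => y i * f y) t x
        + 1 / (4 * t ^ 2) * ∑ i, heatFlow (fun y => y i * (y i * f y)) t x) t := by
  have hz : HasDerivAt (fun s : ℝ => ((2 * s)⁻¹ • x, -(4 * s)⁻¹))
      ((-1 / (2 * t ^ 2)) • x, 1 / (4 * t ^ 2)) t := by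
    refine HasDerivAt.prodMk ?_ ?_
    · have := (((hasDerivAt_id t).const_mul 2).fun_inv (by simpa using ht.ne')).smul_const x
      refine this.congr_deriv ?_
      congr 1
      simp only [id]; field_simp
    · have := (((hasDerivAt_id t).const_mul 4).fun_inv (by simpa using ht.ne')).fun_neg
      refine this.congr_deriv ?_
      simp only [id]; field_simp
  have h1 := hf.hasDerivAt_expIntegral hz (by simpa using ht)
  have h2 : HasDerivAt (fun s : ℝ => gaussPrefactor s x)
      (gaussPrefactor t x * (-n / (2 * t) + ‖x‖ ^ 2 / (4 * t ^ 2))) t := by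
    have h3 := ((hasDerivAt_id t).const_mul (4 * Real.pi)).rpow_const (p := -(n : ℝ) / 2)
      (Or.inl (by simp [Real.pi_ne_zero, ht.ne']))
    have h4 := ((hasDerivAt_const t (-‖x‖ ^ 2)).div ((hasDerivAt_id t).const_mul 4)
      (by simpa using ht.ne')).exp
    refine (h3.mul h4).congr_deriv ?_
    have hp : (4 * Real.pi * t) ^ (-(n : ℝ) / 2 - 1)
        = (4 * Real.pi * t) ^ (-(n : ℝ) / 2) / (4 * Real.pi * t) := by
      rw [Real.rpow_sub (by positivity), Real.rpow_one]
    simp only [gaussPrefactor, hp, id, Pi.div_apply]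
    have := Real.pi_ne_zero
    field_simp
    ring
  have h4 := h2.mul h1
  refine (h4.congr_of_eventuallyEq ((eventually_gt_nhds ht).mono fun s hs =>
    heatFlow_eq_expIntegral f hs x)).congr_deriv ?_
  have e1 : heatFlow (fun y => gaussExponent y ((-1 / (2 * t ^ 2)) • x, 1 / (4 * t ^ 2)) * f y) t x
      = - (2 / (4 * t ^ 2)) * ∑ i, x i * heatFlow (fun y => y i * f y) t x
        + 1 / (4 * t ^ 2) * ∑ i, heatFlow (fun y => y i * (y i * f y)) t x := by
    have h5 : ∀ i, GaussianIntegrable fun y => -(2 / (4 * t ^ 2)) * x i * (y i * f y) :=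
      fun i => (hf.coord_mul i).const_mul _
    have h6 : ∀ i, GaussianIntegrable fun y => 1 / (4 * t ^ 2) * (y i * (y i * f y)) :=
      fun i => ((hf.coord_mul i).coord_mul i).const_mul _
    have h7 : (fun y => gaussExponent y ((-1 / (2 * t ^ 2)) • x, 1 / (4 * t ^ 2)) * f y)
        = fun y => ∑ i, (-(2 / (4 * t ^ 2)) * x i * (y i * f y)
          + 1 / (4 * t ^ 2) * (y i * (y i * f y))) := by
      ext y
      simp only [gaussExponent_apply, inner_smul_right, PiLp.inner_apply, RCLike.inner_apply,
        EuclideanSpace.real_norm_sq_eq, conj_trivial, Finset.sum_mul, Finset.mul_sum, add_mul,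
        ← Finset.sum_add_distrib]
      refine Finset.sum_congr rfl fun i _ => ?_
      field_simp
      ring
    rw [h7, GaussianIntegrable.heatFlow_finset_sum _ (fun i _ => (h5 i).add (h6 i)) ht]
    simp_rw [GaussianIntegrable.heatFlow_add_apply (h5 _) (h6 _) ht, heatFlow_const_mul,
      Finset.sum_add_distrib, Finset.mul_sum, mul_assoc]
  rw [heatFlow_eq_expIntegral _ ht] at e1
  rw [heatFlow_eq_expIntegral f ht]
  linear_combination e1

/-- The partial derivative of a function on Euclidean space. -/
def partialDeriv (i : Fin n) (f : EuclideanSpace ℝ (Fin n) → ℝ) (x : EuclideanSpace ℝ (Fin n)) : ℝ :=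
  fderiv ℝ f x (EuclideanSpace.single i 1)

lemma hasDerivAt_add_smul {V : Type*} [NormedAddCommGroup V] [NormedSpace ℝ V]
    {f : EuclideanSpace ℝ (Fin n) → V} {x : EuclideanSpace ℝ (Fin n)} (hf : DifferentiableAt ℝ f x)
    (e : EuclideanSpace ℝ (Fin n)) :
    HasDerivAt (fun s : ℝ => f (x + s • e)) (fderiv ℝ f x e) 0 := by
  have hl : HasDerivAt (fun s : ℝ => x + s • e) e 0 := by
    simpa using ((hasDerivAt_id (0 : ℝ)).smul_const e).const_add x
  exact HasFDerivAt.comp_hasDerivAt (0 : ℝ) (by simpa using hf.hasFDerivAt) hl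

lemma GaussianIntegrable.contDiff_heatFlow {f : EuclideanSpace ℝ (Fin n) → ℝ}
    (hf : GaussianIntegrable f) {t : ℝ} (ht : 0 < t) : ContDiff ℝ ∞ (heatFlow f t) := by
  rw [← contDiffOn_univ]
  exact hf.contDiffOn_heatFlow.comp (contDiffOn_const (c := t) |>.prodMk contDiffOn_id)
    fun x _ => ⟨ht, mem_univ _⟩

/-- This is the heat flow with the kernel multiplied by `-(x_i - y_i) / 2t`. Since the result
contains only heat flows of moments, the formula can be iterated. -/
lemma GaussianIntegrable.partialDeriv_heatFlow {f : EuclideanSpace ℝ (Fin n) → ℝ}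
    (hf : GaussianIntegrable f) {t : ℝ} (ht : 0 < t) (i : Fin n) (x : EuclideanSpace ℝ (Fin n)) :
    partialDeriv i (heatFlow f t) x
      = (2 * t)⁻¹ * (heatFlow (fun y => y i * f y) t x - x i * heatFlow f t x) :=
  (hasDerivAt_add_smul ((hf.contDiff_heatFlow ht).differentiable (by simp) x) _).unique
    (hf.hasDerivAt_heatFlow_add_smul ht x i)

/-- The heat equation. -/
lemma GaussianIntegrable.hasDerivAt_heatFlow_laplacian {f : EuclideanSpace ℝ (Fin n) → ℝ}
    (hf : GaussianIntegrable f) {t : ℝ} (ht : 0 < t) (x : EuclideanSpace ℝ (Fin n)) :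
    HasDerivAt (fun s : ℝ => heatFlow f s x)
      (∑ i, partialDeriv i (partialDeriv i (heatFlow f t)) x) t := by
  refine (hf.hasDerivAt_heatFlow ht x).congr_deriv ?_
  -- The first-order formula is applied to `f` and to `y_i f`. Summed over `i`, the coefficients of
  -- the moments of order zero, one and two match those of the time derivative.
  have h : ∀ i, partialDeriv i (partialDeriv i (heatFlow f t)) x
      = (-1 / (2 * t) + x i ^ 2 / (4 * t ^ 2)) * heatFlow f t x
        - 2 / (4 * t ^ 2) * (x i * heatFlow (fun y => y i * f y) t x)
        + 1 / (4 * t ^ 2) * heatFlow (fun y => y i * (y i * f y)) t x := by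
    intro i
    have h1 : partialDeriv i (heatFlow f t) = fun x =>
        (2 * t)⁻¹ * (heatFlow (fun y => y i * f y) t x - x i * heatFlow f t x) :=
      funext fun x => hf.partialDeriv_heatFlow ht i x
    have hd : DifferentiableAt ℝ (partialDeriv i (heatFlow f t)) x := by
      rw [h1]
      have d1 := ((hf.coord_mul i).contDiff_heatFlow ht).differentiable (by simp) x
      have d2 := (hf.contDiff_heatFlow ht).differentiable (by simp) x
      have d3 : DifferentiableAt ℝ (fun y : EuclideanSpace ℝ (Fin n) => y i) x := by fun_prop
      exact (d1.sub (d3.mul d2)).const_mul _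
    have h2 := hasDerivAt_add_smul hd (EuclideanSpace.single i 1)
    have h3 : HasDerivAt (fun s : ℝ => (x + s • EuclideanSpace.single i (1 : ℝ)) i) 1 0 := by
      simpa using (hasDerivAt_id (0 : ℝ)).const_add (x i)
    have h4 := (((hf.coord_mul i).hasDerivAt_heatFlow_add_smul ht x i).sub
      (h3.mul (hf.hasDerivAt_heatFlow_add_smul ht x i))).const_mul (2 * t)⁻¹
    have h5 : (fun s : ℝ => partialDeriv i (heatFlow f t) (x + s • EuclideanSpace.single i 1))
        = fun s => (2 * t)⁻¹ * ((heatFlow (fun y => y i * f y) t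
          (x + s • EuclideanSpace.single i 1)) - (x + s • EuclideanSpace.single i (1 : ℝ)) i
            * heatFlow f t (x + s • EuclideanSpace.single i 1)) := by
      rw [h1]
    rw [h5] at h2
    have h6 := h2.unique h4
    rw [show partialDeriv i (partialDeriv i (heatFlow f t)) x
      = fderiv ℝ (partialDeriv i (heatFlow f t)) x (EuclideanSpace.single i 1) from rfl, h6]
    simp only [zero_smul, add_zero]
    field_simp
    ring
  simp_rw [h, Finset.sum_add_distrib, Finset.sum_sub_distrib, ← Finset.mul_sum, ← Finset.sum_mul,
    Finset.sum_add_distrib, ← Finset.sum_div, EuclideanSpace.real_norm_sq_eq]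
  simp

/-! ### The great circle parametrized by the substituted polar angle -/

lemma hasDerivAt_euclidean {ι : Type*} [Fintype ι] {f : ℝ → EuclideanSpace ℝ ι}
    {f' : EuclideanSpace ℝ ι} {x : ℝ} (h : ∀ i, HasDerivAt (fun x => f x i) (f' i) x) :
    HasDerivAt f f' x := by
  exact (PiLp.continuousLinearEquiv 2 ℝ fun _ : ι => ℝ).symm.hasFDerivAt.comp_hasDerivAt x
    (hasDerivAt_pi.2 h)

/-- A unit speed great circle. -/
def greatCircle (β v : ℝ) : E3 :=
  !₂[Real.sin v, -(Real.cos v / √β), √((β - 1) / β) * Real.cos v]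

/-- The velocity of the great circle. -/
def greatCircleDeriv (β v : ℝ) : E3 :=
  !₂[Real.cos v, Real.sin v / √β, -(√((β - 1) / β) * Real.sin v)]

lemma contDiff_greatCircle (β : ℝ) : ContDiff ℝ ∞ (greatCircle β) := by
  rw [contDiff_euclidean]
  intro i
  fin_cases i
  · exact Real.contDiff_sin
  · exact (Real.contDiff_cos.div_const _).neg
  · exact contDiff_const.mul Real.contDiff_cos

lemma hasDerivAt_greatCircle (β v : ℝ) :
    HasDerivAt (greatCircle β) (greatCircleDeriv β v) v := by
  refine hasDerivAt_euclidean fun i => ?_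
  fin_cases i
  · exact Real.hasDerivAt_sin v
  · simpa [greatCircle, greatCircleDeriv, neg_div] using
      ((Real.hasDerivAt_cos v).div_const √β).fun_neg
  · simpa [greatCircle, greatCircleDeriv] using
      (Real.hasDerivAt_cos v).const_mul √((β - 1) / β)

/-- The geodesic equation `γ'' = -γ`, source of the term `|∇d|² d`. -/
lemma hasDerivAt_greatCircleDeriv (β v : ℝ) :
    HasDerivAt (greatCircleDeriv β) (-greatCircle β v) v := by
  refine hasDerivAt_euclidean fun i => ?_
  fin_cases i
  · simpa [greatCircle, greatCircleDeriv] using Real.hasDerivAt_cos v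
  · simpa [greatCircle, greatCircleDeriv] using (Real.hasDerivAt_sin v).div_const √β
  · simpa [greatCircle, greatCircleDeriv] using
      ((Real.hasDerivAt_sin v).const_mul √((β - 1) / β)).fun_neg

section

variable {β : ℝ} (hβ : 1 < β)

include hβ

lemma norm_greatCircle (v : ℝ) : ‖greatCircle β v‖ = 1 := by
  have h1 : √((β - 1) / β) ^ 2 = (β - 1) / β :=
    Real.sq_sqrt (div_nonneg (by linarith) (by linarith))
  have h2 : √β ^ 2 = β := Real.sq_sqrt (by linarith)
  rw [EuclideanSpace.norm_eq, Real.sqrt_eq_one]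
  simp only [greatCircle, Fin.sum_univ_three, Real.norm_eq_abs, sq_abs]
  simp [mul_pow, div_pow, h1, h2]
  have := Real.sin_sq_add_cos_sq v
  field_simp
  linear_combination β * this

lemma norm_greatCircleDeriv (v : ℝ) : ‖greatCircleDeriv β v‖ = 1 := by
  have h1 : √((β - 1) / β) ^ 2 = (β - 1) / β :=
    Real.sq_sqrt (div_nonneg (by linarith) (by linarith))
  have h2 : √β ^ 2 = β := Real.sq_sqrt (by linarith)
  rw [EuclideanSpace.norm_eq, Real.sqrt_eq_one]
  simp only [greatCircleDeriv, Fin.sum_univ_three, Real.norm_eq_abs, sq_abs]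
  simp [mul_pow, div_pow, h1, h2]
  have := Real.sin_sq_add_cos_sq v
  field_simp
  linear_combination β * this

/-- Unit speed, by the mean value inequality. Convergence of the angle thereby passes to the
director. -/
lemma norm_greatCircle_sub_le (v w : ℝ) : ‖greatCircle β v - greatCircle β w‖ ≤ |v - w| := by
  have := Convex.norm_image_sub_le_of_norm_hasDerivWithin_le (f := greatCircle β) (s := univ)
    (C := 1) (fun x _ => (hasDerivAt_greatCircle β x).hasDerivWithinAt)
    (fun x _ => (norm_greatCircleDeriv hβ x).le) convex_univ (mem_univ w) (mem_univ v)
  simpa using this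

end

/-! ### The substitution and the azimuth -/

/-- The closed form of the azimuth. -/
lemma hasDerivAt_neg_arctan {β ψ : ℝ} (hs : 0 < Real.sin ψ) (h : 1 < β * Real.sin ψ ^ 2) :
    HasDerivAt (fun ψ => -Real.arctan (Real.cos ψ / √(β * Real.sin ψ ^ 2 - 1)))
      (1 / (√(β * Real.sin ψ ^ 2 - 1) * Real.sin ψ)) ψ := by
  have hD : 0 < β * Real.sin ψ ^ 2 - 1 := by linarith
  have hr : 0 < √(β * Real.sin ψ ^ 2 - 1) := Real.sqrt_pos.2 hD
  have hr2 : √(β * Real.sin ψ ^ 2 - 1) ^ 2 = β * Real.sin ψ ^ 2 - 1 := Real.sq_sqrt hD.le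
  have h1 : HasDerivAt (fun ψ => β * Real.sin ψ ^ 2 - 1)
      (β * (2 * Real.sin ψ * Real.cos ψ)) ψ := by
    simpa using (((Real.hasDerivAt_sin ψ).fun_pow 2).const_mul β).sub_const 1
  have h2 := (((Real.hasDerivAt_cos ψ).fun_div (h1.sqrt hD.ne') hr.ne').arctan).fun_neg
  refine h2.congr_deriv ?_
  set r := √(β * Real.sin ψ ^ 2 - 1)
  have hsc := Real.sin_sq_add_cos_sq ψ
  have hβ : 1 < β := by nlinarith [Real.sin_sq_le_one ψ]
  -- Here `r² + cos² ψ = (β - 1) sin² ψ`, as `r² = β sin² ψ - 1`.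
  have e1 : 1 + (Real.cos ψ / r) ^ 2 = (β - 1) * Real.sin ψ ^ 2 / r ^ 2 := by
    field_simp
    linear_combination hr2 + hsc
  rw [e1]
  have hβ' : β - 1 ≠ 0 := by linarith
  field_simp
  rw [hr2]
  linear_combination β * hsc

section

variable {δ₁ β : ℝ} (hδ₁ : δ₁ ∈ Ioo 0 (Real.pi / 2)) (hβ : 1 / Real.sin δ₁ ^ 2 ≤ β)

include hδ₁

lemma sin_lt_sin_of_mem_Ioo {ψ : ℝ} (hψ : ψ ∈ Ioo δ₁ (Real.pi - δ₁)) :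
    Real.sin δ₁ < Real.sin ψ := by
  rcases le_or_gt ψ (Real.pi / 2) with h | h
  · exact Real.sin_lt_sin_of_lt_of_le_pi_div_two (by linarith [hδ₁.1, Real.pi_pos]) h hψ.1
  · rw [← Real.sin_pi_sub ψ]
    exact Real.sin_lt_sin_of_lt_of_le_pi_div_two (by linarith [hδ₁.1, Real.pi_pos]) (by linarith)
      (by linarith [hψ.2])

lemma sin_pos_of_mem_Ioo_half : 0 < Real.sin δ₁ :=
  Real.sin_pos_of_pos_of_lt_pi hδ₁.1 (by linarith [hδ₁.2, Real.pi_pos])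

lemma sin_pos_of_mem_Ioo_symm {ψ : ℝ} (hψ : ψ ∈ Ioo δ₁ (Real.pi - δ₁)) : 0 < Real.sin ψ :=
  (sin_pos_of_mem_Ioo_half hδ₁).trans (sin_lt_sin_of_mem_Ioo hδ₁ hψ)

include hβ

lemma one_le_mul_sin_sq : 1 ≤ β * Real.sin δ₁ ^ 2 := by
  have := sin_pos_of_mem_Ioo_half hδ₁
  rwa [div_le_iff₀ (by positivity)] at hβ

lemma one_lt_beta : 1 < β := by
  have h1 := one_le_mul_sin_sq hδ₁ hβ
  have h2 : Real.sin δ₁ < 1 := by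
    rw [← Real.sin_pi_div_two]
    exact Real.sin_lt_sin_of_lt_of_le_pi_div_two (by linarith [hδ₁.1, Real.pi_pos]) le_rfl hδ₁.2
  have h3 := sin_pos_of_mem_Ioo_half hδ₁
  by_contra hc
  nlinarith

/-- The inequality is strict even for the critical `β = 1 / sin² δ₁`, because `ψ` is interior; the
radicand in `Φ` never vanishes. -/
lemma one_lt_mul_sin_sq {ψ : ℝ} (hψ : ψ ∈ Ioo δ₁ (Real.pi - δ₁)) : 1 < β * Real.sin ψ ^ 2 := by
  have h1 := one_le_mul_sin_sq hδ₁ hβ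
  have h2 := sin_lt_sin_of_mem_Ioo hδ₁ hψ
  have h3 := sin_pos_of_mem_Ioo_half hδ₁
  have h4 := one_lt_beta hδ₁ hβ
  have : Real.sin δ₁ ^ 2 < Real.sin ψ ^ 2 := by gcongr
  nlinarith

omit hβ in
lemma pi_div_two_mem_Ioo_symm : Real.pi / 2 ∈ Ioo δ₁ (Real.pi - δ₁) :=
  ⟨hδ₁.2, by linarith [hδ₁.2]⟩

/-- The primitive vanishes at the base point, as `cos (π / 2) = 0`. -/
lemma Phi_eq_neg_arctan {ψ : ℝ} (hψ : ψ ∈ Ioo δ₁ (Real.pi - δ₁)) :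
    Phi β ψ = -Real.arctan (Real.cos ψ / √(β * Real.sin ψ ^ 2 - 1)) := by
  have hsub : uIcc (Real.pi / 2) ψ ⊆ Ioo δ₁ (Real.pi - δ₁) :=
    ordConnected_Ioo.uIcc_subset (pi_div_two_mem_Ioo_symm hδ₁) hψ
  have h := intervalIntegral.integral_eq_sub_of_hasDerivAt (a := Real.pi / 2) (b := ψ)
    (f := fun ψ => -Real.arctan (Real.cos ψ / √(β * Real.sin ψ ^ 2 - 1)))
    (f' := fun ψ => 1 / (√(β * Real.sin ψ ^ 2 - 1) * Real.sin ψ))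
    (fun x hx => hasDerivAt_neg_arctan (sin_pos_of_mem_Ioo_symm hδ₁ (hsub hx))
      (one_lt_mul_sin_sq hδ₁ hβ (hsub hx))) ?_
  · unfold Phi
    rw [h]; simp
  · refine ContinuousOn.intervalIntegrable fun x hx => ContinuousAt.continuousWithinAt ?_
    have h1 := sin_pos_of_mem_Ioo_symm hδ₁ (hsub hx)
    have h2 := one_lt_mul_sin_sq hδ₁ hβ (hsub hx)
    have h3 : √(β * Real.sin x ^ 2 - 1) ≠ 0 := (Real.sqrt_pos.2 (by linarith)).ne'
    exact ContinuousAt.div (by fun_prop) (by fun_prop) (mul_ne_zero h3 h1.ne')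

lemma hasDerivAt_Phi {ψ : ℝ} (hψ : ψ ∈ Ioo δ₁ (Real.pi - δ₁)) :
    HasDerivAt (Phi β) (1 / (√(β * Real.sin ψ ^ 2 - 1) * Real.sin ψ)) ψ :=
  (hasDerivAt_neg_arctan (sin_pos_of_mem_Ioo_symm hδ₁ hψ)
    (one_lt_mul_sin_sq hδ₁ hβ hψ)).congr_of_eventuallyEq
    (eventually_of_mem (Ioo_mem_nhds hψ.1 hψ.2) fun _ h => Phi_eq_neg_arctan hδ₁ hβ h)

lemma contDiffOn_Phi : ContDiffOn ℝ ∞ (Phi β) (Ioo δ₁ (Real.pi - δ₁)) := by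
  refine ContDiffOn.congr (f := fun ψ => -Real.arctan (Real.cos ψ / √(β * Real.sin ψ ^ 2 - 1)))
    (fun x hx => ContDiffAt.contDiffWithinAt ?_) fun x hx => Phi_eq_neg_arctan hδ₁ hβ hx
  have h2 := one_lt_mul_sin_sq hδ₁ hβ hx
  have h3 : β * Real.sin x ^ 2 - 1 ≠ 0 := by linarith
  have h4 : √(β * Real.sin x ^ 2 - 1) ≠ 0 := (Real.sqrt_pos.2 (by linarith)).ne'
  have h5 : ContDiffAt ℝ ∞ (fun ψ => β * Real.sin ψ ^ 2 - 1) x :=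
    (contDiffAt_const.mul (Real.contDiff_sin.contDiffAt.pow 2)).sub contDiffAt_const
  exact (ContDiffAt.arctan (Real.contDiff_cos.contDiffAt.div (h5.sqrt h3) h4)).neg

omit hδ₁ hβ in
lemma sqrt_mul_sqrt_inv (hβ : 1 < β) : √(β / (β - 1)) * √((β - 1) / β) = 1 := by
  have h : 0 < β - 1 := by linarith
  rw [← Real.sqrt_mul (by positivity)]
  field_simp
  simp

/-- `β sin² δ₁ ≥ 1` says `β cos² δ₁ ≤ β - 1`. Equality, for the critical `β`, means `F(δ₁) = 0`. -/
lemma abs_sqrt_mul_cos_le_one : √(β / (β - 1)) * Real.cos δ₁ ≤ 1 := by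
  have h1 := one_le_mul_sin_sq hδ₁ hβ
  have h2 := one_lt_beta hδ₁ hβ
  have h3 : 0 < β - 1 := by linarith
  rw [Real.sin_sq] at h1
  refine (abs_le_one_iff_mul_self_le_one.2 ?_ |> (le_abs_self _).trans)
  rw [mul_mul_mul_comm, Real.mul_self_sqrt (by positivity), div_mul_eq_mul_div, div_le_one h3]
  nlinarith

omit hβ in
lemma cos_mem_Ioo {ψ : ℝ} (hψ : ψ ∈ Ioo δ₁ (Real.pi - δ₁)) :
    Real.cos ψ ∈ Ioo (-Real.cos δ₁) (Real.cos δ₁) := by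
  constructor
  · rw [← Real.cos_pi_sub]
    exact Real.strictAntiOn_cos ⟨by linarith [hδ₁.1, hψ.1], by linarith [hψ.2, hδ₁.1]⟩
      ⟨by linarith [hδ₁.2, Real.pi_pos], by linarith [hδ₁.1]⟩ hψ.2
  · exact Real.strictAntiOn_cos ⟨hδ₁.1.le, by linarith [hδ₁.2, Real.pi_pos]⟩
      ⟨by linarith [hδ₁.1, hψ.1], by linarith [hψ.2, hδ₁.1]⟩ hψ.1

lemma abs_sqrt_mul_cos_lt_one {ψ : ℝ} (hψ : ψ ∈ Ioo δ₁ (Real.pi - δ₁)) :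
    √(β / (β - 1)) * Real.cos ψ ∈ Ioo (-1) 1 := by
  have h1 := cos_mem_Ioo hδ₁ hψ
  have h2 := abs_sqrt_mul_cos_le_one hδ₁ hβ
  have h3 := one_lt_beta hδ₁ hβ
  have h4 : 0 < √(β / (β - 1)) := Real.sqrt_pos.2 (div_pos (by linarith) (by linarith))
  constructor <;> nlinarith [h1.1, h1.2]

lemma cos_hopfCole {ψ : ℝ} (hψ : ψ ∈ Ioo δ₁ (Real.pi - δ₁)) :
    Real.cos (hopfCole β ψ) = √(β / (β - 1)) * Real.cos ψ := by
  have := abs_sqrt_mul_cos_lt_one hδ₁ hβ hψ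
  exact Real.cos_arccos this.1.le this.2.le

/-- `F` is increasing, as a composition of two decreasing functions, and satisfies `F(π - ψ) = π -
F(ψ)`. -/
lemma hopfCole_mem_Ioo {ψ : ℝ} (hψ : ψ ∈ Ioo δ₁ (Real.pi - δ₁)) :
    hopfCole β ψ ∈ Ioo (hopfCole β δ₁) (Real.pi - hopfCole β δ₁) := by
  have h1 := cos_mem_Ioo hδ₁ hψ
  have h2 := abs_sqrt_mul_cos_le_one hδ₁ hβ
  have h3 := one_lt_beta hδ₁ hβ
  have h4 : 0 < √(β / (β - 1)) := Real.sqrt_pos.2 (div_pos (by linarith) (by linarith))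
  have h5 := abs_sqrt_mul_cos_lt_one hδ₁ hβ hψ
  have h6 : 0 < Real.cos δ₁ := by linarith [h1.1, h1.2]
  have h7 : 0 < √(β / (β - 1)) * Real.cos δ₁ := by positivity
  unfold hopfCole
  rw [← Real.arccos_neg]
  constructor
  · exact Real.strictAntiOn_arccos ⟨h5.1.le, h5.2.le⟩ ⟨by linarith, h2⟩
      (mul_lt_mul_of_pos_left h1.2 h4)
  · refine Real.strictAntiOn_arccos ⟨by linarith, by linarith⟩ ⟨h5.1.le, h5.2.le⟩ ?_
    rw [← mul_neg]
    exact mul_lt_mul_of_pos_left h1.1 h4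

omit hδ₁ hβ in
lemma hopfCole_nonneg : 0 ≤ hopfCole β δ₁ := Real.arccos_nonneg _

omit hδ₁ hβ in
lemma sqrt_div_lt_one (hβ : 1 < β) : √((β - 1) / β) < 1 := by
  rw [Real.sqrt_lt' one_pos, div_lt_iff₀ (by linarith)]
  linarith

omit hδ₁ hβ in
lemma sqrt_div_mul_cos_mem (hβ : 1 < β) (v : ℝ) : √((β - 1) / β) * Real.cos v ∈ Ioo (-1) 1 := by
  have h1 := sqrt_div_lt_one hβ
  have h2 := Real.sqrt_nonneg ((β - 1) / β)
  have h3 := Real.neg_one_le_cos v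
  have h4 := Real.cos_le_one v
  constructor <;> nlinarith

omit hδ₁ hβ in
lemma cos_hopfColeInv (hβ : 1 < β) (v : ℝ) :
    Real.cos (hopfColeInv β v) = √((β - 1) / β) * Real.cos v :=
  Real.cos_arccos (sqrt_div_mul_cos_mem hβ v).1.le (sqrt_div_mul_cos_mem hβ v).2.le

omit hδ₁ hβ in
lemma hopfCole_hopfColeInv (hβ : 1 < β) {v : ℝ} (hv : v ∈ Icc 0 Real.pi) :
    hopfCole β (hopfColeInv β v) = v := by
  unfold hopfCole
  rw [cos_hopfColeInv hβ, ← mul_assoc, sqrt_mul_sqrt_inv hβ, one_mul]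
  exact Real.arccos_cos hv.1 hv.2

/-- On cosines the two substitutions are inverse scalings, so the endpoints `F(δ₁)` and `π - F(δ₁)`
return to `δ₁` and `π - δ₁`; monotonicity does the rest. -/
lemma hopfColeInv_mem_Ioo {v : ℝ} (hv : v ∈ Ioo (hopfCole β δ₁) (Real.pi - hopfCole β δ₁)) :
    hopfColeInv β v ∈ Ioo δ₁ (Real.pi - δ₁) := by
  have h0 := one_lt_beta hδ₁ hβ
  have hn : 0 ≤ hopfCole β δ₁ := hopfCole_nonneg
  have h2 := abs_sqrt_mul_cos_le_one hδ₁ hβ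
  have h3 : 0 < √((β - 1) / β) := Real.sqrt_pos.2 (div_pos (by linarith) (by linarith))
  have hc : 0 < Real.cos δ₁ := Real.cos_pos_of_mem_Ioo ⟨by linarith [hδ₁.1, Real.pi_pos], hδ₁.2⟩
  have h4 : Real.cos (hopfCole β δ₁) = √(β / (β - 1)) * Real.cos δ₁ :=
    Real.cos_arccos (by have := Real.sqrt_nonneg (β / (β - 1)); nlinarith) h2
  have h5 : √((β - 1) / β) * Real.cos (hopfCole β δ₁) = Real.cos δ₁ := by
    rw [h4, ← mul_assoc, mul_comm √((β - 1) / β), sqrt_mul_sqrt_inv h0, one_mul]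
  have h6 : Real.arccos (Real.cos δ₁) = δ₁ :=
    Real.arccos_cos hδ₁.1.le (by linarith [hδ₁.2, Real.pi_pos])
  have h7 := sqrt_div_mul_cos_mem h0 v
  have h8 : Real.cos v < Real.cos (hopfCole β δ₁) :=
    Real.strictAntiOn_cos ⟨hn, by linarith [hv.1, hv.2]⟩ ⟨by linarith [hv.1], by linarith [hv.2]⟩ hv.1
  have h9 : -Real.cos (hopfCole β δ₁) < Real.cos v := by
    rw [← Real.cos_pi_sub]
    exact Real.strictAntiOn_cos ⟨by linarith [hv.1], by linarith [hv.2]⟩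
      ⟨by linarith [hv.1, hv.2], by linarith⟩ hv.2
  have h10 := Real.cos_le_one δ₁
  unfold hopfColeInv
  constructor
  · nth_rw 1 [← h6]
    exact Real.strictAntiOn_arccos ⟨h7.1.le, h7.2.le⟩ ⟨by linarith, h10⟩ (by nlinarith)
  · rw [show Real.pi - δ₁ = Real.pi - Real.arccos (Real.cos δ₁) by rw [h6], ← Real.arccos_neg]
    exact Real.strictAntiOn_arccos ⟨by linarith, by linarith⟩ ⟨h7.1.le, h7.2.le⟩ (by nlinarith)

/-- With `r² = β sin² ψ - 1`, the arctangent formula gives `sin ψ cos Φ = r / √(β - 1) = sin F(ψ)`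
and `sin ψ sin Φ = -cos ψ / √(β - 1)`, which is `-cos F(ψ) / √β`. All nonlinearity of the director
is thereby put into a fixed curve. -/
lemma sph_Phi_eq_greatCircle {ψ : ℝ} (hψ : ψ ∈ Ioo δ₁ (Real.pi - δ₁)) :
    sph ψ (Phi β ψ) = greatCircle β (hopfCole β ψ) := by
  have h0 := one_lt_beta hδ₁ hβ
  have hs := sin_pos_of_mem_Ioo_symm hδ₁ hψ
  have hD : 0 < β * Real.sin ψ ^ 2 - 1 := by linarith [one_lt_mul_sin_sq hδ₁ hβ hψ]
  have hr : 0 < √(β * Real.sin ψ ^ 2 - 1) := Real.sqrt_pos.2 hD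
  have hr2 : √(β * Real.sin ψ ^ 2 - 1) ^ 2 = β * Real.sin ψ ^ 2 - 1 := Real.sq_sqrt hD.le
  have hb : 0 < √(β - 1) := Real.sqrt_pos.2 (by linarith)
  have hb2 : √(β - 1) ^ 2 = β - 1 := Real.sq_sqrt (by linarith)
  have hβ0 : 0 < √β := Real.sqrt_pos.2 (by linarith)
  have hβ2 : √β ^ 2 = β := Real.sq_sqrt (by linarith)
  have hsc := Real.sin_sq_add_cos_sq ψ
  have e1 : √(1 + (Real.cos ψ / √(β * Real.sin ψ ^ 2 - 1)) ^ 2)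
      = √(β - 1) * Real.sin ψ / √(β * Real.sin ψ ^ 2 - 1) := by
    rw [Real.sqrt_eq_iff_mul_self_eq (by positivity) (by positivity)]
    field_simp
    rw [hb2, hr2]
    linear_combination hsc
  have e2 : √(β / (β - 1)) = √β / √(β - 1) := Real.sqrt_div (by linarith) _
  have e3 : √((β - 1) / β) = √(β - 1) / √β := Real.sqrt_div (by linarith) _
  have e4 : Real.sin (hopfCole β ψ) = √(β * Real.sin ψ ^ 2 - 1) / √(β - 1) := by
    unfold hopfCole
    rw [Real.sin_arccos, e2, Real.sqrt_eq_iff_mul_self_eq _ (by positivity)]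
    · field_simp
      rw [hr2, hβ2, hb2]
      linear_combination -β * hsc
    · have := abs_sqrt_mul_cos_lt_one hδ₁ hβ hψ
      rw [e2] at this
      nlinarith [this.1, this.2]
  unfold sph greatCircle
  rw [Phi_eq_neg_arctan hδ₁ hβ hψ, cos_hopfCole hδ₁ hβ hψ, Real.cos_neg, Real.sin_neg,
    Real.cos_arctan, Real.sin_arctan, e1, e2, e3, e4]
  generalize √(β * Real.sin ψ ^ 2 - 1) = r at *
  ext i
  fin_cases i
  · simp
    field_simp
  · simp only [Fin.mk_one, Matrix.cons_val_one, Matrix.cons_val_zero]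
    field_simp
  · simp
    field_simp

end

/-! ### Derivatives of the substitutions -/

lemma sin_hopfColeInv_pos {β : ℝ} (hβ : 1 < β) (v : ℝ) : 0 < Real.sin (hopfColeInv β v) := by
  have h := sqrt_div_mul_cos_mem hβ v
  rw [hopfColeInv, Real.sin_arccos]
  exact Real.sqrt_pos.2 (by nlinarith [h.1, h.2])

lemma hasDerivAt_hopfColeInv {β : ℝ} (hβ : 1 < β) (v : ℝ) :
    HasDerivAt (hopfColeInv β)
      (√((β - 1) / β) * Real.sin v / Real.sin (hopfColeInv β v)) v := by
  have h := sqrt_div_mul_cos_mem hβ v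
  have h1 := (Real.hasDerivAt_arccos h.1.ne' h.2.ne).comp v
    ((Real.hasDerivAt_cos v).const_mul √((β - 1) / β))
  refine h1.congr_deriv ?_
  rw [hopfColeInv, Real.sin_arccos]
  ring

lemma hasDerivAt_deriv_hopfColeInv {β : ℝ} (hβ : 1 < β) (v : ℝ) :
    HasDerivAt (fun v => √((β - 1) / β) * Real.sin v / Real.sin (hopfColeInv β v))
      (Real.cos (hopfColeInv β v) / Real.sin (hopfColeInv β v)
        * (1 - (√((β - 1) / β) * Real.sin v / Real.sin (hopfColeInv β v)) ^ 2)) v := by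
  have hs := sin_hopfColeInv_pos hβ v
  have h1 := ((Real.hasDerivAt_sin v).const_mul √((β - 1) / β)).fun_div
    (hasDerivAt_hopfColeInv hβ v).sin hs.ne'
  refine h1.congr_deriv ?_
  rw [← cos_hopfColeInv hβ]
  field_simp

/-- The second derivative of the inverse substitution in terms of the first. -/
lemma deriv_deriv_hopfColeInv_eq {β : ℝ} (hβ : 1 < β) {v : ℝ} (hv : Real.sin v ≠ 0) :
    Real.cos (hopfColeInv β v) / Real.sin (hopfColeInv β v)
        * (1 - (√((β - 1) / β) * Real.sin v / Real.sin (hopfColeInv β v)) ^ 2)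
      = Real.cos (hopfColeInv β v) / ((β * Real.sin (hopfColeInv β v) ^ 2 - 1)
        * Real.sin (hopfColeInv β v))
        * (√((β - 1) / β) * Real.sin v / Real.sin (hopfColeInv β v)) ^ 2 := by
  have hs := sin_hopfColeInv_pos hβ v
  have h1 : √((β - 1) / β) ^ 2 = (β - 1) / β :=
    Real.sq_sqrt (div_nonneg (by linarith) (by linarith))
  -- With `G` the inverse substitution, this identity gives `1 - G'² = G'² / (β sin² G - 1)`.
  have h2 : β * Real.sin (hopfColeInv β v) ^ 2 - 1 = (β - 1) * Real.sin v ^ 2 := by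
    rw [Real.sin_sq (hopfColeInv β v), cos_hopfColeInv hβ, mul_pow, h1, Real.cos_sq']
    field_simp
    ring
  rw [h2, div_pow, mul_pow, h1]
  have h3 : β - 1 ≠ 0 := by linarith
  field_simp
  linear_combination Real.cos (hopfColeInv β v) * h2

/-- The slope is bounded on the interval when `β > 1 / sin² δ₁`; for the critical `β` it blows up at
the endpoints, and the initial elastic energy may be infinite. -/
lemma hasDerivAt_hopfCole {δ₁ β : ℝ} (hδ₁ : δ₁ ∈ Ioo 0 (Real.pi / 2))
    (hβ : 1 / Real.sin δ₁ ^ 2 ≤ β) {ψ : ℝ} (hψ : ψ ∈ Ioo δ₁ (Real.pi - δ₁)) :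
    HasDerivAt (hopfCole β) (√β * Real.sin ψ / √(β * Real.sin ψ ^ 2 - 1)) ψ := by
  have h0 := one_lt_beta hδ₁ hβ
  have h := abs_sqrt_mul_cos_lt_one hδ₁ hβ hψ
  have hD : 0 < β * Real.sin ψ ^ 2 - 1 := by linarith [one_lt_mul_sin_sq hδ₁ hβ hψ]
  have hb : 0 < √(β - 1) := Real.sqrt_pos.2 (by linarith)
  have h1 := (Real.hasDerivAt_arccos h.1.ne' h.2.ne).comp ψ
    ((Real.hasDerivAt_cos ψ).const_mul √(β / (β - 1)))
  refine h1.congr_deriv ?_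
  have e2 : √(β / (β - 1)) = √β / √(β - 1) := Real.sqrt_div (by linarith) _
  have e4 : √(1 - (√(β / (β - 1)) * Real.cos ψ) ^ 2) = √(β * Real.sin ψ ^ 2 - 1) / √(β - 1) := by
    rw [← Real.sqrt_div hD.le, mul_pow, Real.sq_sqrt (div_nonneg (by linarith) (by linarith)),
      Real.sin_sq]
    congr 1
    have : β - 1 ≠ 0 := by linarith
    field_simp
    ring
  have hr : 0 < √(β * Real.sin ψ ^ 2 - 1) := Real.sqrt_pos.2 hD
  rw [e4, e2]
  field_simp

lemma contDiffOn_hopfCole {δ₁ β : ℝ} (hδ₁ : δ₁ ∈ Ioo 0 (Real.pi / 2))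
    (hβ : 1 / Real.sin δ₁ ^ 2 ≤ β) : ContDiffOn ℝ ∞ (hopfCole β) (Ioo δ₁ (Real.pi - δ₁)) := by
  intro ψ hψ
  have h := abs_sqrt_mul_cos_lt_one hδ₁ hβ hψ
  exact ((Real.contDiffAt_arccos h.1.ne' h.2.ne).comp ψ
    (contDiffAt_const.mul Real.contDiff_cos.contDiffAt)).contDiffWithinAt

/-! ### Calculus of radial functions -/

variable {n : ℕ}

/-- The function depends only on the norm. -/
def IsRadial (f : EuclideanSpace ℝ (Fin n) → ℝ) : Prop := ∀ ⦃x y⦄, ‖x‖ = ‖y‖ → f x = f y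

/-- `|x + s w| = |x - s w|` when `w ⊥ x`, so the derivative along `w` equals its own negative. -/
lemma IsRadial.fderiv_apply_of_inner_eq_zero {f : EuclideanSpace ℝ (Fin n) → ℝ} (hf : IsRadial f)
    {x w : EuclideanSpace ℝ (Fin n)} (hd : DifferentiableAt ℝ f x) (h : inner ℝ x w = 0) :
    fderiv ℝ f x w = 0 := by
  have h1 := hasDerivAt_add_smul hd w
  have h2 := hasDerivAt_add_smul hd (-w)
  have h3 : (fun s : ℝ => f (x + s • -w)) = fun s => f (x + s • w) := by
    ext s
    apply hf
    rw [smul_neg, ← sub_eq_add_neg, ← sq_eq_sq₀ (norm_nonneg _) (norm_nonneg _),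
      norm_sub_sq_real, norm_add_sq_real, inner_smul_right, h]
    ring
  rw [h3] at h2
  have h4 := h1.unique h2
  rw [map_neg] at h4
  linarith

lemma IsRadial.fderiv_zero {f : EuclideanSpace ℝ (Fin n) → ℝ} (hf : IsRadial f)
    (hd : DifferentiableAt ℝ f 0) : fderiv ℝ f 0 = 0 := by
  ext w
  exact hf.fderiv_apply_of_inner_eq_zero hd (inner_zero_left _)

/-- The vector `|x|² w - ⟨x, w⟩ x` is orthogonal to `x`. Multiplying by `|x|²` avoids excluding the
origin. -/
lemma IsRadial.norm_sq_mul_fderiv_apply {f : EuclideanSpace ℝ (Fin n) → ℝ} (hf : IsRadial f)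
    {x : EuclideanSpace ℝ (Fin n)} (hd : DifferentiableAt ℝ f x) (w : EuclideanSpace ℝ (Fin n)) :
    ‖x‖ ^ 2 * fderiv ℝ f x w = inner ℝ x w * fderiv ℝ f x x := by
  have h := hf.fderiv_apply_of_inner_eq_zero hd (w := ‖x‖ ^ 2 • w - inner ℝ x w • x) (by
    rw [inner_sub_right, inner_smul_right, inner_smul_right, real_inner_self_eq_norm_sq]; ring)
  simp only [map_sub, map_smul, smul_eq_mul] at h
  linarith

lemma IsRadial.norm_sq_mul_partialDeriv {f : EuclideanSpace ℝ (Fin n) → ℝ} (hf : IsRadial f)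
    {x : EuclideanSpace ℝ (Fin n)} (hd : DifferentiableAt ℝ f x) (i : Fin n) :
    ‖x‖ ^ 2 * partialDeriv i f x = x i * fderiv ℝ f x x := by
  have := hf.norm_sq_mul_fderiv_apply hd (EuclideanSpace.single i 1)
  simpa [EuclideanSpace.inner_single_right, partialDeriv] using this

lemma hasDerivAt_comp_smul {f : EuclideanSpace ℝ (Fin n) → ℝ} {x : EuclideanSpace ℝ (Fin n)} {c : ℝ}
    (hd : DifferentiableAt ℝ f (c • x)) :
    HasDerivAt (fun c : ℝ => f (c • x)) (fderiv ℝ f (c • x) x) c := by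
  have hl : HasDerivAt (fun s : ℝ => s • x) x c := by
    simpa using (hasDerivAt_id c).smul_const x
  exact HasFDerivAt.comp_hasDerivAt c hd.hasFDerivAt hl

lemma IsRadial.fderiv_self {f : EuclideanSpace ℝ (Fin n) → ℝ} (hf : IsRadial f)
    (hd : Differentiable ℝ f) : IsRadial fun x => fderiv ℝ f x x := by
  intro x y hxy
  have h1 := hasDerivAt_comp_smul (x := x) (hd ((1 : ℝ) • x))
  have h2 := hasDerivAt_comp_smul (x := y) (hd ((1 : ℝ) • y))
  have h3 : (fun c : ℝ => f (c • x)) = fun c => f (c • y) :=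
    funext fun c => hf (by rw [norm_smul, norm_smul, hxy])
  rw [h3] at h1
  simpa using h1.unique h2

/-- A radial function whose radial derivative is `‖x‖ q x` has the gradient `q x • x`. -/
lemma IsRadial.partialDeriv_eq_mul {f : EuclideanSpace ℝ (Fin n) → ℝ} (hf : IsRadial f)
    (hd : Differentiable ℝ f) {x : EuclideanSpace ℝ (Fin n)} {q : ℝ}
    (h : x ≠ 0 → fderiv ℝ f x x = ‖x‖ ^ 2 * q) (i : Fin n) : partialDeriv i f x = x i * q := by
  by_cases hx : x = 0
  · simp [hx, partialDeriv, hf.fderiv_zero (hd 0)]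
  · have h1 := hf.norm_sq_mul_partialDeriv (hd x) i
    rw [h hx] at h1
    have h2 : ‖x‖ ^ 2 ≠ 0 := by simpa using hx
    apply mul_left_cancel₀ h2
    linear_combination h1

lemma contDiff_partialDeriv {f : EuclideanSpace ℝ (Fin n) → ℝ} (hf : ContDiff ℝ ∞ f) (i : Fin n) :
    ContDiff ℝ ∞ (partialDeriv i f) :=
  (hf.fderiv_right (m := ∞) (by simp)).clm_apply contDiff_const

/-- The second derivative of a radial function in a direction perpendicular to the position. -/
lemma IsRadial.norm_sq_mul_partialDeriv_partialDeriv {f : EuclideanSpace ℝ (Fin n) → ℝ}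
    (hf : IsRadial f) (hs : ContDiff ℝ ∞ f) {x : EuclideanSpace ℝ (Fin n)} {j : Fin n}
    (hj : x j = 0) : fderiv ℝ f x x = ‖x‖ ^ 2 * partialDeriv j (partialDeriv j f) x := by
  have hd : Differentiable ℝ f := hs.differentiable (by simp)
  let e : EuclideanSpace ℝ (Fin n) := EuclideanSpace.single j (1 : ℝ)
  have h1 := hasDerivAt_add_smul ((contDiff_partialDeriv hs j).differentiable (by simp) x) e
  have hl : HasDerivAt (fun s : ℝ => x + s • e) e 0 := by
    simpa using ((hasDerivAt_id (0 : ℝ)).smul_const e).const_add x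
  -- The identity `|y|² ∂_j f = y_j (y · ∇f)` on the line `y = x + s e_j`, where `y_j = s`; it is
  -- differentiated at `s = 0`.
  have h2 : ∀ s : ℝ, ‖x + s • e‖ ^ 2 * partialDeriv j f (x + s • e)
      = s * fderiv ℝ f (x + s • e) (x + s • e) := fun s => by
    rw [hf.norm_sq_mul_partialDeriv (hd _) j]
    simp [e, hj]
  have h3 : HasDerivAt (fun s : ℝ => ‖x + s • e‖ ^ 2) 0 0 := by
    simpa [e, EuclideanSpace.inner_single_right, hj] using hl.norm_sq
  have h4 : DifferentiableAt ℝ (fun s : ℝ => fderiv ℝ f (x + s • e) (x + s • e)) 0 := by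
    have : ContDiff ℝ ∞ fun y => fderiv ℝ f y y :=
      (hs.fderiv_right (m := ∞) (by simp)).clm_apply contDiff_id
    have h5 := this.differentiable (by simp) (x + (0 : ℝ) • e)
    exact h5.comp (0 : ℝ) hl.differentiableAt
  have h5 := (hasDerivAt_id (0 : ℝ)).mul h4.hasDerivAt
  have h6 := h3.mul h1
  have h7 : ((fun s : ℝ => ‖x + s • e‖ ^ 2) * fun s => partialDeriv j f (x + s • e))
      = id * fun s => fderiv ℝ f (x + s • e) (x + s • e) := funext h2
  rw [h7] at h6
  have h8 := h5.unique h6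
  simpa [e, partialDeriv] using h8

/-- The transverse second derivative is `f_r / r`, in a form that makes sense at the origin. -/
lemma IsRadial.partialDeriv_eq_mul_partialDeriv {f : EuclideanSpace ℝ (Fin n) → ℝ}
    (hf : IsRadial f) (hs : ContDiff ℝ ∞ f) {x : EuclideanSpace ℝ (Fin n)} {j : Fin n}
    (hj : x j = 0) (i : Fin n) :
    partialDeriv i f x = x i * partialDeriv j (partialDeriv j f) x :=
  hf.partialDeriv_eq_mul (hs.differentiable (by simp))
    (fun _ => hf.norm_sq_mul_partialDeriv_partialDeriv hs hj) i

/-! ### Radial averages -/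

/-- The average `∫₀¹ σ g (σ x) dσ`. -/
def radialMean (g : EuclideanSpace ℝ (Fin n) → ℝ) (x : EuclideanSpace ℝ (Fin n)) : ℝ :=
  ∫ σ in (0 : ℝ)..1, σ * g (σ • x)

/-- The average is the value at `0` of the convolution of `σ 1_{(0,1]}` with a smooth, compactly
supported function depending smoothly on the parameters. -/
lemma contDiffOn_radialMean {g : ℝ → EuclideanSpace ℝ (Fin n) → ℝ} {s : Set ℝ} (hs : IsOpen s)
    (hg : ContDiffOn ℝ ∞ (fun z : ℝ × EuclideanSpace ℝ (Fin n) => g z.1 z.2) (s ×ˢ univ)) :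
    ContDiffOn ℝ ∞ (fun z : ℝ × EuclideanSpace ℝ (Fin n) => radialMean (g z.1) z.2)
      (s ×ˢ univ) := by
  let χ : ContDiffBump (0 : ℝ) := ⟨1, 2, one_pos, one_lt_two⟩
  let f : ℝ → ℝ := indicator (Ioc 0 1) id
  -- The cutoff is `1` on `[-1, 1]` and only supplies compact support. The sign of `σ` is reversed
  -- because a convolution at `0` evaluates `G` at `-σ`.
  let G : ℝ × EuclideanSpace ℝ (Fin n) → ℝ → ℝ := fun p σ => χ σ * g p.1 (-σ • p.2)
  have hf : LocallyIntegrable f volume := by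
    refine Integrable.locallyIntegrable ?_
    rw [integrable_indicator_iff measurableSet_Ioc]
    exact (continuous_id.integrableOn_Icc (a := 0) (b := 1)).mono_set Ioc_subset_Icc_self
  have hG : ContDiffOn ℝ ∞ (↿G) ((s ×ˢ univ) ×ˢ univ) := by
    refine ContDiffOn.mul (χ.contDiff.comp contDiff_snd).contDiffOn ?_
    refine hg.comp (t := s ×ˢ univ) (f := fun q : (ℝ × EuclideanSpace ℝ (Fin n)) × ℝ =>
      (q.1.1, -q.2 • q.1.2)) ?_ fun q hq => ⟨hq.1.1, mem_univ _⟩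
    exact (contDiff_fst.fst.prodMk (contDiff_snd.neg.smul contDiff_fst.snd)).contDiffOn
  have key := contDiffOn_convolution_right_with_param (μ := volume) (n := ⊤)
    (ContinuousLinearMap.lsmul ℝ ℝ : ℝ →L[ℝ] ℝ →L[ℝ] ℝ) (g := G)
    (k := Metric.closedBall 0 2) (hs.prod isOpen_univ) (isCompact_closedBall _ _)
    (fun p σ _ hσ => by
      have : χ σ = 0 := χ.zero_of_le_dist (not_le.1 hσ).le
      simp [G, this]) hf hG
  have h2 : ContDiffOn ℝ ∞ (fun z : ℝ × EuclideanSpace ℝ (Fin n) => (z, (0 : ℝ))) (s ×ˢ univ) :=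
    (contDiff_id.prodMk contDiff_const).contDiffOn
  refine (key.comp h2 fun z hz => ⟨hz, mem_univ _⟩).congr fun z hz => ?_
  simp only [convolution, Function.comp, zero_sub, ContinuousLinearMap.lsmul_apply, smul_eq_mul]
  rw [radialMean, intervalIntegral.integral_of_le zero_le_one, ← integral_indicator measurableSet_Ioc]
  refine integral_congr_ae (ae_of_all _ fun σ => ?_)
  by_cases hσ : σ ∈ Ioc (0 : ℝ) 1
  · have : χ (-σ) = 1 := χ.one_of_mem_closedBall (by
      simpa [abs_le] using ⟨by linarith [hσ.1, hσ.2], hσ.2⟩)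
    simp [f, G, hσ, this]
  · simp [f, hσ]

lemma IsRadial.radialMean {g : EuclideanSpace ℝ (Fin n) → ℝ} (hg : IsRadial g) :
    IsRadial (radialMean g) := fun x y h => by
  unfold LiquidCrystal.radialMean
  congr 1
  ext σ
  rw [hg (show ‖σ • x‖ = ‖σ • y‖ by rw [norm_smul, norm_smul, h])]

lemma sq_mul_radialMean_smul (g : EuclideanSpace ℝ (Fin n) → ℝ) (c : ℝ)
    (x : EuclideanSpace ℝ (Fin n)) :
    c ^ 2 * radialMean g (c • x) = ∫ τ in (0 : ℝ)..c, τ * g (τ • x) := by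
  have h := intervalIntegral.mul_integral_comp_mul_left (a := 0) (b := 1)
    (f := fun τ : ℝ => τ * g (τ • x)) c
  rw [mul_zero, mul_one] at h
  rw [← h, radialMean, sq, mul_assoc]
  congr 1
  rw [← intervalIntegral.integral_const_mul]
  congr 1
  ext σ
  rw [smul_smul, mul_comm σ c]
  ring

/-- The radial antiderivative `‖x‖² ∫₀¹ σ g (σ x) dσ` of a radial function. -/
lemma partialDeriv_norm_sq_mul_radialMean {g : EuclideanSpace ℝ (Fin n) → ℝ} (hg : IsRadial g)
    (hc : Continuous g) (hd : Differentiable ℝ fun x => ‖x‖ ^ 2 * radialMean g x)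
    (x : EuclideanSpace ℝ (Fin n)) (i : Fin n) :
    partialDeriv i (fun x => ‖x‖ ^ 2 * radialMean g x) x = x i * g x := by
  have hr : IsRadial fun x => ‖x‖ ^ 2 * radialMean g x := fun x y h => by
    simp only [h, hg.radialMean h]
  refine hr.partialDeriv_eq_mul hd (fun _ => ?_) i
  have h1 := hasDerivAt_comp_smul (x := x) (hd ((1 : ℝ) • x))
  -- Along the ray through `x` the function is an integral with upper limit `c`; the fundamental
  -- theorem applies at `c = 1`.
  have h2 : (fun c : ℝ => ‖c • x‖ ^ 2 * radialMean g (c • x))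
      = fun c => ‖x‖ ^ 2 * ∫ τ in (0 : ℝ)..c, τ * g (τ • x) := by
    ext c
    rw [← sq_mul_radialMean_smul, norm_smul, mul_pow, Real.norm_eq_abs, sq_abs]
    ring
  rw [h2] at h1
  have h3 : Continuous fun τ : ℝ => τ * g (τ • x) := by fun_prop
  have h4 := (intervalIntegral.integral_hasDerivAt_right (h3.intervalIntegrable 0 1)
    h3.aestronglyMeasurable.stronglyMeasurableAtFilter h3.continuousAt).const_mul (‖x‖ ^ 2)
  simpa using h1.unique h4

/-- The radial derivative of a planar radial function as an average of its Laplacian. -/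
lemma IsRadial.fderiv_self_eq_radialMean {f : E2 → ℝ} (hf : IsRadial f) (hs : ContDiff ℝ ∞ f)
    {g : E2 → ℝ} (hg : IsRadial g)
    (hfg : ∀ x, g x = ∑ i, partialDeriv i (partialDeriv i f) x) (x : E2) :
    fderiv ℝ f x x = ‖x‖ ^ 2 * LiquidCrystal.radialMean g x := by
  have hd : Differentiable ℝ f := hs.differentiable (by simp)
  let e : E2 := EuclideanSpace.single 0 ‖x‖
  have he : ‖x‖ = ‖e‖ := by simp [e]
  rw [show fderiv ℝ f x x = fderiv ℝ f e e from hf.fderiv_self hd he, hg.radialMean he, he]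
  have hes : e = ‖e‖ • EuclideanSpace.single 0 (1 : ℝ) := by
    ext i; fin_cases i <;> simp [e]
  have hgc : Continuous g := by
    rw [funext hfg]
    exact continuous_finsetSum _ fun i _ =>
      (contDiff_partialDeriv (contDiff_partialDeriv hs i) i).continuous
  have hap : ∀ (u : E2 → ℝ) (y : E2), fderiv ℝ u y e = ‖e‖ * partialDeriv 0 u y := fun u y => by
    rw [hes, map_smul, ← hes, smul_eq_mul, partialDeriv]
  -- This is `(r f_r)_r = r Δf` on the first axis, where the second derivative across the axis
  -- supplies `f_r / r`.
  have hder : ∀ σ ∈ uIcc (0 : ℝ) 1, HasDerivAt (fun σ : ℝ => σ * (‖e‖ * partialDeriv 0 f (σ • e)))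
      (‖e‖ ^ 2 * (σ * g (σ • e))) σ := by
    intro σ _
    have h1 := hasDerivAt_comp_smul (x := e) (c := σ)
      ((contDiff_partialDeriv hs 0).differentiable (by simp) _)
    refine ((hasDerivAt_id σ).mul (h1.const_mul ‖e‖)).congr_deriv ?_
    rw [hap, hfg, Fin.sum_univ_two]
    have h2 := hf.partialDeriv_eq_mul_partialDeriv hs (x := σ • e) (j := 1) (by simp [e]) 0
    have h3 : (σ • e) 0 = σ * ‖e‖ := by simp [e]
    rw [h3] at h2
    simp only [id]
    linear_combination ‖e‖ * h2
  have := intervalIntegral.integral_eq_sub_of_hasDerivAt hder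
    (Continuous.intervalIntegrable (by fun_prop) _ _)
  rw [intervalIntegral.integral_const_mul] at this
  rw [hap, LiquidCrystal.radialMean, this]
  simp

/-! ### Radial classical solutions -/

/-- The rotation by a right angle. -/
def rotate : E2 →L[ℝ] E2 :=
  LinearMap.toContinuousLinearMap
    { toFun := fun x => !₂[-(x 1), x 0]
      map_add' := fun x y => by ext i; fin_cases i <;> simp; ring
      map_smul' := fun c x => by ext i; fin_cases i <;> simp }

lemma rotate_apply (x : E2) : rotate x = !₂[-(x 1), x 0] := rfl

lemma rotate_rotate (x : E2) : rotate (rotate x) = -x := by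
  ext i; fin_cases i <;> simp [rotate_apply]

lemma fderiv_eq_sum_partialDeriv {V : Type*} [NormedAddCommGroup V] [NormedSpace ℝ V] (f : E2 → V)
    (x w : E2) : fderiv ℝ f x w = ∑ i, w i • pd i f x := by
  have hw : w = ∑ i, w i • EuclideanSpace.single i (1 : ℝ) := by
    ext i; fin_cases i <;> simp
  conv_lhs => rw [hw]
  simp [pd]

lemma pd_eq_of_hasFDerivAt {V : Type*} [NormedAddCommGroup V] [NormedSpace ℝ V] {f : E2 → V}
    {f' : E2 →L[ℝ] V} {x : E2} (h : HasFDerivAt f f' x) (i : Fin 2) :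
    pd i f x = f' (EuclideanSpace.single i 1) := by rw [pd, h.fderiv]

lemma laplacian_eq_sum_pd {V : Type*} [NormedAddCommGroup V] [NormedSpace ℝ V] {f : E2 → V}
    (hf : ContDiff ℝ ∞ f) (x : E2) : Laplacian.laplacian f x = ∑ i, pd i (pd i f) x := by
  rw [InnerProductSpace.laplacian_eq_iteratedFDeriv_orthonormalBasis f
    (EuclideanSpace.basisFun (Fin 2) ℝ)]
  refine Finset.sum_congr rfl fun i _ => ?_
  rw [iteratedFDeriv_two_apply]
  have hd : DifferentiableAt ℝ (fderiv ℝ f) x :=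
    (hf.fderiv_right (m := ∞) (by simp)).differentiable (by simp) x
  have h := hd.hasFDerivAt.clm_apply (hasFDerivAt_const (EuclideanSpace.single i (1 : ℝ)) x)
  have h2 := pd_eq_of_hasFDerivAt h i
  rw [show pd i (pd i f) x = pd i (fun y => fderiv ℝ f y (EuclideanSpace.single i (1 : ℝ))) x
    from rfl, h2]
  simp

lemma gradient_apply_eq_pd {f : E2 → ℝ} {x : E2} (hf : DifferentiableAt ℝ f x) (i : Fin 2) :
    gradient f x i = pd i f x := by
  have h := hf.hasGradientAt.hasFDerivAt
  rw [pd_eq_of_hasFDerivAt h i, InnerProductSpace.toDual_apply_apply,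
    EuclideanSpace.inner_single_right]
  simp

lemma pd_smul {V : Type*} [NormedAddCommGroup V] [NormedSpace ℝ V] {f : E2 → ℝ} {g : E2 → V}
    {x : E2} (hf : DifferentiableAt ℝ f x) (hg : DifferentiableAt ℝ g x) (i : Fin 2) :
    pd i (fun y => f y • g y) x = f x • pd i g x + pd i f x • g x := by
  rw [pd_eq_of_hasFDerivAt (hf.hasFDerivAt.fun_smul hg.hasFDerivAt) i]
  simp [pd]

lemma pd_mul {f g : E2 → ℝ} {x : E2} (hf : DifferentiableAt ℝ f x) (hg : DifferentiableAt ℝ g x)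
    (i : Fin 2) : pd i (fun y => f y * g y) x = f x * pd i g x + pd i f x * g x :=
  pd_smul hf hg i

lemma pd_add {V : Type*} [NormedAddCommGroup V] [NormedSpace ℝ V] {f g : E2 → V}
    {x : E2} (hf : DifferentiableAt ℝ f x) (hg : DifferentiableAt ℝ g x) (i : Fin 2) :
    pd i (fun y => f y + g y) x = pd i f x + pd i g x := by
  rw [pd_eq_of_hasFDerivAt (hf.hasFDerivAt.fun_add hg.hasFDerivAt) i]
  simp [pd]

lemma pd_sub {V : Type*} [NormedAddCommGroup V] [NormedSpace ℝ V] {f g : E2 → V}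
    {x : E2} (hf : DifferentiableAt ℝ f x) (hg : DifferentiableAt ℝ g x) (i : Fin 2) :
    pd i (fun y => f y - g y) x = pd i f x - pd i g x := by
  rw [pd_eq_of_hasFDerivAt (hf.hasFDerivAt.fun_sub hg.hasFDerivAt) i]
  simp [pd]

lemma pd_coord (i j : Fin 2) (x : E2) : pd i (fun y : E2 => y j) x = if i = j then 1 else 0 := by
  have h : HasFDerivAt (fun y : E2 => y j) (EuclideanSpace.proj j : E2 →L[ℝ] ℝ) x :=
    (EuclideanSpace.proj j : E2 →L[ℝ] ℝ).hasFDerivAt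
  rw [pd_eq_of_hasFDerivAt h i]
  simp [eq_comm]

lemma pd_clm {V : Type*} [NormedAddCommGroup V] [NormedSpace ℝ V] (L : E2 →L[ℝ] V) (i : Fin 2)
    (x : E2) : pd i (fun y => L y) x = L (EuclideanSpace.single i 1) :=
  pd_eq_of_hasFDerivAt L.hasFDerivAt i

lemma pd_comp_real {V : Type*} [NormedAddCommGroup V] [NormedSpace ℝ V] {γ : ℝ → V} {γ' : V}
    {f : E2 → ℝ} {x : E2} (hγ : HasDerivAt γ γ' (f x)) (hf : DifferentiableAt ℝ f x) (i : Fin 2) :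
    pd i (fun y => γ (f y)) x = pd i f x • γ' := by
  have h : HasFDerivAt (fun y => γ (f y)) _ x := hγ.hasFDerivAt.comp x hf.hasFDerivAt
  rw [pd_eq_of_hasFDerivAt h i]
  simp [pd]

lemma ContDiff.pd {V : Type*} [NormedAddCommGroup V] [NormedSpace ℝ V] {f : E2 → V}
    (hf : ContDiff ℝ ∞ f) (i : Fin 2) : ContDiff ℝ ∞ (pd i f) :=
  (hf.fderiv_right (m := ∞) (by simp)).clm_apply contDiff_const

lemma norm_sq_pd_greatCircle_comp {β : ℝ} (hβ : 1 < β) {v : E2 → ℝ} {x : E2}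
    (hv : DifferentiableAt ℝ v x) (i : Fin 2) :
    ‖pd i (fun y => greatCircle β (v y)) x‖ = |pd i v x| := by
  rw [pd_comp_real (hasDerivAt_greatCircle β (v x)) hv, norm_smul, norm_greatCircleDeriv hβ,
    mul_one, Real.norm_eq_abs]

/-! ### Identities for radial fields at a fixed time -/

section Slice

variable {β : ℝ} (hβ : 1 < β) {v W Q R P : E2 → ℝ} (hvs : ContDiff ℝ ∞ v) (hWs : ContDiff ℝ ∞ W)
  (hQs : ContDiff ℝ ∞ Q) (hv : ∀ x i, pd i v x = x i * Q x) (hW : ∀ x i, pd i W x = x i * R x)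

include hW in
lemma fderiv_rotate_eq_zero (x : E2) : fderiv ℝ W x (rotate x) = 0 := by
  rw [fderiv_eq_sum_partialDeriv]
  simp [hW, rotate_apply]
  ring

include hWs hW in
-- `∇W` is parallel to `x`, hence orthogonal to `Jx`, and `J² = -1`; only the centripetal term
-- remains.
lemma convection_swirl (x : E2) :
    fderiv ℝ (fun y => W y • rotate y) x (W x • rotate x) = -(W x ^ 2 • x) := by
  rw [((hWs.differentiable (by simp) x).hasFDerivAt.fun_smul rotate.hasFDerivAt).fderiv]
  simp [fderiv_rotate_eq_zero hW, rotate_rotate, smul_smul, sq]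

include hWs hW in
-- `J` is linear, so besides `ΔW Jx` only the cross term `2 ∑ ∂_i W J e_i = 2 R Jx` occurs. For `R =
-- W_r / r` the factor is the radial Laplacian of `ℝ⁴`, with `1/r + 2/r = 3/r`.
lemma laplacian_swirl (x : E2) :
    Laplacian.laplacian (fun y => W y • rotate y) x
      = ((∑ i, pd i (pd i W) x) + 2 * R x) • rotate x := by
  have hdW := hWs.differentiable (by simp)
  rw [laplacian_eq_sum_pd (f := fun y => W y • rotate y) (hWs.smul rotate.contDiff)]
  have h1 : ∀ i, pd i (fun y => W y • rotate y)
      = fun y => W y • rotate (EuclideanSpace.single i 1) + pd i W y • rotate y := fun i => by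
    ext1 y
    rw [pd_smul (hdW y) rotate.differentiableAt, pd_clm]
  have h2 : ∀ i, pd i (pd i (fun y => W y • rotate y)) x
      = (2 * pd i W x) • rotate (EuclideanSpace.single i 1) + pd i (pd i W) x • rotate x := by
    intro i
    have hd1 : DifferentiableAt ℝ (pd i W) x := (ContDiff.pd hWs i).differentiable (by simp) x
    rw [h1, pd_add ((hdW x).smul_const _) (hd1.fun_smul rotate.differentiableAt),
      pd_smul (hdW x) (differentiableAt_const _), pd_smul hd1 rotate.differentiableAt, pd_clm]
    simp [pd, two_mul, add_smul]
    abel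
  simp_rw [h2, hW]
  rw [add_smul, Finset.sum_smul, Finset.sum_add_distrib, add_comm]
  congr 1
  ext i
  fin_cases i <;> simp [rotate_apply] <;> ring

include hWs hW in
lemma divergence_swirl (x : E2) : ∑ j : Fin 2, pd j (fun y => (W y • rotate y) j) x = 0 := by
  have hdW := hWs.differentiable (by simp)
  have h0 : (fun y : E2 => (W y • rotate y) 0) = fun y => W y * -(y 1) := by
    ext y; simp [rotate_apply]
  have h1 : (fun y : E2 => (W y • rotate y) 1) = fun y => W y * y 0 := by
    ext y; simp [rotate_apply]
  have h2 : pd 0 (fun y : E2 => -(y 1)) x = 0 := by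
    have := pd_coord 0 1 x
    simp only [pd] at this ⊢
    rw [fderiv_fun_neg]
    simpa using this
  rw [Fin.sum_univ_two, h0, h1, pd_mul (hdW x) (by fun_prop), pd_mul (hdW x) (by fun_prop), hW, hW,
    h2, pd_coord]
  simp
  ring

include hvs hv in
lemma convection_greatCircle (x : E2) :
    fderiv ℝ (fun y => greatCircle β (v y)) x (W x • rotate x) = 0 := by
  have h : HasFDerivAt (fun y => greatCircle β (v y)) _ x :=
    (hasDerivAt_greatCircle β (v x)).hasFDerivAt.comp x
      (hvs.differentiable (by simp) x).hasFDerivAt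
  rw [h.fderiv]
  simp [fderiv_rotate_eq_zero hv]

include hvs in
-- The normal component, from `γ'' = -γ`, is `-|∇d|² d`; the tangential one carries the heat
-- equation.
lemma laplacian_greatCircle (x : E2) :
    Laplacian.laplacian (fun y => greatCircle β (v y)) x
      = (∑ i, pd i (pd i v) x) • greatCircleDeriv β (v x)
        - (∑ i, pd i v x ^ 2) • greatCircle β (v x) := by
  have hdv := hvs.differentiable (by simp)
  rw [laplacian_eq_sum_pd (f := fun y => greatCircle β (v y))
    ((contDiff_greatCircle β).comp hvs)]
  have h1 : ∀ i, pd i (fun y => greatCircle β (v y))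
      = fun y => pd i v y • greatCircleDeriv β (v y) := fun i => funext fun y =>
    pd_comp_real (hasDerivAt_greatCircle β (v y)) (hdv y) i
  have h2 : ∀ i, pd i (pd i (fun y => greatCircle β (v y))) x
      = pd i (pd i v) x • greatCircleDeriv β (v x) - pd i v x ^ 2 • greatCircle β (v x) := by
    intro i
    have hd1 : DifferentiableAt ℝ (pd i v) x := (ContDiff.pd hvs i).differentiable (by simp) x
    have hd2 : DifferentiableAt ℝ (fun y => greatCircleDeriv β (v y)) x :=
      (hasDerivAt_greatCircleDeriv β (v x)).differentiableAt.comp x (hdv x)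
    rw [h1, pd_smul hd1 hd2, pd_comp_real (hasDerivAt_greatCircleDeriv β (v x)) (hdv x)]
    simp [smul_smul, sq]
    abel
  simp_rw [h2, Finset.sum_sub_distrib, Finset.sum_smul]

include hβ hvs in
lemma gradSq_greatCircle (x : E2) :
    gradSq (fun y => greatCircle β (v y)) x = ∑ i, pd i v x ^ 2 := by
  unfold gradSq
  refine Finset.sum_congr rfl fun i _ => ?_
  rw [norm_sq_pd_greatCircle_comp hβ (hvs.differentiable (by simp) x), sq_abs]

include hβ hvs hQs hv in
-- Unit speed gives `∂_i d · ∂_j d = ∂_i v ∂_j v = x_i x_j Q²`. For radial `Q` the divergence points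
-- along `x`.
lemma elasticForce_greatCircle (x : E2) (i : Fin 2) :
    elasticForce (fun y => greatCircle β (v y)) x i
      = x i * (∑ j, x j * pd j (fun y => Q y ^ 2) x) + 3 * Q x ^ 2 * x i := by
  have hdv := hvs.differentiable (by simp)
  have h1 : ∀ i j, (fun y => (inner ℝ (pd i (fun y => greatCircle β (v y)) y)
      (pd j (fun y => greatCircle β (v y)) y) : ℝ)) = fun y => y i * y j * Q y ^ 2 := by
    intro i j
    ext y
    rw [pd_comp_real (hasDerivAt_greatCircle β (v y)) (hdv y),
      pd_comp_real (hasDerivAt_greatCircle β (v y)) (hdv y), inner_smul_left, inner_smul_right,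
      real_inner_self_eq_norm_sq, norm_greatCircleDeriv hβ, hv, hv]
    simp
    ring
  have hdQ : DifferentiableAt ℝ (fun y => Q y ^ 2) x := (hQs.differentiable (by simp) x).pow 2
  have h2 : ∀ i j, pd j (fun y => y i * y j * Q y ^ 2) x
      = x i * x j * pd j (fun y => Q y ^ 2) x
        + (x i + (if j = i then 1 else 0) * x j) * Q x ^ 2 := by
    intro i j
    rw [pd_mul (by fun_prop) hdQ, pd_mul (by fun_prop) (by fun_prop), pd_coord, pd_coord]
    simp
  simp only [elasticForce, h1]
  simp_rw [h2, Fin.sum_univ_two]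
  fin_cases i <;> simp <;> ring

include hQs in
-- For radial `Q` one has `|x|² ∂_i (Q²) = x_i (x · ∇Q²)`. The result is `W² x` minus the elastic
-- force, exactly what balances convection.
lemma pd_pressure (hQ : IsRadial Q) (hPs : ContDiff ℝ ∞ P)
    (hP : ∀ x i, pd i P x = x i * (W x ^ 2 - Q x ^ 2)) (x : E2) (i : Fin 2) :
    pd i (fun y => P y - ‖y‖ ^ 2 * Q y ^ 2) x
      = x i * W x ^ 2 - 3 * Q x ^ 2 * x i - x i * ∑ j, x j * pd j (fun y => Q y ^ 2) x := by
  have hdQ : Differentiable ℝ (fun y => Q y ^ 2) := (hQs.differentiable (by simp)).pow 2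
  have hn : DifferentiableAt ℝ (fun y : E2 => ‖y‖ ^ 2) x := (contDiff_norm_sq ℝ).differentiable
    (n := ∞) (by simp) x
  have h1 : pd i (fun y : E2 => ‖y‖ ^ 2) x = 2 * x i := by
    rw [pd_eq_of_hasFDerivAt (hasStrictFDerivAt_norm_sq x).hasFDerivAt i]
    simp [EuclideanSpace.inner_single_right]
  have h2 : IsRadial fun y => Q y ^ 2 := fun a b h => by simp only [hQ h]
  have h3 := h2.norm_sq_mul_partialDeriv (hdQ x) i
  rw [fderiv_eq_sum_partialDeriv] at h3
  rw [pd_sub (hPs.differentiable (by simp) x) (hn.fun_mul (hdQ x)), pd_mul hn (hdQ x), hP, h1]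
  simp only [smul_eq_mul] at h3
  change ‖x‖ ^ 2 * pd i (fun y => Q y ^ 2) x = _ at h3
  rw [h3]
  ring

end Slice

lemma contDiff_slice {V : Type*} [NormedAddCommGroup V] [NormedSpace ℝ V] {f : ℝ → E2 → V}
    (hf : ContDiffOn ℝ ∞ (fun z : ℝ × E2 => f z.1 z.2) (Ioi 0 ×ˢ univ)) {t : ℝ} (ht : 0 < t) :
    ContDiff ℝ ∞ (f t) := by
  rw [← contDiffOn_univ]
  exact hf.comp (contDiffOn_const (c := t) |>.prodMk contDiffOn_id) fun x _ => ⟨ht, mem_univ _⟩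

lemma differentiableAt_time {V E : Type*} [NormedAddCommGroup V] [NormedSpace ℝ V]
    [NormedAddCommGroup E] [NormedSpace ℝ E] {f : ℝ → E → V}
    (hf : ContDiffOn ℝ ∞ (fun z : ℝ × E => f z.1 z.2) (Ioi 0 ×ˢ univ)) {t : ℝ} (ht : 0 < t)
    (x : E) : DifferentiableAt ℝ (fun s => f s x) t := by
  have h1 : ContDiffOn ℝ ∞ (fun s => f s x) (Ioi 0) :=
    hf.comp (contDiffOn_id.prodMk (contDiffOn_const (c := x))) fun s hs => ⟨hs, mem_univ _⟩
  exact (h1.differentiableOn (by simp)).differentiableAt (Ioi_mem_nhds ht)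

/-- A radial swirl `W` and a radial angle `v` along a great circle solve the liquid crystal
system. -/
theorem isClassicalSolution_of_radial {β : ℝ} (hβ : 1 < β) {v W Q R P : ℝ → E2 → ℝ}
    (hvs : ContDiffOn ℝ ∞ (fun z : ℝ × E2 => v z.1 z.2) (Ioi 0 ×ˢ univ))
    (hWs : ContDiffOn ℝ ∞ (fun z : ℝ × E2 => W z.1 z.2) (Ioi 0 ×ˢ univ))
    (hQs : ContDiffOn ℝ ∞ (fun z : ℝ × E2 => Q z.1 z.2) (Ioi 0 ×ˢ univ))
    (hPs : ContDiffOn ℝ ∞ (fun z : ℝ × E2 => P z.1 z.2) (Ioi 0 ×ˢ univ))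
    (hQ : ∀ t > 0, IsRadial (Q t))
    (hv : ∀ t > 0, ∀ x i, pd i (v t) x = x i * Q t x)
    (hvt : ∀ t > 0, ∀ x, deriv (fun s => v s x) t = ∑ i, pd i (pd i (v t)) x)
    (hW : ∀ t > 0, ∀ x i, pd i (W t) x = x i * R t x)
    (hWt : ∀ t > 0, ∀ x, deriv (fun s => W s x) t = (∑ i, pd i (pd i (W t)) x) + 2 * R t x)
    (hP : ∀ t > 0, ∀ x i, pd i (P t) x = x i * (W t x ^ 2 - Q t x ^ 2)) :
    IsClassicalSolution (fun t x => W t x • rotate x) (fun t x => greatCircle β (v t x))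
      (fun t x => P t x - ‖x‖ ^ 2 * Q t x ^ 2) where
  smooth_u := hWs.smul (rotate.contDiff.comp contDiff_snd).contDiffOn
  smooth_d := (contDiff_greatCircle β).comp_contDiffOn hvs
  smooth_p := hPs.sub ((contDiff_snd.norm_sq ℝ).contDiffOn.mul (hQs.pow 2))
  momentum t ht x := by
    have hv' := contDiff_slice hvs ht
    have hW' := contDiff_slice hWs ht
    have hQ' := contDiff_slice hQs ht
    have hP' := contDiff_slice hPs ht
    have hp : DifferentiableAt ℝ (fun y => P t y - ‖y‖ ^ 2 * Q t y ^ 2) x :=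
      (hP'.sub ((contDiff_norm_sq ℝ).mul (hQ'.pow 2))).differentiable (by simp) x
    -- The terms along `Jx` cancel by the equation of `W`; what remains is radial and is settled by
    -- the pressure gradient.
    rw [convection_swirl hW' (hW t ht), laplacian_swirl hW' (hW t ht), ← hWt t ht,
      ((differentiableAt_time hWs ht x).hasDerivAt.smul_const (rotate x)).deriv]
    ext i
    simp only [PiLp.add_apply, PiLp.sub_apply, PiLp.neg_apply, PiLp.smul_apply, smul_eq_mul,
      gradient_apply_eq_pd hp, pd_pressure hQ' (hQ t ht) hP' (hP t ht),
      elasticForce_greatCircle hβ hv' hQ' (hv t ht)]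
    ring
  orientation t ht x := by
    have hv' := contDiff_slice hvs ht
    rw [convection_greatCircle hv' (hv t ht), laplacian_greatCircle hv',
      gradSq_greatCircle hβ hv', ← hvt t ht]
    have := (hasDerivAt_greatCircle β (v t x)).scomp t (differentiableAt_time hvs ht x).hasDerivAt
    rw [show (fun s => greatCircle β (v s x)) = greatCircle β ∘ fun s => v s x from rfl, this.deriv]
    simp
  incompressible t ht x := divergence_swirl (contDiff_slice hWs ht) (hW t ht) x
  unit t _ x := norm_greatCircle hβ _

lemma IsClassicalSolution.congr {u u' : ℝ → E2 → E2} {d d' : ℝ → E2 → E3} {p p' : ℝ → E2 → ℝ}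
    (h : IsClassicalSolution u d p) (hu : ∀ t > 0, u' t = u t) (hd : ∀ t > 0, d' t = d t)
    (hp : ∀ t > 0, p' t = p t) : IsClassicalSolution u' d' p' where
  smooth_u := h.smooth_u.congr fun z hz => by rw [hu z.1 hz.1]
  smooth_d := h.smooth_d.congr fun z hz => by rw [hd z.1 hz.1]
  smooth_p := h.smooth_p.congr fun z hz => by rw [hp z.1 hz.1]
  momentum t ht x := by
    have : (fun s => u' s x) =ᶠ[𝓝 t] fun s => u s x :=
      (eventually_gt_nhds ht).mono fun s hs => congrFun (hu s hs) x
    rw [this.deriv_eq, hu t ht, hd t ht, hp t ht]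
    exact h.momentum t ht x
  orientation t ht x := by
    have : (fun s => d' s x) =ᶠ[𝓝 t] fun s => d s x :=
      (eventually_gt_nhds ht).mono fun s hs => congrFun (hd s hs) x
    rw [this.deriv_eq, hu t ht, hd t ht]
    exact h.orientation t ht x
  incompressible t ht x := by
    rw [hu t ht]
    exact h.incompressible t ht x
  unit t ht x := by
    rw [hd t ht]
    exact h.unit t ht x

/-! ### Polar coordinates -/

section Polar

variable {n : ℕ} [NeZero n]

/-- The surface area of the unit sphere. -/
def sphereArea (n : ℕ) : ENNReal := (volume : Measure (EuclideanSpace ℝ (Fin n))).toSphere univ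

omit [NeZero n] in
lemma sphereArea_ne_top : sphereArea n ≠ ⊤ := measure_ne_top _ _

instance : Nontrivial (EuclideanSpace ℝ (Fin n)) :=
  Module.nontrivial_of_finrank_pos (R := ℝ) (by simpa using NeZero.pos n)

lemma sphereArea_ne_zero : sphereArea n ≠ 0 := by
  unfold sphereArea
  rw [Measure.toSphere_apply_univ]
  have h1 : 0 < volume (Metric.ball (0 : EuclideanSpace ℝ (Fin n)) 1) :=
    Metric.measure_ball_pos _ _ one_pos
  simp [h1.ne', NeZero.ne n]

/-- Polar coordinates as a push-forward, a form that also serves profiles that are measurable only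
up to null sets. -/
lemma map_norm_volume : (volume : Measure (EuclideanSpace ℝ (Fin n))).map norm
    = sphereArea n • (volume.restrict (Ioi 0)).withDensity
      fun r => ENNReal.ofReal (r ^ (n - 1)) := by
  ext s hs
  have hr : ∀ f : ℝ → ENNReal, Measurable f → ∫⁻ x : EuclideanSpace ℝ (Fin n), f ‖x‖
      = sphereArea n * ∫⁻ r in Ioi 0, ENNReal.ofReal (r ^ (n - 1)) * f r := by
    intro f hf
    calc ∫⁻ x : EuclideanSpace ℝ (Fin n), f ‖x‖
        = ∫⁻ x : ({(0)}ᶜ : Set (EuclideanSpace ℝ (Fin n))), f ‖x.1‖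
            ∂(volume.comap Subtype.val) := by
          rw [lintegral_subtype_comap (measurableSet_singleton _).compl fun x => f ‖x‖,
            restrict_compl_singleton]
      _ = ∫⁻ x, f x.2 ∂(volume : Measure (EuclideanSpace ℝ (Fin n))).toSphere.prod
            (.volumeIoiPow (Module.finrank ℝ (EuclideanSpace ℝ (Fin n)) - 1)) := by
          simpa using ((volume : Measure (EuclideanSpace ℝ
            (Fin n))).measurePreserving_homeomorphUnitSphereProd.lintegral_comp_emb
            (Homeomorph.measurableEmbedding _) (f ∘ Subtype.val ∘ Prod.snd))
      _ = sphereArea n * ∫⁻ x : Ioi (0 : ℝ), f x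
            ∂.volumeIoiPow (Module.finrank ℝ (EuclideanSpace ℝ (Fin n)) - 1) := by
          rw [lintegral_prod _ (by fun_prop)]
          simp only [lintegral_const, mul_comm, sphereArea]
      _ = _ := by
          rw [Measure.volumeIoiPow, lintegral_withDensity_eq_lintegral_mul _ (by fun_prop)
            (by fun_prop), finrank_euclideanSpace_fin]
          congr 1
          exact lintegral_subtype_comap measurableSet_Ioi
            fun r => ENNReal.ofReal (r ^ (n - 1)) * f r
  have h1 := hr (s.indicator 1) (measurable_one.indicator hs)
  rw [Measure.map_apply measurable_norm hs, Measure.smul_apply, withDensity_apply _ hs,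
    ← lintegral_indicator hs, smul_eq_mul, ← lintegral_indicator_one (measurable_norm hs)]
  convert h1 using 2
  · ext x
    by_cases h : ‖x‖ ∈ s <;> simp [h]
  · refine lintegral_congr fun r => ?_
    by_cases h : r ∈ s <;> simp [h]

lemma quasiMeasurePreserving_norm :
    Measure.QuasiMeasurePreserving (norm : EuclideanSpace ℝ (Fin n) → ℝ) volume
      (volume.restrict (Ioi 0)) := by
  refine ⟨measurable_norm, ?_⟩
  rw [map_norm_volume]
  exact (withDensity_absolutelyContinuous _ _).smul_left _

lemma lintegral_comp_norm {f : ℝ → ENNReal} (hf : AEMeasurable f (volume.restrict (Ioi 0))) :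
    ∫⁻ x : EuclideanSpace ℝ (Fin n), f ‖x‖
      = sphereArea n * ∫⁻ r in Ioi 0, ENNReal.ofReal (r ^ (n - 1)) * f r := by
  have h1 : AEMeasurable f ((volume : Measure (EuclideanSpace ℝ (Fin n))).map norm) :=
    hf.mono_ac quasiMeasurePreserving_norm.2
  rw [← lintegral_map' h1 measurable_norm.aemeasurable, map_norm_volume, lintegral_smul_measure,
    smul_eq_mul, lintegral_withDensity_eq_lintegral_mul₀ (by fun_prop) hf]
  rfl

end Polar

/-! ### The energy of a swirl -/

lemma norm_swirl {w : ℝ → ℝ} {x : E2} (hx : x ≠ 0) : ‖swirl w x‖ = |w ‖x‖| := by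
  have h0 : ‖x‖ ≠ 0 := norm_ne_zero_iff.2 hx
  have h : ‖(!₂[-(x 1 / ‖x‖), x 0 / ‖x‖] : E2)‖ = 1 := by
    rw [EuclideanSpace.norm_eq, Real.sqrt_eq_one]
    have := EuclideanSpace.real_norm_sq_eq x
    rw [Fin.sum_univ_two] at this
    simp [div_pow]
    field_simp
    linarith
  rw [swirl, norm_smul, h, mul_one, Real.norm_eq_abs]

lemma sqNorm_swirl_eq_lintegral_norm (w : ℝ → ℝ) :
    sqNorm (swirl w) = ∫⁻ x : E2, ‖w ‖x‖‖ₑ ^ 2 := by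
  refine lintegral_congr_ae ?_
  filter_upwards [compl_mem_ae_iff.2 (measure_singleton (0 : E2))] with x hx
  rw [← ofReal_norm, norm_swirl hx, ← Real.norm_eq_abs, ofReal_norm]

/-- The energy of a planar swirl is a multiple of that of the angular velocity on `ℝ⁴`. -/
lemma sqNorm_swirl {w : ℝ → ℝ} (hw : AEStronglyMeasurable w (volume.restrict (Ioi 0))) :
    sqNorm (swirl w)
      = sphereArea 2 / sphereArea 4 * ∫⁻ z : E4, ‖w ‖z‖ / ‖z‖‖ₑ ^ 2 := by
  have hm : AEMeasurable (fun r => ‖w r‖ₑ ^ 2) (volume.restrict (Ioi 0)) := hw.enorm.pow_const 2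
  have hm' : AEMeasurable (fun r => ‖w r / r‖ₑ ^ 2) (volume.restrict (Ioi 0)) :=
    (hw.aemeasurable.div aemeasurable_id).enorm.pow_const 2
  rw [sqNorm_swirl_eq_lintegral_norm, lintegral_comp_norm hm, lintegral_comp_norm hm', ← mul_assoc,
    ENNReal.div_mul_cancel sphereArea_ne_zero sphereArea_ne_top]
  congr 1
  -- The radial densities agree: `r w² = r³ (w / r)²`.
  refine setLIntegral_congr_fun measurableSet_Ioi fun r (hr : 0 < r) => ?_
  simp only [← ofReal_norm, ← ENNReal.ofReal_pow (norm_nonneg _)]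
  rw [← ENNReal.ofReal_mul (by positivity), ← ENNReal.ofReal_mul (by positivity)]
  congr 1
  rw [norm_div, Real.norm_of_nonneg hr.le]
  field_simp
  ring

section Velocity

variable {u₀ : ℝ → ℝ} (hm : AEStronglyMeasurable u₀ (volume.restrict (Ioi 0)))
  (he : IntegrableOn (fun r => u₀ r ^ 2 * r) (Ioi 0))

include hm

lemma aestronglyMeasurable_angular :
    AEStronglyMeasurable (fun z : E4 => u₀ ‖z‖ / ‖z‖) := by
  have h : AEStronglyMeasurable (fun r => u₀ r / r) (volume.restrict (Ioi 0)) :=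
    (hm.aemeasurable.div aemeasurable_id).aestronglyMeasurable
  exact h.comp_quasiMeasurePreserving quasiMeasurePreserving_norm

include he

lemma sqNorm_swirl_lt_top : sqNorm (swirl u₀) < ⊤ := by
  have h1 : AEMeasurable (fun r => ‖u₀ r‖ₑ ^ 2) (volume.restrict (Ioi 0)) := hm.enorm.pow_const 2
  rw [sqNorm_swirl_eq_lintegral_norm, lintegral_comp_norm h1]
  refine ENNReal.mul_lt_top sphereArea_ne_top.lt_top ?_
  refine lt_of_eq_of_lt (setLIntegral_congr_fun measurableSet_Ioi fun r (hr : 0 < r) => ?_) he.2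
  simp only [← ofReal_norm, ← ENNReal.ofReal_pow (norm_nonneg _)]
  rw [← ENNReal.ofReal_mul (by positivity)]
  congr 1
  rw [Real.norm_of_nonneg (by positivity : 0 ≤ u₀ r ^ 2 * r), Real.norm_eq_abs, sq_abs]
  ring

lemma memLp_angular : MemLp (fun z : E4 => u₀ ‖z‖ / ‖z‖) 2 := by
  rw [memLp_two_iff_lintegral (aestronglyMeasurable_angular hm)]
  have h1 := sqNorm_swirl_lt_top hm he
  rw [sqNorm_swirl hm] at h1
  by_contra h2
  rw [not_lt, top_le_iff] at h2
  rw [h2, ENNReal.mul_top] at h1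
  · exact lt_irrefl _ h1
  · exact ENNReal.div_ne_zero.2 ⟨sphereArea_ne_zero, sphereArea_ne_top⟩

omit hm he in
lemma uRad_norm_div (t : ℝ) {z : E4} (hz : z ≠ 0) :
    uRad u₀ t ‖z‖ / ‖z‖ = heatFlow (fun y : E4 => u₀ ‖y‖ / ‖y‖) t z := by
  have h0 : ‖z‖ ≠ 0 := norm_ne_zero_iff.2 hz
  rw [uRad, mul_div_cancel_left₀ _ h0]
  exact heatFlow_eq_of_norm_eq (fun r => u₀ r / r) t (by simp)

lemma continuous_uRad {t : ℝ} (ht : 0 < t) : Continuous (uRad u₀ t) := by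
  have h := ((GaussianIntegrable.of_memLp_two (memLp_angular hm he)).contDiff_heatFlow
    ht).continuous
  have h2 : Continuous fun r : ℝ => (EuclideanSpace.single 0 r : E4) := by
    have : (fun r : ℝ => (EuclideanSpace.single 0 r : E4))
        = fun r => r • EuclideanSpace.single 0 (1 : ℝ) := by
      ext r i; simp
    rw [this]; fun_prop
  exact continuous_id.mul (h.comp h2)

lemma sqNorm_velocity_eq {t : ℝ} (ht : 0 < t) : sqNorm (velocity u₀ t)
    = sphereArea 2 / sphereArea 4
      * ∫⁻ z, ‖heatFlow (fun y : E4 => u₀ ‖y‖ / ‖y‖) t z‖ₑ ^ 2 := by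
  rw [show velocity u₀ t = swirl (uRad u₀ t) from rfl,
    sqNorm_swirl (continuous_uRad hm he ht).aestronglyMeasurable]
  congr 1
  refine lintegral_congr_ae ?_
  filter_upwards [compl_mem_ae_iff.2 (measure_singleton (0 : E4))] with z hz
  rw [uRad_norm_div t hz]

lemma sqNorm_velocity_le {t : ℝ} (ht : 0 < t) : sqNorm (velocity u₀ t) ≤ sqNorm (swirl u₀) := by
  rw [sqNorm_velocity_eq hm he ht, sqNorm_swirl hm]
  gcongr _ * ?_
  exact lintegral_heatFlow_sq_le (aestronglyMeasurable_angular hm) ht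

lemma tendsto_sqNorm_velocity_sub :
    Tendsto (fun t => sqNorm fun x => velocity u₀ t x - swirl u₀ x) (𝓝[>] 0) (𝓝 0) := by
  have h1 := ENNReal.Tendsto.const_mul (tendsto_lintegral_heatFlow_sub (memLp_angular hm he))
    (Or.inr (ENNReal.div_ne_top (sphereArea_ne_top (n := 2)) (sphereArea_ne_zero (n := 4))))
  rw [mul_zero] at h1
  refine h1.congr' ?_
  filter_upwards [self_mem_nhdsWithin] with t ht
  have h2 : (fun x => velocity u₀ t x - swirl u₀ x) = swirl fun r => uRad u₀ t r - u₀ r := by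
    ext1 x
    simp only [velocity, swirl, sub_smul]
  rw [h2, sqNorm_swirl (w := fun r => uRad u₀ t r - u₀ r)
    ((continuous_uRad hm he ht).aestronglyMeasurable.sub hm)]
  congr 1
  refine lintegral_congr_ae ?_
  filter_upwards [compl_mem_ae_iff.2 (measure_singleton (0 : E4))] with z hz
  rw [sub_div, uRad_norm_div t hz]

end Velocity

/-! ### Absolutely continuous radial functions on lines -/

lemma _root_.AbsolutelyContinuousOnInterval.comp_lipschitzOnWith {f g : ℝ → ℝ} {a b : ℝ}
    {K : NNReal} {s : Set ℝ} (hf : AbsolutelyContinuousOnInterval f a b)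
    (hg : LipschitzOnWith K g s) (hs : ∀ x ∈ uIcc a b, f x ∈ s) :
    AbsolutelyContinuousOnInterval (fun x => g (f x)) a b := by
  rw [absolutelyContinuousOnInterval_iff] at hf ⊢
  intro ε hε
  -- `K + 1` instead of `K`, so that `K = 0` is covered.
  obtain ⟨δ, hδ, h⟩ := hf (ε / (K + 1)) (by positivity)
  refine ⟨δ, hδ, fun E hE hlt => ?_⟩
  have h1 := h E hE hlt
  have h2 : ∀ i ∈ Finset.range E.1, dist (g (f (E.2 i).1)) (g (f (E.2 i).2))
      ≤ (K + 1) * dist (f (E.2 i).1) (f (E.2 i).2) := fun i hi => by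
    have hm := hE.1 i hi
    refine (hg.dist_le_mul _ (hs _ hm.1) _ (hs _ hm.2)).trans ?_
    gcongr
    linarith
  calc ∑ i ∈ Finset.range E.1, dist (g (f (E.2 i).1)) (g (f (E.2 i).2))
      ≤ ∑ i ∈ Finset.range E.1, (K + 1) * dist (f (E.2 i).1) (f (E.2 i).2) := Finset.sum_le_sum h2
    _ = (K + 1) * ∑ i ∈ Finset.range E.1, dist (f (E.2 i).1) (f (E.2 i).2) := by
        rw [Finset.mul_sum]
    _ < (K + 1) * (ε / (K + 1)) := by gcongr
    _ = ε := by field_simp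

section Lines

variable {f : ℝ → ℝ} (hac : ∀ a b : ℝ, 0 < a → a < b → AbsolutelyContinuousOnInterval f a b)

include hac

/-- On `[0, b]` the map `s ↦ √(s² + c²)` is increasing with values at least `|c| > 0`. A change of
variables reduces the claim to the fundamental theorem for `f` on an interval away from the origin.
-/
lemma integral_deriv_sqrt_of_nonneg {c b : ℝ} (hc : c ≠ 0) (hb : 0 < b) :
    IntervalIntegrable (fun s => deriv f √(s ^ 2 + c ^ 2) * (s / √(s ^ 2 + c ^ 2))) volume 0 b ∧
    ∫ s in (0 : ℝ)..b, deriv f √(s ^ 2 + c ^ 2) * (s / √(s ^ 2 + c ^ 2))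
      = f √(b ^ 2 + c ^ 2) - f √(0 ^ 2 + c ^ 2) := by
  have hpos : ∀ s : ℝ, 0 < s ^ 2 + c ^ 2 := fun s => by positivity
  have hd : ∀ s : ℝ, HasDerivAt (fun s : ℝ => √(s ^ 2 + c ^ 2)) (s / √(s ^ 2 + c ^ 2)) s := by
    intro s
    have h1 : HasDerivAt (fun s : ℝ => s ^ 2 + c ^ 2) (2 * s) s := by
      simpa using (hasDerivAt_pow 2 s).add_const (c ^ 2)
    refine (h1.sqrt (hpos s).ne').congr_deriv ?_
    rw [mul_div_mul_left _ _ two_ne_zero]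
  have hlt : √(0 ^ 2 + c ^ 2) < √(b ^ 2 + c ^ 2) :=
    Real.sqrt_lt_sqrt (hpos 0).le (by nlinarith [sq_pos_of_pos hb])
  have hAC := hac _ _ (Real.sqrt_pos.2 (hpos 0)) hlt
  have hcont : ContinuousOn (fun s : ℝ => √(s ^ 2 + c ^ 2)) (Icc 0 b) := by fun_prop
  have hnn : ∀ s ∈ Ioo 0 b, 0 ≤ s / √(s ^ 2 + c ^ 2) := fun s hs =>
    div_nonneg hs.1.le (Real.sqrt_nonneg _)
  have e1 := integral_Icc_deriv_smul_of_deriv_nonneg (g := deriv f) hcont (fun s _ => hd s) hnn hb.le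
  have e2 := (integrableOn_Icc_deriv_smul_iff_of_deriv_nonneg (g := deriv f) hcont
    (fun s _ => hd s) hnn hb.le).2
    ((intervalIntegrable_iff_integrableOn_Icc_of_le hlt.le).1 hAC.intervalIntegrable_deriv)
  constructor
  · rw [intervalIntegrable_iff_integrableOn_Icc_of_le hb.le]
    exact e2.congr_fun (fun s _ => by simp [mul_comm]) measurableSet_Icc
  · rw [← hAC.integral_deriv_eq_sub, intervalIntegral.integral_of_le hb.le,
      intervalIntegral.integral_of_le hlt.le, ← integral_Icc_eq_integral_Ioc,
      ← integral_Icc_eq_integral_Ioc, ← e1]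
    refine setIntegral_congr_fun measurableSet_Icc fun s _ => ?_
    simp [mul_comm]

/-- Negative `b` is reduced to positive `b` by the oddness of the integrand. -/
lemma integral_deriv_sqrt_zero {c : ℝ} (hc : c ≠ 0) (b : ℝ) :
    IntervalIntegrable (fun s => deriv f √(s ^ 2 + c ^ 2) * (s / √(s ^ 2 + c ^ 2))) volume 0 b ∧
    ∫ s in (0 : ℝ)..b, deriv f √(s ^ 2 + c ^ 2) * (s / √(s ^ 2 + c ^ 2))
      = f √(b ^ 2 + c ^ 2) - f √(0 ^ 2 + c ^ 2) := by
  rcases lt_trichotomy 0 b with hb | hb | hb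
  · exact integral_deriv_sqrt_of_nonneg hac hc hb
  · simp [← hb]
  · obtain ⟨h1, h2⟩ := integral_deriv_sqrt_of_nonneg hac hc (b := -b) (by linarith)
    have hodd : (fun s => deriv f √((-s) ^ 2 + c ^ 2) * (-s / √((-s) ^ 2 + c ^ 2)))
        = fun s => -(deriv f √(s ^ 2 + c ^ 2) * (s / √(s ^ 2 + c ^ 2))) := by
      ext s; rw [neg_sq]; ring
    constructor
    · have h3 := (IntervalIntegrable.iff_comp_neg).1 h1
      simp only [neg_zero, neg_neg] at h3
      rw [hodd] at h3
      simpa [Pi.neg_def] using h3.neg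
    · have h3 := intervalIntegral.integral_comp_neg (a := 0) (b := b)
        fun s => deriv f √(s ^ 2 + c ^ 2) * (s / √(s ^ 2 + c ^ 2))
      rw [hodd, intervalIntegral.integral_neg, neg_zero,
        intervalIntegral.integral_symm 0 (-b), h2] at h3
      simp only [neg_sq] at h3
      linarith

lemma integral_deriv_sqrt {c : ℝ} (hc : c ≠ 0) (a b : ℝ) :
    IntervalIntegrable (fun s => deriv f √(s ^ 2 + c ^ 2) * (s / √(s ^ 2 + c ^ 2))) volume a b ∧
    ∫ s in a..b, deriv f √(s ^ 2 + c ^ 2) * (s / √(s ^ 2 + c ^ 2))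
      = f √(b ^ 2 + c ^ 2) - f √(a ^ 2 + c ^ 2) := by
  obtain ⟨ha1, ha2⟩ := integral_deriv_sqrt_zero hac hc a
  obtain ⟨hb1, hb2⟩ := integral_deriv_sqrt_zero hac hc b
  refine ⟨ha1.symm.trans hb1, ?_⟩
  rw [← intervalIntegral.integral_interval_sub_left hb1 ha1, ha2, hb2]
  ring

end Lines

/-! ### Radial functions of finite Dirichlet energy -/

/-- The candidate partial derivative of `x ↦ f ‖x‖`. -/
def radialPartial (f : ℝ → ℝ) (i : Fin 2) (y : E2) : ℝ := deriv f ‖y‖ * (y i / ‖y‖)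

lemma measurable_radialPartial (f : ℝ → ℝ) (i : Fin 2) : Measurable (radialPartial f i) := by
  unfold radialPartial
  have := measurable_deriv f
  fun_prop

lemma norm_add_smul_single (y : E2) (i : Fin 2) (s : ℝ) :
    ‖y + s • EuclideanSpace.single i (1 : ℝ)‖ = √((y i + s) ^ 2 + y (1 - i) ^ 2) := by
  rw [EuclideanSpace.norm_eq]
  congr 1
  rw [Fin.sum_univ_two]
  fin_cases i <;> simp [add_comm]

lemma ae_apply_ne_zero (i : Fin 2) : ∀ᵐ y : E2, y i ≠ 0 := by
  have h := Measure.addHaar_submodule (volume : Measure E2)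
    (LinearMap.ker (EuclideanSpace.proj i : E2 →L[ℝ] ℝ).toLinearMap) (by
      intro h
      have : (EuclideanSpace.single i (1 : ℝ) : E2) ∈
        LinearMap.ker (EuclideanSpace.proj i : E2 →L[ℝ] ℝ).toLinearMap := by rw [h]; trivial
      simp at this)
  filter_upwards [compl_mem_ae_iff.2 h] with y hy
  simpa using hy

section Profile

variable {f : ℝ → ℝ} (hac : ∀ a b : ℝ, 0 < a → a < b → AbsolutelyContinuousOnInterval f a b)

include hac

/-- The index `1 - i` is the other coordinate; it is constant on the line, and its being nonzero
means that the line misses the origin. -/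
lemma integral_radialPartial_line (i : Fin 2) (h : ℝ) {y : E2} (hy : y (1 - i) ≠ 0) :
    IntervalIntegrable (fun s => radialPartial f i (y + s • EuclideanSpace.single i (1 : ℝ)))
      volume 0 h ∧
    ∫ s in (0 : ℝ)..h, radialPartial f i (y + s • EuclideanSpace.single i (1 : ℝ))
      = f ‖y + h • EuclideanSpace.single i (1 : ℝ)‖ - f ‖y‖ := by
  obtain ⟨h1, h2⟩ := integral_deriv_sqrt hac hy (y i) (y i + h)
  have e : (fun s : ℝ => radialPartial f i (y + s • EuclideanSpace.single i (1 : ℝ)))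
      = fun s => (fun s => deriv f √(s ^ 2 + y (1 - i) ^ 2)
        * (s / √(s ^ 2 + y (1 - i) ^ 2))) (y i + s) := by
    ext s
    simp [radialPartial, norm_add_smul_single]
  have e0 : ‖y‖ = √(y i ^ 2 + y (1 - i) ^ 2) := by
    simpa using norm_add_smul_single y i 0
  rw [e]
  constructor
  · have := h1.comp_add_left (y i)
    simpa using this
  · rw [intervalIntegral.integral_comp_add_left (fun s => deriv f √(s ^ 2 + y (1 - i) ^ 2)
        * (s / √(s ^ 2 + y (1 - i) ^ 2))) (y i), add_zero, h2, norm_add_smul_single, e0]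

lemma continuousOn_profile : ContinuousOn f (Ioi 0) := by
  intro r (hr : 0 < r)
  have h := (hac (r / 2) (2 * r) (by linarith) (by linarith)).continuousOn
  rw [uIcc_of_le (by linarith)] at h
  exact (h.continuousAt (Icc_mem_nhds (by linarith) (by linarith))).continuousWithinAt

lemma aestronglyMeasurable_profile_norm : AEStronglyMeasurable fun y : E2 => f ‖y‖ := by
  have h := (continuousOn_profile hac).aestronglyMeasurable (μ := volume) measurableSet_Ioi
  exact h.comp_quasiMeasurePreserving quasiMeasurePreserving_norm

lemma ae_differentiableAt_profile : ∀ᵐ r ∂(volume.restrict (Ioi (0 : ℝ))),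
    DifferentiableAt ℝ f r := by
  -- The intervals `[1 / (k + 2), k + 2]` exhaust `(0, ∞)`; the shift by two keeps their endpoints
  -- in strict order.
  have h1 : ∀ k : ℕ, ∀ᵐ r : ℝ, r ∈ uIcc ((k + 2 : ℝ)⁻¹) (k + 2) → DifferentiableAt ℝ f r :=
    fun k => (hac _ _ (by positivity)
      ((inv_lt_one_of_one_lt₀ (by linarith)).trans (by linarith))).ae_differentiableAt
  rw [ae_restrict_iff' measurableSet_Ioi]
  filter_upwards [ae_all_iff.2 h1] with r hr (h0 : 0 < r)
  obtain ⟨k, hk⟩ := exists_nat_ge (max r r⁻¹)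
  have hk1 : r ≤ k := (le_max_left _ _).trans hk
  have hk2 : r⁻¹ ≤ k := (le_max_right _ _).trans hk
  refine hr k ?_
  rw [uIcc_of_le ((inv_lt_one_of_one_lt₀ (by linarith)).le.trans (by linarith))]
  exact ⟨inv_le_of_inv_le₀ h0 (by linarith), by linarith⟩

lemma ae_hasFDerivAt_profile_norm : ∀ᵐ y : E2,
    DifferentiableAt ℝ (fun y : E2 => f ‖y‖) y ∧
      ∀ i, pd i (fun y : E2 => f ‖y‖) y = radialPartial f i y := by
  have h := quasiMeasurePreserving_norm (n := 2) |>.ae (ae_differentiableAt_profile hac)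
  filter_upwards [h, compl_mem_ae_iff.2 (measure_singleton (0 : E2))] with y hy h0
  have h1 : HasFDerivAt (fun y : E2 => ‖y‖) (‖y‖⁻¹ • innerSL ℝ y) y := by
    have h2 := (hasStrictFDerivAt_norm_sq y).hasFDerivAt.sqrt (by simpa using h0)
    simp only [Real.sqrt_sq (norm_nonneg _)] at h2
    refine h2.congr_fderiv ?_
    ext w
    simp
    ring
  have h3 : HasFDerivAt (fun y : E2 => f ‖y‖) _ y := hy.hasDerivAt.comp_hasFDerivAt y h1
  refine ⟨h3.differentiableAt, fun i => ?_⟩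
  rw [pd_eq_of_hasFDerivAt h3 i, radialPartial]
  simp [EuclideanSpace.inner_single_right, div_eq_inv_mul]

variable (he : IntegrableOn (fun r => deriv f r ^ 2 * r) (Ioi 0))

omit hac in
lemma sum_radialPartial_sq {y : E2} (hy : y ≠ 0) :
    ∑ i, radialPartial f i y ^ 2 = deriv f ‖y‖ ^ 2 := by
  have h0 : ‖y‖ ≠ 0 := norm_ne_zero_iff.2 hy
  have := EuclideanSpace.real_norm_sq_eq y
  rw [Fin.sum_univ_two] at this ⊢
  simp only [radialPartial]
  field_simp
  rw [this]

omit hac in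
lemma lintegral_deriv_sq_norm : ∫⁻ y : E2, ‖deriv f ‖y‖‖ₑ ^ 2
    = sphereArea 2 * ∫⁻ r in Ioi 0, ‖deriv f r ^ 2 * r‖ₑ := by
  have h1 : Measurable fun r => ‖deriv f r‖ₑ ^ 2 := (measurable_deriv f).enorm.pow_const 2
  rw [lintegral_comp_norm h1.aemeasurable]
  congr 1
  refine setLIntegral_congr_fun measurableSet_Ioi fun r (hr : 0 < r) => ?_
  simp only [← ofReal_norm, ← ENNReal.ofReal_pow (norm_nonneg _)]
  rw [← ENNReal.ofReal_mul (by positivity)]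
  congr 1
  rw [Real.norm_of_nonneg (by positivity : 0 ≤ deriv f r ^ 2 * r), Real.norm_eq_abs, sq_abs]
  ring

omit hac in
lemma sum_lintegral_radialPartial : ∑ i, ∫⁻ y, ‖radialPartial f i y‖ₑ ^ 2
    = ∫⁻ y : E2, ‖deriv f ‖y‖‖ₑ ^ 2 := by
  rw [← lintegral_finsetSum _ fun i _ => (measurable_radialPartial f i).enorm.pow_const 2]
  refine lintegral_congr_ae ?_
  filter_upwards [compl_mem_ae_iff.2 (measure_singleton (0 : E2))] with y hy
  simp only [← ofReal_norm, ← ENNReal.ofReal_pow (norm_nonneg _)]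
  rw [← ENNReal.ofReal_sum_of_nonneg fun i _ => by positivity]
  congr 1
  simp only [Real.norm_eq_abs, sq_abs]
  exact sum_radialPartial_sq hy

include he

omit hac in
lemma memLp_radialPartial (i : Fin 2) : MemLp (radialPartial f i) 2 := by
  rw [memLp_two_iff_lintegral (measurable_radialPartial f i).aestronglyMeasurable]
  have h : ∑ i, ∫⁻ y, ‖radialPartial f i y‖ₑ ^ 2 < ⊤ := by
    rw [sum_lintegral_radialPartial, lintegral_deriv_sq_norm]
    exact ENNReal.mul_lt_top sphereArea_ne_top.lt_top he.2
  exact (ENNReal.sum_lt_top.1 h) i (Finset.mem_univ i)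

omit he in
/-- Translating a radial function of finite Dirichlet energy along a coordinate axis. -/
lemma lintegral_translate_single_le (i : Fin 2) (h : ℝ) :
    ∫⁻ y : E2, ‖f ‖y + h • EuclideanSpace.single i (1 : ℝ)‖ - f ‖y‖‖ₑ ^ 2
      ≤ ‖h‖ₑ ^ 2 * ∫⁻ y, ‖radialPartial f i y‖ₑ ^ 2 := by
  have hP : IsProbabilityMeasure (volume.restrict (Ioc (0 : ℝ) 1)) := ⟨by simp⟩
  have hmD := measurable_radialPartial f i
  -- The increment is an average over `s ∈ (0, 1]` of `h` times the derivative at `y + h s e_i`.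
  -- Jensen, Tonelli and translation invariance follow.
  calc ∫⁻ y : E2, ‖f ‖y + h • EuclideanSpace.single i (1 : ℝ)‖ - f ‖y‖‖ₑ ^ 2
      ≤ ∫⁻ y : E2, ∫⁻ s in Ioc (0 : ℝ) 1,
        ‖h * radialPartial f i (y + (h * s) • EuclideanSpace.single i (1 : ℝ))‖ₑ ^ 2 := by
        refine lintegral_mono_ae ?_
        filter_upwards [ae_apply_ne_zero (1 - i)] with y hy
        obtain ⟨_, h2⟩ := integral_radialPartial_line hac i h hy
        have h3 := intervalIntegral.mul_integral_comp_mul_left (a := 0) (b := 1)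
          (f := fun s : ℝ => radialPartial f i (y + s • EuclideanSpace.single i (1 : ℝ))) h
        rw [mul_zero, mul_one, h2, intervalIntegral.integral_of_le zero_le_one,
          ← integral_const_mul] at h3
        rw [← h3]
        have := enorm_integral_sub_sq_le (μ := volume.restrict (Ioc (0 : ℝ) 1))
          (g := fun s => h * radialPartial f i (y + (h * s) • EuclideanSpace.single i (1 : ℝ)))
          (Measurable.aestronglyMeasurable (by fun_prop)) 0
        simpa using this
    _ = ∫⁻ s in Ioc (0 : ℝ) 1, ∫⁻ y : E2,
        ‖h * radialPartial f i (y + (h * s) • EuclideanSpace.single i (1 : ℝ))‖ₑ ^ 2 := by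
        refine lintegral_lintegral_swap (Measurable.aemeasurable ?_)
        simp only [Function.uncurry_def]
        fun_prop
    _ = ∫⁻ s in Ioc (0 : ℝ) 1, ‖h‖ₑ ^ 2 * ∫⁻ y, ‖radialPartial f i y‖ₑ ^ 2 := by
        refine lintegral_congr fun s => ?_
        simp_rw [enorm_mul, mul_pow]
        rw [lintegral_const_mul _ (by fun_prop),
          lintegral_add_right_eq_self (fun y => ‖radialPartial f i y‖ₑ ^ 2)]
    _ = _ := by simp

end Profile

/-! ### Derivatives of the heat flow in terms of weak derivatives -/

/-- If `D` is the derivative of `g` along almost every line in the direction `e`, then the heat flow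
of `D` is the derivative of the heat flow of `g` in this direction. -/
lemma hasDerivAt_heatFlow_of_lines {n : ℕ} {g D : EuclideanSpace ℝ (Fin n) → ℝ}
    (hg : GaussianIntegrable g) (hDm : Measurable D) (hD : MemLp D 2)
    (e : EuclideanSpace ℝ (Fin n))
    (hline : ∀ h : ℝ, ∀ᵐ y, ∫ s in (0 : ℝ)..h, D (y + s • e) = g (y + h • e) - g y)
    {t : ℝ} (ht : 0 < t) (x : EuclideanSpace ℝ (Fin n)) :
    HasDerivAt (fun h : ℝ => heatFlow g t (x + h • e)) (heatFlow D t x) 0 := by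
  have hDg := GaussianIntegrable.of_memLp_two hD
  have hDn := GaussianIntegrable.of_memLp_two hD.norm
  have hK := continuous_heatKernel (n := n) t
  -- The shift is moved from the kernel to the data, where the hypothesis on lines can be used.
  have hshift : ∀ (q : EuclideanSpace ℝ (Fin n) → ℝ) (h : ℝ),
      heatFlow q t (x + h • e) = ∫ y, heatKernel n t (x - y) * q (y + h • e) := fun q h => by
    rw [heatFlow_eq_integral_heatKernel,
      ← integral_add_right_eq_self (fun y => heatKernel n t (x + h • e - y) * q y) (h • e)]
    simp only [add_sub_add_right_eq_sub]
  have hint : ∀ {q : EuclideanSpace ℝ (Fin n) → ℝ}, GaussianIntegrable q → ∀ h : ℝ,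
      Integrable fun y => heatKernel n t (x - y) * q (y + h • e) := fun hq h => by
    have := (hq.integrable_heatKernel_mul ht (x + h • e)).comp_add_right (h • e)
    simpa only [add_sub_add_right_eq_sub] using this
  have hcont : ∀ {q : EuclideanSpace ℝ (Fin n) → ℝ}, GaussianIntegrable q →
      Continuous fun s : ℝ => heatFlow q t (x + s • e) := fun hq =>
    (hq.contDiff_heatFlow ht).continuous.comp (by fun_prop)
  -- By Fubini the flow of `g` is a primitive, along the line, of the flow of `D`. The latter is
  -- continuous, so the fundamental theorem gives the derivative.
  have hmain : ∀ h : ℝ, heatFlow g t (x + h • e)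
      = heatFlow g t x + ∫ s in (0 : ℝ)..h, heatFlow D t (x + s • e) := fun h => by
    have h1 : Integrable (Function.uncurry fun (s : ℝ) (y : EuclideanSpace ℝ (Fin n)) =>
        heatKernel n t (x - y) * D (y + s • e)) ((volume.restrict (uIoc 0 h)).prod volume) := by
      have hm : Measurable (Function.uncurry fun (s : ℝ) (y : EuclideanSpace ℝ (Fin n)) =>
          heatKernel n t (x - y) * D (y + s • e)) := by
        simp only [Function.uncurry_def]
        have := hK.measurable
        fun_prop
      rw [integrable_prod_iff hm.aestronglyMeasurable]
      refine ⟨ae_of_all _ fun s => hint hDg s, ?_⟩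
      refine Integrable.congr (f := fun s => heatFlow (fun y => ‖D y‖) t (x + s • e)) ?_
        (ae_of_all _ fun s => ?_)
      · exact intervalIntegrable_iff.1 ((hcont hDn).intervalIntegrable 0 h)
      · simp only [Function.uncurry_apply_pair]
        rw [hshift]
        refine integral_congr_ae (ae_of_all _ fun y => ?_)
        simp [abs_of_pos (heatKernel_pos ht _)]
    have h2 := intervalIntegral_integral_swap h1
    simp only [hshift D]
    rw [h2, hshift g h, ← sub_eq_iff_eq_add', heatFlow_eq_integral_heatKernel, ← integral_sub
      (hint hg h) (hg.integrable_heatKernel_mul ht x)]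
    refine integral_congr_ae ?_
    filter_upwards [hline h] with y hy
    rw [intervalIntegral.integral_const_mul, hy, mul_sub]
  have h3 := ((hcont hDg).integral_hasStrictDerivAt 0 0).hasDerivAt.const_add (heatFlow g t x)
  simp only [zero_smul, add_zero] at h3
  exact h3.congr_of_eventuallyEq (Eventually.of_forall hmain)

lemma lintegral_apply_sq_heatMeasure_lt_top (n : ℕ) (i : Fin n) :
    ∫⁻ z, ‖z i‖ₑ ^ 2 ∂heatMeasure n < ⊤ := by
  have h1 : GaussianIntegrable fun _ : EuclideanSpace ℝ (Fin n) => (1 : ℝ) :=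
    .of_bound aestronglyMeasurable_const (C := 1) (ae_of_all _ fun _ => by simp)
  have h2 := (((h1.coord_mul i).coord_mul i).integrable_heatKernel_mul one_pos 0).comp_neg
  have h3 := h2.2
  rw [hasFiniteIntegral_iff_enorm] at h3
  rw [heatMeasure, lintegral_withDensity_eq_lintegral_mul _ measurable_heatKernel_ofReal
    (by fun_prop)]
  refine lt_of_eq_of_lt (lintegral_congr fun z => ?_) h3
  simp only [Pi.mul_apply, zero_sub, neg_neg, PiLp.neg_apply, mul_one, enorm_mul, enorm_neg]
  rw [Real.enorm_eq_ofReal (heatKernel_pos one_pos z).le, sq]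

section Profile

variable {f : ℝ → ℝ} (hac : ∀ a b : ℝ, 0 < a → a < b → AbsolutelyContinuousOnInterval f a b)
  (he : IntegrableOn (fun r => deriv f r ^ 2 * r) (Ioi 0))

include hac he

/-- Gradient and heat flow commute although the profile is differentiable only almost everywhere.
The elastic energy is thus an `L²` norm of heat flows. -/
lemma pd_heatFlow_profile {C : ℝ} (hC : ∀ r > 0, |f r| ≤ C) {t : ℝ} (ht : 0 < t) (i : Fin 2)
    (x : E2) :
    pd i (heatFlow (fun y : E2 => f ‖y‖) t) x = heatFlow (radialPartial f i) t x := by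
  have hg : GaussianIntegrable fun y : E2 => f ‖y‖ :=
    .of_bound (aestronglyMeasurable_profile_norm hac) (C := C) (by
      filter_upwards [compl_mem_ae_iff.2 (measure_singleton (0 : E2))] with y hy
      exact hC _ (norm_pos_iff.2 hy))
  have h1 := hasDerivAt_heatFlow_of_lines hg (measurable_radialPartial f i)
    (memLp_radialPartial he i) (EuclideanSpace.single i 1) (fun h => by
      filter_upwards [ae_apply_ne_zero (1 - i)] with y hy
      exact (integral_radialPartial_line hac i h hy).2) ht x
  have h2 := hasDerivAt_add_smul
    ((hg.contDiff_heatFlow ht).differentiable (by simp) x) (EuclideanSpace.single i 1)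
  exact h2.unique h1

omit he in
-- The translation is made in two steps parallel to the axes; the factor `2` comes from `(a + b)² ≤
-- 2a² + 2b²`.
lemma lintegral_translate_le (w : E2) :
    ∫⁻ y : E2, ‖f ‖y - w‖ - f ‖y‖‖ₑ ^ 2
      ≤ 2 * ∑ i, ‖w i‖ₑ ^ 2 * ∫⁻ y, ‖radialPartial f i y‖ₑ ^ 2 := by
  have hm := aestronglyMeasurable_profile_norm hac
  have hw : ∀ y : E2, y - w = (y + (-w 0) • EuclideanSpace.single 0 (1 : ℝ))
      + (-w 1) • EuclideanSpace.single 1 (1 : ℝ) := fun y => by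
    ext j; fin_cases j <;> simp [sub_eq_add_neg]
  set a : E2 := (-w 0) • EuclideanSpace.single 0 (1 : ℝ)
  set b : E2 := (-w 1) • EuclideanSpace.single 1 (1 : ℝ)
  have hmt : ∀ c : E2, AEStronglyMeasurable fun y : E2 => f ‖y + c‖ := fun c =>
    hm.comp_quasiMeasurePreserving (measurePreserving_add_right volume c).quasiMeasurePreserving
  calc ∫⁻ y : E2, ‖f ‖y - w‖ - f ‖y‖‖ₑ ^ 2
      ≤ ∫⁻ y : E2, (2 * ‖f ‖y + a‖ - f ‖y‖‖ₑ ^ 2 + 2 * ‖f ‖y + a + b‖ - f ‖y + a‖‖ₑ ^ 2) := by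
        refine lintegral_mono fun y => ?_
        have := enorm_add_sq_le (f ‖y + a‖ - f ‖y‖) (f ‖y + a + b‖ - f ‖y + a‖)
        simpa [hw] using this
    _ = 2 * (∫⁻ y : E2, ‖f ‖y + a‖ - f ‖y‖‖ₑ ^ 2)
        + 2 * ∫⁻ y : E2, ‖f ‖y + b‖ - f ‖y‖‖ₑ ^ 2 := by
        have h1 : AEMeasurable fun y : E2 => 2 * ‖f ‖y + a‖ - f ‖y‖‖ₑ ^ 2 :=
          (((hmt a).sub hm).enorm.pow_const 2).const_mul 2
        rw [lintegral_add_left' h1,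
          lintegral_const_mul' _ _ (by norm_num), lintegral_const_mul' _ _ (by norm_num),
          lintegral_add_right_eq_self (fun y => ‖f ‖y + b‖ - f ‖y‖‖ₑ ^ 2)]
    _ ≤ 2 * (‖w 0‖ₑ ^ 2 * ∫⁻ y, ‖radialPartial f 0 y‖ₑ ^ 2)
        + 2 * (‖w 1‖ₑ ^ 2 * ∫⁻ y, ‖radialPartial f 1 y‖ₑ ^ 2) := by
        have h0 := lintegral_translate_single_le hac 0 (-w 0)
        have h1 := lintegral_translate_single_le hac 1 (-w 1)
        rw [enorm_neg] at h0 h1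
        gcongr
    _ = _ := by rw [Fin.sum_univ_two, mul_add]

/-- The profile itself need not be in `L²`. The translation by `√t z` costs at most `2t ∑ z_i² ‖∂_i
f‖²`, and the Gaussian has finite second moments, so the error is `O(t)`. -/
lemma tendsto_lintegral_heatFlow_profile_sub :
    Tendsto (fun t => ∫⁻ x : E2, ‖heatFlow (fun y : E2 => f ‖y‖) t x - f ‖x‖‖ₑ ^ 2) (𝓝[>] 0)
      (𝓝 0) := by
  have hm := aestronglyMeasurable_profile_norm hac
  have hlt : 2 * ∑ i, (∫⁻ z, ‖z i‖ₑ ^ 2 ∂heatMeasure 2) * ∫⁻ y, ‖radialPartial f i y‖ₑ ^ 2 < ⊤ :=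
    ENNReal.mul_lt_top (by norm_num) (ENNReal.sum_lt_top.2 fun i _ => ENNReal.mul_lt_top
      (lintegral_apply_sq_heatMeasure_lt_top 2 i)
      ((memLp_two_iff_lintegral (memLp_radialPartial he i).1).1 (memLp_radialPartial he i)))
  set M := 2 * ∑ i, (∫⁻ z, ‖z i‖ₑ ^ 2 ∂heatMeasure 2) * ∫⁻ y, ‖radialPartial f i y‖ₑ ^ 2 with hM
  have hb : ∀ t > 0, ∫⁻ x : E2, ‖heatFlow (fun y : E2 => f ‖y‖) t x - f ‖x‖‖ₑ ^ 2
      ≤ ENNReal.ofReal t * M := fun t ht => by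
    refine (lintegral_heatFlow_sub_le hm ht hm).trans ?_
    refine (lintegral_mono fun z => lintegral_translate_le hac (√t • z)).trans_eq ?_
    have e : ∀ (z : E2) (i : Fin 2), ‖(√t • z) i‖ₑ ^ 2 = ENNReal.ofReal t * ‖z i‖ₑ ^ 2 := by
      intro z i
      rw [PiLp.smul_apply, smul_eq_mul, enorm_mul, mul_pow,
        Real.enorm_eq_ofReal (Real.sqrt_nonneg t), ← ENNReal.ofReal_pow (Real.sqrt_nonneg t),
        Real.sq_sqrt ht.le]
    simp_rw [e]
    rw [lintegral_const_mul' _ _ (by norm_num), lintegral_finsetSum _ (fun i _ => by fun_prop), hM]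
    rw [mul_left_comm]
    congr 1
    rw [Finset.mul_sum]
    refine Finset.sum_congr rfl fun i _ => ?_
    rw [lintegral_mul_const _ (by fun_prop), lintegral_const_mul _ (by fun_prop), mul_assoc]
  have h0 : Tendsto (fun t => ENNReal.ofReal t * M) (𝓝[>] 0) (𝓝 0) := by
    have h1 : Tendsto (fun t : ℝ => ENNReal.ofReal t * M) (𝓝 0) (𝓝 (ENNReal.ofReal 0 * M)) :=
      ENNReal.Tendsto.mul_const (ENNReal.continuous_ofReal.tendsto 0) (Or.inr hlt.ne)
    rw [ENNReal.ofReal_zero, zero_mul] at h1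
    exact h1.mono_left nhdsWithin_le_nhds
  exact tendsto_of_tendsto_of_tendsto_of_le_of_le' tendsto_const_nhds h0
    (Eventually.of_forall fun _ => zero_le) (eventually_mem_nhdsWithin.mono fun t ht => hb t ht)

end Profile

/-! ### The transformed angle and the director -/

/-- The initial polar angle after the Hopf–Cole type substitution. -/
def phase₀ (β : ℝ) (ψ₀ : ℝ → ℝ) (r : ℝ) : ℝ := hopfCole β (ψ₀ r)

/-- The heat flow of the transformed angle. -/
def phase (β : ℝ) (ψ₀ : ℝ → ℝ) (t : ℝ) (x : E2) : ℝ := heatFlow (fun y : E2 => phase₀ β ψ₀ ‖y‖) t x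

lemma isRadial_phase (β : ℝ) (ψ₀ : ℝ → ℝ) (t : ℝ) : IsRadial (phase β ψ₀ t) := fun _ _ h =>
  heatFlow_eq_of_norm_eq (phase₀ β ψ₀) t h

lemma norm_single_norm {n : ℕ} [NeZero n] (x : E2) :
    ‖(EuclideanSpace.single 0 ‖x‖ : EuclideanSpace ℝ (Fin n))‖ = ‖x‖ := by
  simp

lemma psi_norm (β : ℝ) (ψ₀ : ℝ → ℝ) (t : ℝ) (x : E2) :
    psi β ψ₀ t ‖x‖ = hopfColeInv β (phase β ψ₀ t x) := by
  rw [isRadial_phase β ψ₀ t (norm_single_norm (n := 2) x).symm]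
  rfl

section Data

variable {δ₁ β : ℝ} (hδ₁ : δ₁ ∈ Ioo 0 (Real.pi / 2)) (hβ : 1 / Real.sin δ₁ ^ 2 ≤ β)
  {u₀ ψ₀ : ℝ → ℝ} (hA : AdmissibleData δ₁ u₀ ψ₀)

include hδ₁ hβ hA

/-- On `[a, b]` the values of `ψ₀` fill a compact subinterval of the open interval, where `F` is
Lipschitz. For the critical `β` this fails up to the endpoints. -/
lemma absolutelyContinuousOnInterval_phase₀ (a b : ℝ) (ha : 0 < a) (hab : a < b) :
    AbsolutelyContinuousOnInterval (phase₀ β ψ₀) a b := by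
  have hψ := hA.ac_psi a b ha hab
  have himg := (isPreconnected_uIcc (a := a) (b := b)).image ψ₀ hψ.continuousOn
  have hcomp := (isCompact_uIcc (a := a) (b := b)).image_of_continuousOn hψ.continuousOn
  have hsub : ψ₀ '' uIcc a b ⊆ Ioo δ₁ (Real.pi - δ₁) := by
    rintro _ ⟨r, hr, rfl⟩
    rw [uIcc_of_le hab.le] at hr
    exact hA.range_psi r (ha.trans_le hr.1)
  obtain ⟨K, hK⟩ := ((contDiffOn_hopfCole hδ₁ hβ).mono hsub).exists_lipschitzOnWith (by simp)
    himg.ordConnected.convex hcomp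
  exact hψ.comp_lipschitzOnWith hK fun x hx => mem_image_of_mem _ hx

lemma phase₀_mem_Ioo {r : ℝ} (hr : 0 < r) :
    phase₀ β ψ₀ r ∈ Ioo (hopfCole β δ₁) (Real.pi - hopfCole β δ₁) :=
  hopfCole_mem_Ioo hδ₁ hβ (hA.range_psi r hr)

omit hδ₁ hβ hA in
lemma abs_phase₀_le (r : ℝ) : |phase₀ β ψ₀ r| ≤ Real.pi := by
  rw [phase₀, hopfCole, abs_of_nonneg (Real.arccos_nonneg _)]
  exact Real.arccos_le_pi _

lemma aestronglyMeasurable_phase₀_norm : AEStronglyMeasurable fun y : E2 => phase₀ β ψ₀ ‖y‖ :=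
  aestronglyMeasurable_profile_norm (absolutelyContinuousOnInterval_phase₀ hδ₁ hβ hA)

lemma gaussianIntegrable_phase₀_norm : GaussianIntegrable fun y : E2 => phase₀ β ψ₀ ‖y‖ :=
  .of_bound (aestronglyMeasurable_phase₀_norm hδ₁ hβ hA) (ae_of_all _ fun _ => abs_phase₀_le _)

lemma contDiff_phase {t : ℝ} (ht : 0 < t) : ContDiff ℝ ∞ (phase β ψ₀ t) :=
  (gaussianIntegrable_phase₀_norm hδ₁ hβ hA).contDiff_heatFlow ht

lemma phase_mem_Ioo {t : ℝ} (ht : 0 < t) (x : E2) :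
    phase β ψ₀ t x ∈ Ioo (hopfCole β δ₁) (Real.pi - hopfCole β δ₁) := by
  refine heatFlow_mem_Ioo (aestronglyMeasurable_phase₀_norm hδ₁ hβ hA) ?_ ht x
  filter_upwards [compl_mem_ae_iff.2 (measure_singleton (0 : E2))] with y hy
  exact phase₀_mem_Ioo hδ₁ hβ hA (norm_pos_iff.2 hy)

lemma hopfCole_hopfColeInv_phase {t : ℝ} (ht : 0 < t) (x : E2) :
    hopfCole β (hopfColeInv β (phase β ψ₀ t x)) = phase β ψ₀ t x := by
  have h := phase_mem_Ioo hδ₁ hβ hA ht x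
  have h0 : 0 ≤ hopfCole β δ₁ := hopfCole_nonneg
  exact hopfCole_hopfColeInv (one_lt_beta hδ₁ hβ) ⟨h0.trans h.1.le, by linarith [h.2]⟩

lemma director_eq {t : ℝ} (ht : 0 < t) (x : E2) :
    director β ψ₀ t x = greatCircle β (phase β ψ₀ t x) := by
  rw [director, dRad, psi_norm, sph_Phi_eq_greatCircle hδ₁ hβ
    (hopfColeInv_mem_Ioo hδ₁ hβ (phase_mem_Ioo hδ₁ hβ hA ht x)),
    hopfCole_hopfColeInv_phase hδ₁ hβ hA ht]

/-- The origin is excluded because `ψ₀ 0` is not constrained by the hypotheses. -/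
lemma director₀_eq {x : E2} (hx : x ≠ 0) :
    director₀ β ψ₀ x = greatCircle β (phase₀ β ψ₀ ‖x‖) :=
  sph_Phi_eq_greatCircle hδ₁ hβ (hA.range_psi _ (norm_pos_iff.2 hx))

lemma tendsto_phase {x : E2} (hx : x ≠ 0) :
    Tendsto (fun t => phase β ψ₀ t x) (𝓝[>] 0) (𝓝 (phase₀ β ψ₀ ‖x‖)) := by
  have hc : ContinuousAt (phase₀ β ψ₀) ‖x‖ :=
    (continuousOn_profile (absolutelyContinuousOnInterval_phase₀ hδ₁ hβ hA)).continuousAt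
      (Ioi_mem_nhds (norm_pos_iff.2 hx))
  exact tendsto_heatFlow_of_continuousAt (f := fun y : E2 => phase₀ β ψ₀ ‖y‖)
    (aestronglyMeasurable_phase₀_norm hδ₁ hβ hA) (ae_of_all _ fun _ => abs_phase₀_le _)
    (hc.comp continuous_norm.continuousAt)

lemma tendsto_director {x : E2} (hx : x ≠ 0) :
    Tendsto (fun t => director β ψ₀ t x) (𝓝[>] 0) (𝓝 (director₀ β ψ₀ x)) := by
  rw [director₀_eq hδ₁ hβ hA hx]
  refine (((contDiff_greatCircle β).continuous.tendsto _).comp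
    (tendsto_phase hδ₁ hβ hA hx)).congr' ?_
  filter_upwards [self_mem_nhdsWithin] with t ht
  exact (director_eq hδ₁ hβ hA ht x).symm

/-! ### The length of the image curve -/

/-- By the semigroup law `v(t)` is an average of `v(s)`, whose range is an interval by continuity
and contains its averages. -/
lemma range_phase_subset {s t : ℝ} (hs : 0 < s) (hst : s ≤ t) :
    range (phase β ψ₀ t) ⊆ range (phase β ψ₀ s) := by
  rcases hst.eq_or_lt with rfl | hlt
  · exact subset_rfl
  rintro _ ⟨x, rfl⟩
  have hc := (contDiff_phase hδ₁ hβ hA hs).continuous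
  have h := heatFlow_add (aestronglyMeasurable_phase₀_norm hδ₁ hβ hA)
    (ae_of_all _ fun y => abs_phase₀_le ‖y‖) (sub_pos.2 hlt) hs x
  rw [sub_add_cancel] at h
  rw [phase, h]
  refine heatFlow_mem_of_ordConnected (C := Real.pi) hc.aestronglyMeasurable
    (isPreconnected_range hc).ordConnected ?_ (ae_of_all _ fun y => mem_range_self y)
    (sub_pos.2 hlt) x
  rintro _ ⟨y, rfl⟩
  have h := phase_mem_Ioo hδ₁ hβ hA hs y
  have h0 : 0 ≤ hopfCole β δ₁ := hopfCole_nonneg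
  exact abs_le.2 ⟨by linarith [h.1, Real.pi_pos], by linarith [h.2]⟩

lemma range_phase_subset_image {t : ℝ} (ht : 0 < t) :
    range (phase β ψ₀ t) ⊆ phase₀ β ψ₀ '' Ioi 0 := by
  rintro _ ⟨x, rfl⟩
  have hc := continuousOn_profile (absolutelyContinuousOnInterval_phase₀ hδ₁ hβ hA)
  refine heatFlow_mem_of_ordConnected (C := Real.pi) (aestronglyMeasurable_phase₀_norm hδ₁ hβ hA)
    (isPreconnected_Ioi.image _ hc).ordConnected ?_ ?_ ht x
  · rintro _ ⟨r, -, rfl⟩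
    exact abs_phase₀_le r
  · filter_upwards [compl_mem_ae_iff.2 (measure_singleton (0 : E2))] with y hy
    exact mem_image_of_mem _ (norm_pos_iff.2 hy)

/-- The image arcs are nested as sets, so monotonicity of the measure suffices. -/
lemma imageLength_director_le {s t : ℝ} (hs : 0 < s) (hst : s ≤ t) :
    imageLength (director β ψ₀ t) ≤ imageLength (director β ψ₀ s) := by
  refine measure_mono ?_
  rintro _ ⟨x, rfl⟩
  obtain ⟨y, hy⟩ := range_phase_subset hδ₁ hβ hA hs hst (mem_range_self x)
  exact ⟨y, by rw [director_eq hδ₁ hβ hA hs, director_eq hδ₁ hβ hA (hs.trans_le hst), hy]⟩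

lemma imageLength_director_le_initial {t : ℝ} (ht : 0 < t) :
    imageLength (director β ψ₀ t) ≤ imageLength (director₀ β ψ₀) := by
  refine measure_mono ?_
  rintro _ ⟨x, rfl⟩
  obtain ⟨r, hr : 0 < r, h⟩ := range_phase_subset_image hδ₁ hβ hA ht (mem_range_self x)
  have hn : ‖(EuclideanSpace.single 0 r : E2)‖ = r := by
    simp [abs_of_pos hr]
  refine ⟨EuclideanSpace.single 0 r, ?_⟩
  rw [director_eq hδ₁ hβ hA ht, ← h, director₀_eq hδ₁ hβ hA (norm_pos_iff.1 (by rwa [hn])), hn]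

/-! ### The elastic energy -/

lemma pd_director {t : ℝ} (ht : 0 < t) (i : Fin 2) (x : E2) :
    pd i (director β ψ₀ t) x = pd i (phase β ψ₀ t) x • greatCircleDeriv β (phase β ψ₀ t x) := by
  rw [funext (director_eq hδ₁ hβ hA ht)]
  exact pd_comp_real (hasDerivAt_greatCircle β _)
    ((contDiff_phase hδ₁ hβ hA ht).differentiable (by simp) x) i

lemma ae_pd_director₀ : ∀ᵐ x : E2, ∀ i, pd i (director₀ β ψ₀) x
    = radialPartial (phase₀ β ψ₀) i x • greatCircleDeriv β (phase₀ β ψ₀ ‖x‖) := by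
  filter_upwards [ae_hasFDerivAt_profile_norm (absolutelyContinuousOnInterval_phase₀ hδ₁ hβ hA),
    compl_mem_ae_iff.2 (measure_singleton (0 : E2))] with x hx h0 i
  have h1 : director₀ β ψ₀ =ᶠ[𝓝 x] fun y => greatCircle β (phase₀ β ψ₀ ‖y‖) :=
    (isOpen_ne.eventually_mem h0).mono fun y hy => director₀_eq hδ₁ hβ hA hy
  rw [pd, h1.fderiv_eq, ← hx.2 i]
  exact pd_comp_real (f := fun y : E2 => phase₀ β ψ₀ ‖y‖) (hasDerivAt_greatCircle β _) hx.1 i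

lemma sqNorm_pd_director₀ (i : Fin 2) :
    sqNorm (pd i (director₀ β ψ₀)) = ∫⁻ x, ‖radialPartial (phase₀ β ψ₀) i x‖ₑ ^ 2 := by
  refine lintegral_congr_ae ?_
  filter_upwards [ae_pd_director₀ hδ₁ hβ hA] with x hx
  rw [hx i, enorm_smul, ← ofReal_norm (greatCircleDeriv _ _),
    norm_greatCircleDeriv (one_lt_beta hδ₁ hβ), ENNReal.ofReal_one, mul_one]

lemma dirichlet_director₀ : dirichlet (director₀ β ψ₀)
    = sphereArea 2 * ∫⁻ r in Ioi 0, ‖deriv (phase₀ β ψ₀) r ^ 2 * r‖ₑ := by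
  rw [← lintegral_deriv_sq_norm, ← sum_lintegral_radialPartial, dirichlet]
  exact Finset.sum_congr rfl fun i _ => sqNorm_pd_director₀ hδ₁ hβ hA i

lemma integrableOn_deriv_phase₀ (h : dirichlet (director₀ β ψ₀) < ⊤) :
    IntegrableOn (fun r => deriv (phase₀ β ψ₀) r ^ 2 * r) (Ioi 0) := by
  rw [dirichlet_director₀ hδ₁ hβ hA] at h
  refine ⟨?_, ?_⟩
  · have := measurable_deriv (phase₀ β ψ₀)
    exact Measurable.aestronglyMeasurable (by fun_prop)
  · exact (ENNReal.mul_lt_top_iff.1 h).elim (fun h => h.2)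
      (Or.rec (fun h => absurd h sphereArea_ne_zero) fun h => by
        rw [HasFiniteIntegral, h]; exact ENNReal.zero_lt_top)

lemma dirichlet_director₀_lt_top (hlt : 1 / Real.sin δ₁ ^ 2 < β) :
    dirichlet (director₀ β ψ₀) < ⊤ := by
  have hs := sin_pos_of_mem_Ioo_half hδ₁
  have h0 := one_lt_beta hδ₁ hβ
  have h1 : 0 < β * Real.sin δ₁ ^ 2 - 1 := by
    rw [div_lt_iff₀ (by positivity)] at hlt; linarith
  rw [dirichlet_director₀ hδ₁ hβ hA]
  refine ENNReal.mul_lt_top sphereArea_ne_top.lt_top ?_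
  -- The constant bounds `F'(ψ)² = β sin² ψ / (β sin² ψ - 1)`, as `sin δ₁ < sin ψ ≤ 1`.
  have h2 := (hA.energy_psi.const_mul (β / (β * Real.sin δ₁ ^ 2 - 1)))
  have hm : AEStronglyMeasurable (fun r => deriv (phase₀ β ψ₀) r ^ 2 * r)
      (volume.restrict (Ioi 0)) := by
    have := measurable_deriv (phase₀ β ψ₀)
    exact Measurable.aestronglyMeasurable (by fun_prop)
  refine (h2.mono' hm ?_).2
  filter_upwards [ae_differentiableAt_profile hA.ac_psi, ae_restrict_mem measurableSet_Ioi]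
    with r hr (hpos : 0 < r)
  have hψ := hA.range_psi r hpos
  have hd : HasDerivAt (phase₀ β ψ₀) _ r :=
    (hasDerivAt_hopfCole hδ₁ hβ hψ).comp r hr.hasDerivAt
  have h3 := sin_lt_sin_of_mem_Ioo hδ₁ hψ
  have h4 : β * Real.sin δ₁ ^ 2 - 1 ≤ β * Real.sin (ψ₀ r) ^ 2 - 1 := by gcongr
  have h5 : Real.sin (ψ₀ r) ^ 2 ≤ 1 := Real.sin_sq_le_one _
  rw [hd.deriv, Real.norm_of_nonneg (by positivity), mul_pow, div_pow, mul_pow,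
    Real.sq_sqrt (by linarith), Real.sq_sqrt (by linarith), ← mul_assoc]
  have h6 : β * Real.sin (ψ₀ r) ^ 2 ≤ β := by nlinarith
  gcongr

variable (hfin : dirichlet (director₀ β ψ₀) < ⊤)

include hfin

lemma pd_phase {t : ℝ} (ht : 0 < t) (i : Fin 2) (x : E2) :
    pd i (phase β ψ₀ t) x = heatFlow (radialPartial (phase₀ β ψ₀) i) t x :=
  pd_heatFlow_profile (absolutelyContinuousOnInterval_phase₀ hδ₁ hβ hA)
    (integrableOn_deriv_phase₀ hδ₁ hβ hA hfin) (fun _ _ => abs_phase₀_le _) ht i x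

/-- Since `|γ'| = 1`, this is the `L²` contraction for each component of the weak gradient of the
angle. -/
lemma dirichlet_director_le {t : ℝ} (ht : 0 < t) :
    dirichlet (director β ψ₀ t) ≤ dirichlet (director₀ β ψ₀) := by
  refine Finset.sum_le_sum fun i _ => ?_
  rw [sqNorm_pd_director₀ hδ₁ hβ hA]
  refine le_of_eq_of_le (lintegral_congr fun x => ?_) (lintegral_heatFlow_sq_le
    (measurable_radialPartial (phase₀ β ψ₀) i).aestronglyMeasurable ht)
  rw [pd_director hδ₁ hβ hA ht, pd_phase hδ₁ hβ hA hfin ht, enorm_smul,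
    ← ofReal_norm (greatCircleDeriv _ _), norm_greatCircleDeriv (one_lt_beta hδ₁ hβ),
    ENNReal.ofReal_one, mul_one]

lemma tendsto_sqNorm_director_sub :
    Tendsto (fun t => sqNorm fun x => director β ψ₀ t x - director₀ β ψ₀ x) (𝓝[>] 0) (𝓝 0) := by
  refine tendsto_of_tendsto_of_tendsto_of_le_of_le' tendsto_const_nhds
    (tendsto_lintegral_heatFlow_profile_sub (absolutelyContinuousOnInterval_phase₀ hδ₁ hβ hA)
      (integrableOn_deriv_phase₀ hδ₁ hβ hA hfin))
    (Eventually.of_forall fun _ => zero_le) (eventually_mem_nhdsWithin.mono fun t ht => ?_)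
  refine lintegral_mono_ae ?_
  filter_upwards [compl_mem_ae_iff.2 (measure_singleton (0 : E2))] with x hx
  rw [director_eq hδ₁ hβ hA ht, director₀_eq hδ₁ hβ hA hx, ← ofReal_norm, ← ofReal_norm]
  gcongr
  exact norm_greatCircle_sub_le (one_lt_beta hδ₁ hβ) _ _

/-- With `V = ∂_i v` and `D = ∂_i v₀`, the difference splits into `(V - D) γ'(v)` and `D (γ'(v) -
γ'(v₀))`. The first tends to zero as `V` is the heat flow of `D`. The second does by dominated
convergence with bound `2 |D|`, as `v → v₀` pointwise. -/
lemma tendsto_sqNorm_pd_director_sub (i : Fin 2) :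
    Tendsto (fun t => sqNorm fun x => pd i (director β ψ₀ t) x - pd i (director₀ β ψ₀) x)
      (𝓝[>] 0) (𝓝 0) := by
  have h1β := one_lt_beta hδ₁ hβ
  have hD := memLp_radialPartial (integrableOn_deriv_phase₀ hδ₁ hβ hA hfin) i
  have hDm := measurable_radialPartial (phase₀ β ψ₀) i
  have hm₀ := aestronglyMeasurable_phase₀_norm hδ₁ hβ hA
  have hγ : Continuous (greatCircleDeriv β) :=
    continuous_iff_continuousAt.2 fun v => (hasDerivAt_greatCircleDeriv β v).continuousAt
  have hA1 := tendsto_lintegral_heatFlow_sub hD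
  have hA2 : Tendsto (fun t => ∫⁻ x, ‖radialPartial (phase₀ β ψ₀) i x •
      (greatCircleDeriv β (phase β ψ₀ t x) - greatCircleDeriv β (phase₀ β ψ₀ ‖x‖))‖ₑ ^ 2)
      (𝓝[>] 0) (𝓝 (∫⁻ _ : E2, 0)) := by
    refine tendsto_lintegral_filter_of_dominated_convergence'
      (fun x => ‖radialPartial (phase₀ β ψ₀) i x * 2‖ₑ ^ 2) ?_ ?_ ?_ ?_
    · filter_upwards [self_mem_nhdsWithin] with t ht
      exact (hDm.aestronglyMeasurable.smul ((hγ.comp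
        (contDiff_phase hδ₁ hβ hA ht).continuous).aestronglyMeasurable.sub
        (hγ.comp_aestronglyMeasurable hm₀))).enorm.pow_const 2
    · refine Eventually.of_forall fun t => ae_of_all _ fun x => ?_
      rw [← ofReal_norm, ← ofReal_norm]
      gcongr
      rw [norm_smul, norm_mul]
      gcongr
      refine (norm_sub_le _ _).trans ?_
      rw [norm_greatCircleDeriv h1β, norm_greatCircleDeriv h1β]
      norm_num
    · simp_rw [enorm_mul, mul_pow]
      rw [lintegral_mul_const _ (hDm.enorm.pow_const 2)]
      exact ENNReal.mul_ne_top ((memLp_two_iff_lintegral hD.1).1 hD).ne (by simp)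
    · filter_upwards [compl_mem_ae_iff.2 (measure_singleton (0 : E2))] with x hx
      have h1 := ((hγ.tendsto _).comp (tendsto_phase hδ₁ hβ hA hx)).sub_const
        (greatCircleDeriv β (phase₀ β ψ₀ ‖x‖))
      have h2 := ENNReal.Tendsto.pow (n := 2)
        (h1.const_smul (radialPartial (phase₀ β ψ₀) i x)).enorm
      simpa using h2
  have h0 := (ENNReal.Tendsto.const_mul hA1 (a := 2) (Or.inr (by norm_num))).add
    (ENNReal.Tendsto.const_mul hA2 (a := 2) (Or.inr (by norm_num)))
  simp only [lintegral_zero, mul_zero, add_zero] at h0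
  refine tendsto_of_tendsto_of_tendsto_of_le_of_le' tendsto_const_nhds h0
    (Eventually.of_forall fun _ => zero_le) (eventually_mem_nhdsWithin.mono fun t ht => ?_)
  have hm : AEMeasurable fun x : E2 => 2 * ‖radialPartial (phase₀ β ψ₀) i x •
      (greatCircleDeriv β (phase β ψ₀ t x) - greatCircleDeriv β (phase₀ β ψ₀ ‖x‖))‖ₑ ^ 2 :=
    ((hDm.aestronglyMeasurable.smul ((hγ.comp
        (contDiff_phase hδ₁ hβ hA ht).continuous).aestronglyMeasurable.sub
        (hγ.comp_aestronglyMeasurable hm₀))).enorm.pow_const 2).const_mul 2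
  rw [← lintegral_const_mul' _ _ (by norm_num), ← lintegral_const_mul' _ _ (by norm_num),
    ← lintegral_add_right' _ hm]
  refine lintegral_mono_ae ?_
  filter_upwards [ae_pd_director₀ hδ₁ hβ hA] with x hx
  rw [hx i, pd_director hδ₁ hβ hA ht, pd_phase hδ₁ hβ hA hfin ht]
  set V := heatFlow (radialPartial (phase₀ β ψ₀) i) t x
  set D := radialPartial (phase₀ β ψ₀) i x
  have hsplit : V • greatCircleDeriv β (phase β ψ₀ t x) - D • greatCircleDeriv β (phase₀ β ψ₀ ‖x‖)
      = (V - D) • greatCircleDeriv β (phase β ψ₀ t x)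
        + D • (greatCircleDeriv β (phase β ψ₀ t x) - greatCircleDeriv β (phase₀ β ψ₀ ‖x‖)) := by
    module
  rw [hsplit]
  refine (enorm_add_sq_le _ _).trans_eq ?_
  rw [enorm_smul (V - D), ← ofReal_norm (greatCircleDeriv _ (phase β ψ₀ t x)),
    norm_greatCircleDeriv h1β, ENNReal.ofReal_one, mul_one]

end Data

/-! ### Radial functions on the first coordinate axis -/

lemma hasDerivAt_comp_single {V : Type*} [NormedAddCommGroup V] [NormedSpace ℝ V] {n : ℕ}
    {f : EuclideanSpace ℝ (Fin n) → V} {i : Fin n} {r : ℝ}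
    (hf : DifferentiableAt ℝ f (EuclideanSpace.single i r)) :
    HasDerivAt (fun ρ : ℝ => f (EuclideanSpace.single i ρ))
      (fderiv ℝ f (EuclideanSpace.single i r) (EuclideanSpace.single i 1)) r := by
  have h : HasDerivAt (fun ρ : ℝ => (EuclideanSpace.single i ρ : EuclideanSpace ℝ (Fin n)))
      (EuclideanSpace.single i 1) r := by
    refine hasDerivAt_euclidean fun j => ?_
    by_cases hj : j = i
    · subst hj; simpa using hasDerivAt_id' r
    · simpa [hj] using hasDerivAt_const r (0 : ℝ)
  exact HasFDerivAt.comp_hasDerivAt r hf.hasFDerivAt h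

/-- The Laplacian of a radial function in polar coordinates. -/
lemma IsRadial.sum_partialDeriv_partialDeriv {n : ℕ} {f : EuclideanSpace ℝ (Fin (n + 1)) → ℝ}
    (hf : IsRadial f) (hs : ContDiff ℝ ∞ f) {r : ℝ} (hr : r ≠ 0) :
    ∑ i, partialDeriv i (partialDeriv i f) (EuclideanSpace.single 0 r)
      = iteratedDeriv 2 (fun ρ => f (EuclideanSpace.single 0 ρ)) r
        + n / r * deriv (fun ρ => f (EuclideanSpace.single 0 ρ)) r := by
  have h1 : deriv (fun ρ => f (EuclideanSpace.single 0 ρ))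
      = fun ρ => partialDeriv 0 f (EuclideanSpace.single 0 ρ) :=
    funext fun ρ => (hasDerivAt_comp_single (hs.differentiable (by simp) _)).deriv
  have h2 : iteratedDeriv 2 (fun ρ => f (EuclideanSpace.single 0 ρ)) r
      = partialDeriv 0 (partialDeriv 0 f) (EuclideanSpace.single 0 r) := by
    rw [iteratedDeriv_succ, iteratedDeriv_one, h1]
    exact (hasDerivAt_comp_single
      ((contDiff_partialDeriv hs 0).differentiable (by simp) _)).deriv
  -- Each of the `n` transverse directions contributes the same `f_r / r`.
  have h3 : ∀ j : Fin n, partialDeriv j.succ (partialDeriv j.succ f) (EuclideanSpace.single 0 r)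
      = partialDeriv 0 f (EuclideanSpace.single 0 r) / r := fun j => by
    have h := hf.partialDeriv_eq_mul_partialDeriv hs (x := EuclideanSpace.single 0 r)
      (j := j.succ) (by simp) 0
    rw [h]
    simp [hr]
  rw [h2, h1, Fin.sum_univ_succ, Finset.sum_congr rfl fun j _ => h3 j]
  simp
  ring

section Equations

variable {δ₁ β : ℝ} (hδ₁ : δ₁ ∈ Ioo 0 (Real.pi / 2)) (hβ : 1 / Real.sin δ₁ ^ 2 ≤ β)
  {u₀ ψ₀ : ℝ → ℝ} (hA : AdmissibleData δ₁ u₀ ψ₀)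

include hδ₁ hβ hA

lemma hasDerivAt_phase_time {t : ℝ} (ht : 0 < t) (x : E2) :
    HasDerivAt (fun s => phase β ψ₀ s x)
      (∑ i, partialDeriv i (partialDeriv i (phase β ψ₀ t)) x) t :=
  (gaussianIntegrable_phase₀_norm hδ₁ hβ hA).hasDerivAt_heatFlow_laplacian ht x

lemma deriv_phase_time {t r : ℝ} (ht : 0 < t) (hr : 0 < r) :
    deriv (fun s => phase β ψ₀ s (EuclideanSpace.single 0 r)) t
      = iteratedDeriv 2 (fun ρ => phase β ψ₀ t (EuclideanSpace.single 0 ρ)) r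
        + 1 / r * deriv (fun ρ => phase β ψ₀ t (EuclideanSpace.single 0 ρ)) r := by
  rw [(hasDerivAt_phase_time hδ₁ hβ hA ht _).deriv,
    (isRadial_phase β ψ₀ t).sum_partialDeriv_partialDeriv (contDiff_phase hδ₁ hβ hA ht) hr.ne']
  simp

lemma deriv_hopfCole_psi {t r : ℝ} (ht : 0 < t) (hr : 0 < r) :
    deriv (fun s => hopfCole β (psi β ψ₀ s r)) t
      = iteratedDeriv 2 (fun ρ => hopfCole β (psi β ψ₀ t ρ)) r
        + 1 / r * deriv (fun ρ => hopfCole β (psi β ψ₀ t ρ)) r := by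
  have h1 : ∀ s > 0, ∀ ρ, hopfCole β (psi β ψ₀ s ρ) = phase β ψ₀ s (EuclideanSpace.single 0 ρ) :=
    fun s hs ρ => hopfCole_hopfColeInv_phase hδ₁ hβ hA hs _
  have h2 : (fun s => hopfCole β (psi β ψ₀ s r))
      =ᶠ[𝓝 t] fun s => phase β ψ₀ s (EuclideanSpace.single 0 r) :=
    eventually_of_mem (Ioi_mem_nhds ht) fun s hs => h1 s hs r
  rw [h2.deriv_eq, funext (h1 t ht)]
  exact deriv_phase_time hδ₁ hβ hA ht hr

/-- For `ψ = G(v)` the heat equation gives `ψ_t = ψ_rr + ψ_r / r - G''(v) v_r²`, and `G''` is the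
stated coefficient times `G'²`. This uses `sin v ≠ 0`, that is, `v` strictly between `0` and `π`. -/
lemma deriv_psi {t r : ℝ} (ht : 0 < t) (hr : 0 < r) :
    deriv (fun s => psi β ψ₀ s r) t
      = iteratedDeriv 2 (psi β ψ₀ t) r + 1 / r * deriv (psi β ψ₀ t) r
        - Real.cos (psi β ψ₀ t r)
          / ((β * Real.sin (psi β ψ₀ t r) ^ 2 - 1) * Real.sin (psi β ψ₀ t r))
          * deriv (psi β ψ₀ t) r ^ 2 := by
  have h1β := one_lt_beta hδ₁ hβ
  have hs := contDiff_phase hδ₁ hβ hA ht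
  set V : ℝ → ℝ := fun ρ => phase β ψ₀ t (EuclideanSpace.single 0 ρ) with hV
  have hψ : psi β ψ₀ t = fun ρ => hopfColeInv β (V ρ) := rfl
  have hVd : ∀ ρ, HasDerivAt V (partialDeriv 0 (phase β ψ₀ t) (EuclideanSpace.single 0 ρ)) ρ :=
    fun ρ => hasDerivAt_comp_single (hs.differentiable (by simp) _)
  have hV1 : deriv V = fun ρ => partialDeriv 0 (phase β ψ₀ t) (EuclideanSpace.single 0 ρ) :=
    funext fun ρ => (hVd ρ).deriv
  have hVd2 : HasDerivAt (deriv V) (iteratedDeriv 2 V r) r := by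
    rw [iteratedDeriv_succ, iteratedDeriv_one]
    refine DifferentiableAt.hasDerivAt ?_
    rw [hV1]
    exact (hasDerivAt_comp_single
      ((contDiff_partialDeriv hs 0).differentiable (by simp) _)).differentiableAt
  have hψ1 : deriv (psi β ψ₀ t) = fun ρ =>
      √((β - 1) / β) * Real.sin (V ρ) / Real.sin (hopfColeInv β (V ρ)) * deriv V ρ := by
    rw [hψ]
    funext ρ
    rw [hV1]
    exact ((hasDerivAt_hopfColeInv h1β (V ρ)).comp ρ (hVd ρ)).deriv
  have hψ2 : iteratedDeriv 2 (psi β ψ₀ t) r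
      = Real.cos (hopfColeInv β (V r)) / Real.sin (hopfColeInv β (V r))
          * (1 - (√((β - 1) / β) * Real.sin (V r) / Real.sin (hopfColeInv β (V r))) ^ 2)
          * deriv V r * deriv V r
        + √((β - 1) / β) * Real.sin (V r) / Real.sin (hopfColeInv β (V r))
          * iteratedDeriv 2 V r := by
    rw [iteratedDeriv_succ, iteratedDeriv_one, hψ1]
    exact (((hasDerivAt_deriv_hopfColeInv h1β (V r)).comp r
      (hVd r).differentiableAt.hasDerivAt).fun_mul hVd2).deriv
  have hψt : deriv (fun s => psi β ψ₀ s r) t = _ :=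
    ((hasDerivAt_hopfColeInv h1β (V r)).comp t
      (hasDerivAt_phase_time hδ₁ hβ hA ht (EuclideanSpace.single 0 r))).deriv
  have hheat := deriv_phase_time hδ₁ hβ hA ht hr
  rw [(hasDerivAt_phase_time hδ₁ hβ hA ht _).deriv] at hheat
  have hmem := phase_mem_Ioo hδ₁ hβ hA ht (EuclideanSpace.single 0 r)
  have h0 : 0 ≤ hopfCole β δ₁ := hopfCole_nonneg
  have hsin : Real.sin (V r) ≠ 0 :=
    (Real.sin_pos_of_pos_of_lt_pi (h0.trans_lt hmem.1) (by linarith [hmem.2])).ne'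
  have hG := deriv_deriv_hopfColeInv_eq h1β hsin
  rw [hψt, hheat, hψ2, hψ1]
  rw [hG]
  simp only [hψ]
  ring

omit hδ₁ hβ in
lemma gaussianIntegrable_angular : GaussianIntegrable fun y : E4 => u₀ ‖y‖ / ‖y‖ :=
  .of_memLp_two (memLp_angular hA.measurable_u hA.energy_u)

omit hδ₁ hβ in
lemma deriv_uRad_div {t r : ℝ} (ht : 0 < t) (hr : 0 < r) :
    deriv (fun s => uRad u₀ s r / r) t
      = iteratedDeriv 2 (fun ρ => uRad u₀ t ρ / ρ) r
        + 3 / r * deriv (fun ρ => uRad u₀ t ρ / ρ) r := by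
  have hU := gaussianIntegrable_angular hA
  have h1 : ∀ s, ∀ ρ ≠ 0, uRad u₀ s ρ / ρ
      = heatFlow (fun y : E4 => u₀ ‖y‖ / ‖y‖) s (EuclideanSpace.single 0 ρ) :=
    fun s ρ hρ => mul_div_cancel_left₀ _ hρ
  have h2 : (fun ρ => uRad u₀ t ρ / ρ) =ᶠ[𝓝 r]
      fun ρ => heatFlow (fun y : E4 => u₀ ‖y‖ / ‖y‖) t (EuclideanSpace.single 0 ρ) :=
    (isOpen_ne.eventually_mem hr.ne').mono fun ρ hρ => h1 t ρ hρ
  have h3 : IsRadial (heatFlow (fun y : E4 => u₀ ‖y‖ / ‖y‖) t) := fun x y h =>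
    heatFlow_eq_of_norm_eq (fun r => u₀ r / r) t h
  rw [h2.deriv_eq, h2.iteratedDeriv_eq, funext fun s => h1 s r hr.ne',
    (hU.hasDerivAt_heatFlow_laplacian ht _).deriv,
    h3.sum_partialDeriv_partialDeriv (hU.contDiff_heatFlow ht) hr.ne']
  norm_num

end Equations

/-! ### The explicit fields solve the system -/

/-- The inclusion of the plane into four-space. -/
def planeIncl : E2 →L[ℝ] E4 :=
  LinearMap.toContinuousLinearMap
    { toFun := fun x => !₂[x 0, x 1, 0, 0]
      map_add' := fun x y => by ext i; fin_cases i <;> simp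
      map_smul' := fun c x => by ext i; fin_cases i <;> simp }

lemma planeIncl_apply (x : E2) : planeIncl x = !₂[x 0, x 1, 0, 0] := rfl

lemma norm_planeIncl (x : E2) : ‖planeIncl x‖ = ‖x‖ := by
  rw [EuclideanSpace.norm_eq, EuclideanSpace.norm_eq, Fin.sum_univ_four, Fin.sum_univ_two]
  simp [planeIncl_apply]

lemma planeIncl_castLE (x : E2) (i : Fin 2) :
    planeIncl x (Fin.castLE (by norm_num : 2 ≤ 4) i) = x i := by
  fin_cases i <;> simp [planeIncl_apply]

lemma planeIncl_single (i : Fin 2) (r : ℝ) :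
    planeIncl (EuclideanSpace.single i r)
      = EuclideanSpace.single (Fin.castLE (by norm_num : 2 ≤ 4) i) r := by
  ext j; fin_cases i <;> fin_cases j <;> simp [planeIncl_apply]

lemma pd_comp_planeIncl {f : E4 → ℝ} {x : E2} (hf : DifferentiableAt ℝ f (planeIncl x))
    (i : Fin 2) : pd i (fun y => f (planeIncl y)) x
      = partialDeriv (Fin.castLE (by norm_num : 2 ≤ 4) i) f (planeIncl x) := by
  have h : HasFDerivAt (fun y => f (planeIncl y)) _ x :=
    hf.hasFDerivAt.comp x planeIncl.hasFDerivAt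
  rw [pd_eq_of_hasFDerivAt h i, partialDeriv, ← planeIncl_single]
  rfl

/-- The angular velocity `u / r` as a function on the plane. -/
def angular (u₀ : ℝ → ℝ) (t : ℝ) (x : E2) : ℝ :=
  heatFlow (fun y : E4 => u₀ ‖y‖ / ‖y‖) t (planeIncl x)

/-- The time derivative of the transformed angle. -/
def phaseDeriv (β : ℝ) (ψ₀ : ℝ → ℝ) (t : ℝ) (x : E2) : ℝ := deriv (fun s => phase β ψ₀ s x) t

/-- The radial derivative of the transformed angle, divided by the radius. -/
def phaseSlope (β : ℝ) (ψ₀ : ℝ → ℝ) (t : ℝ) : E2 → ℝ := radialMean (phaseDeriv β ψ₀ t)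

lemma isRadial_angular (u₀ : ℝ → ℝ) (t : ℝ) : IsRadial (angular u₀ t) := fun x y h =>
  heatFlow_eq_of_norm_eq (fun r => u₀ r / r) t (by rw [norm_planeIncl, norm_planeIncl, h])

lemma isRadial_phaseDeriv (β : ℝ) (ψ₀ : ℝ → ℝ) (t : ℝ) : IsRadial (phaseDeriv β ψ₀ t) :=
  fun x y h => by
    have : (fun s => phase β ψ₀ s x) = fun s => phase β ψ₀ s y :=
      funext fun s => isRadial_phase β ψ₀ s h
    rw [phaseDeriv, this, phaseDeriv]

lemma isRadial_phaseSlope (β : ℝ) (ψ₀ : ℝ → ℝ) (t : ℝ) : IsRadial (phaseSlope β ψ₀ t) :=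
  (isRadial_phaseDeriv β ψ₀ t).radialMean

lemma velocity_eq (u₀ : ℝ → ℝ) (t : ℝ) (x : E2) :
    velocity u₀ t x = angular u₀ t x • rotate x := by
  have hU : uRad u₀ t ‖x‖ = ‖x‖ * angular u₀ t x := by
    rw [uRad, angular]
    congr 1
    exact heatFlow_eq_of_norm_eq (fun r => u₀ r / r) t (by simp [norm_planeIncl])
  rw [velocity, swirl, hU, rotate_apply]
  by_cases hx : x = 0
  · ext i; fin_cases i <;> simp [hx]
  · have h0 : ‖x‖ ≠ 0 := norm_ne_zero_iff.2 hx
    ext i; fin_cases i <;> simp <;> field_simp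

section Solution

variable {δ₁ β : ℝ} (hδ₁ : δ₁ ∈ Ioo 0 (Real.pi / 2)) (hβ : 1 / Real.sin δ₁ ^ 2 ≤ β)
  {u₀ ψ₀ : ℝ → ℝ} (hA : AdmissibleData δ₁ u₀ ψ₀)

include hA

lemma contDiffOn_angular :
    ContDiffOn ℝ ∞ (fun z : ℝ × E2 => angular u₀ z.1 z.2) (Ioi 0 ×ˢ univ) :=
  (gaussianIntegrable_angular hA).contDiffOn_heatFlow.comp
    (contDiff_fst.prodMk (planeIncl.contDiff.comp contDiff_snd)).contDiffOn
    fun _ hz => ⟨hz.1, mem_univ _⟩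

/-- The radial derivative of the angular velocity, divided by the radius. -/
lemma exists_pd_angular {t : ℝ} (ht : 0 < t) (x : E2) :
    ∃ q, (∀ i, pd i (angular u₀ t) x = x i * q) ∧
      deriv (fun s => angular u₀ s x) t = (∑ i, pd i (pd i (angular u₀ t)) x) + 2 * q := by
  have hU := gaussianIntegrable_angular hA
  have hs := hU.contDiff_heatFlow ht
  have hr : IsRadial (heatFlow (fun y : E4 => u₀ ‖y‖ / ‖y‖) t) := fun x y h =>
    heatFlow_eq_of_norm_eq (fun r => u₀ r / r) t h
  set U := heatFlow (fun y : E4 => u₀ ‖y‖ / ‖y‖) t with hUdef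
  have h1 : ∀ i, pd i (angular u₀ t) = fun y =>
      partialDeriv (Fin.castLE (by norm_num : 2 ≤ 4) i) U (planeIncl y) := fun i =>
    funext fun y => pd_comp_planeIncl (hs.differentiable (by simp) _) i
  -- On the plane both transverse second derivatives equal `U_r / r`. Their sum, twice the witness,
  -- is what the Laplacian of `ℝ⁴` has beyond that of the plane.
  refine ⟨(partialDeriv 2 (partialDeriv 2 U) (planeIncl x)
    + partialDeriv 3 (partialDeriv 3 U) (planeIncl x)) / 2, fun i => ?_, ?_⟩
  · have h2 := hr.partialDeriv_eq_mul_partialDeriv hs (x := planeIncl x) (j := 2)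
      (by simp [planeIncl_apply]) (Fin.castLE (by norm_num : 2 ≤ 4) i)
    have h3 := hr.partialDeriv_eq_mul_partialDeriv hs (x := planeIncl x) (j := 3)
      (by simp [planeIncl_apply]) (Fin.castLE (by norm_num : 2 ≤ 4) i)
    rw [planeIncl_castLE] at h2 h3
    rw [h1]
    linarith
  · have h4 : ∀ i, pd i (pd i (angular u₀ t)) x
        = partialDeriv (Fin.castLE (by norm_num : 2 ≤ 4) i)
          (partialDeriv (Fin.castLE (by norm_num : 2 ≤ 4) i) U) (planeIncl x) := fun i => by
      rw [h1]
      exact pd_comp_planeIncl ((contDiff_partialDeriv hs _).differentiable (by simp) _) i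
    simp only [h4]
    rw [show (fun s => angular u₀ s x) = fun s =>
      heatFlow (fun y : E4 => u₀ ‖y‖ / ‖y‖) s (planeIncl x) from rfl,
      (hU.hasDerivAt_heatFlow_laplacian ht _).deriv, Fin.sum_univ_four, Fin.sum_univ_two]
    simp only [← hUdef]
    rw [show Fin.castLE (by norm_num : 2 ≤ 4) (0 : Fin 2) = (0 : Fin 4) from rfl,
      show Fin.castLE (by norm_num : 2 ≤ 4) (1 : Fin 2) = (1 : Fin 4) from rfl]
    ring

include hδ₁ hβ

lemma contDiffOn_phase :
    ContDiffOn ℝ ∞ (fun z : ℝ × E2 => phase β ψ₀ z.1 z.2) (Ioi 0 ×ˢ univ) :=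
  (gaussianIntegrable_phase₀_norm hδ₁ hβ hA).contDiffOn_heatFlow

lemma contDiffOn_phaseDeriv :
    ContDiffOn ℝ ∞ (fun z : ℝ × E2 => phaseDeriv β ψ₀ z.1 z.2) (Ioi 0 ×ˢ univ) := by
  have ho : IsOpen (Ioi (0 : ℝ) ×ˢ (univ : Set E2)) := isOpen_Ioi.prod isOpen_univ
  have hs := contDiffOn_phase hδ₁ hβ hA
  have h1 := (hs.fderiv_of_isOpen ho (m := ∞) (by simp)).clm_apply
    (contDiffOn_const (c := ((1 : ℝ), (0 : E2))))
  refine h1.congr fun z hz => ?_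
  have h2 := ((hs.differentiableOn (by simp)).differentiableAt (ho.mem_nhds hz)).hasFDerivAt
  have h3 : HasDerivAt (fun s : ℝ => (s, z.2)) ((1 : ℝ), (0 : E2)) z.1 :=
    (hasDerivAt_id z.1).prodMk (hasDerivAt_const z.1 z.2)
  exact (HasFDerivAt.comp_hasDerivAt z.1 h2 h3).deriv

lemma contDiffOn_phaseSlope :
    ContDiffOn ℝ ∞ (fun z : ℝ × E2 => phaseSlope β ψ₀ z.1 z.2) (Ioi 0 ×ˢ univ) :=
  contDiffOn_radialMean isOpen_Ioi (contDiffOn_phaseDeriv hδ₁ hβ hA)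

/-- `v_r / r` is the radial average of `Δv = v_t`. Written with `v_t`, it is visibly smooth in `(t,
x)`, the origin included. -/
lemma pd_phase_eq_mul_phaseSlope {t : ℝ} (ht : 0 < t) (x : E2) (i : Fin 2) :
    pd i (phase β ψ₀ t) x = x i * phaseSlope β ψ₀ t x := by
  have hs := contDiff_phase hδ₁ hβ hA ht
  exact (isRadial_phase β ψ₀ t).partialDeriv_eq_mul (hs.differentiable (by simp))
    (fun _ => (isRadial_phase β ψ₀ t).fderiv_self_eq_radialMean hs (isRadial_phaseDeriv β ψ₀ t)
      (fun y => (hasDerivAt_phase_time hδ₁ hβ hA ht y).deriv) x) i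

omit hδ₁ hβ hA in
/-- The radial pressure gradient without the elastic part, divided by the radius. -/
def pressureSlope (β : ℝ) (u₀ ψ₀ : ℝ → ℝ) (t : ℝ) (x : E2) : ℝ :=
  angular u₀ t x ^ 2 - phaseSlope β ψ₀ t x ^ 2

omit hδ₁ hβ hA in
lemma isRadial_pressureSlope (β : ℝ) (u₀ ψ₀ : ℝ → ℝ) (t : ℝ) :
    IsRadial (pressureSlope β u₀ ψ₀ t) := fun x y h => by
  rw [pressureSlope, isRadial_angular u₀ t h, isRadial_phaseSlope β ψ₀ t h, pressureSlope]

lemma contDiffOn_pressureSlope :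
    ContDiffOn ℝ ∞ (fun z : ℝ × E2 => pressureSlope β u₀ ψ₀ z.1 z.2) (Ioi 0 ×ˢ univ) :=
  ((contDiffOn_angular hA).pow 2).sub ((contDiffOn_phaseSlope hδ₁ hβ hA).pow 2)

lemma norm_sq_deriv_dRad {t : ℝ} (ht : 0 < t) (r : ℝ) :
    ‖deriv (dRad β ψ₀ t) r‖ ^ 2
      = r ^ 2 * phaseSlope β ψ₀ t (EuclideanSpace.single 0 r) ^ 2 := by
  have h1 : dRad β ψ₀ t = fun ρ =>
      greatCircle β (phase β ψ₀ t (EuclideanSpace.single 0 ρ)) := funext fun ρ => by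
    have hψ : psi β ψ₀ t ρ = hopfColeInv β (phase β ψ₀ t (EuclideanSpace.single 0 ρ)) := rfl
    rw [dRad, hψ, sph_Phi_eq_greatCircle hδ₁ hβ
      (hopfColeInv_mem_Ioo hδ₁ hβ (phase_mem_Ioo hδ₁ hβ hA ht _)),
      hopfCole_hopfColeInv_phase hδ₁ hβ hA ht]
  have h2 : HasDerivAt (fun ρ => phase β ψ₀ t (EuclideanSpace.single 0 ρ))
      (pd 0 (phase β ψ₀ t) (EuclideanSpace.single 0 r)) r :=
    hasDerivAt_comp_single ((contDiff_phase hδ₁ hβ hA ht).differentiable (by simp) _)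
  have h3 := ((hasDerivAt_greatCircle β _).scomp r h2).deriv
  rw [h1]
  erw [h3]
  rw [norm_smul, norm_greatCircleDeriv (one_lt_beta hδ₁ hβ), mul_one, Real.norm_eq_abs, sq_abs,
    pd_phase_eq_mul_phaseSlope hδ₁ hβ hA ht]
  simp [mul_pow]

/-- Both `u` and `|d_r|` carry a factor `s`, so the singular `1 / s` disappears and the integral
converges at the origin. -/
lemma pIntegrand_eq {t : ℝ} (ht : 0 < t) (s : ℝ) :
    pIntegrand β u₀ ψ₀ t s
      = s * pressureSlope β u₀ ψ₀ t (s • EuclideanSpace.single 0 (1 : ℝ)) := by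
  have h1 : s • EuclideanSpace.single 0 (1 : ℝ) = (EuclideanSpace.single 0 s : E2) := by
    ext j; simp
  have h2 : uRad u₀ t s = s * angular u₀ t (EuclideanSpace.single 0 s) := by
    rw [angular, planeIncl_single]; rfl
  rw [pIntegrand, norm_sq_deriv_dRad hδ₁ hβ hA ht, h1, h2, pressureSlope]
  by_cases hs : s = 0
  -- At `s = 0` the left side vanishes by the convention `1 / 0 = 0`.
  · simp [hs]
  · field_simp

lemma continuous_pressureSlope {t : ℝ} (ht : 0 < t) : Continuous (pressureSlope β u₀ ψ₀ t) :=
  (contDiff_slice (contDiffOn_pressureSlope hδ₁ hβ hA) ht).continuous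

lemma intervalIntegrable_pIntegrand {t : ℝ} (ht : 0 < t) (a b : ℝ) :
    IntervalIntegrable (pIntegrand β u₀ ψ₀ t) volume a b := by
  rw [funext (pIntegrand_eq hδ₁ hβ hA ht)]
  have := continuous_pressureSlope hδ₁ hβ hA ht
  exact Continuous.intervalIntegrable (by fun_prop) _ _

lemma pressure_eq {t : ℝ} (ht : 0 < t) (x : E2) :
    pressure β u₀ ψ₀ t x = ‖x‖ ^ 2 * radialMean (pressureSlope β u₀ ψ₀ t) x
      - ‖x‖ ^ 2 * phaseSlope β ψ₀ t x ^ 2 := by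
  have h1 : ‖x‖ • EuclideanSpace.single 0 (1 : ℝ) = (EuclideanSpace.single 0 ‖x‖ : E2) := by
    ext j; simp
  have hn := (norm_single_norm (n := 2) x).symm
  rw [pressure, pRad, norm_sq_deriv_dRad hδ₁ hβ hA ht, funext (pIntegrand_eq hδ₁ hβ hA ht),
    ← sq_mul_radialMean_smul, h1, isRadial_phaseSlope β ψ₀ t hn,
    (isRadial_pressureSlope β u₀ ψ₀ t).radialMean hn]

theorem isClassicalSolution_explicit :
    IsClassicalSolution (velocity u₀) (director β ψ₀) (pressure β u₀ ψ₀) := by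
  -- No regularity of `R` is required; it enters only through pointwise identities.
  choose! R hR using fun t (ht : 0 < t) => exists_pd_angular hA ht
  have hPs : ContDiffOn ℝ ∞ (fun z : ℝ × E2 =>
      ‖z.2‖ ^ 2 * radialMean (pressureSlope β u₀ ψ₀ z.1) z.2) (Ioi 0 ×ˢ univ) :=
    (contDiff_snd.norm_sq ℝ).contDiffOn.mul
      (contDiffOn_radialMean isOpen_Ioi (contDiffOn_pressureSlope hδ₁ hβ hA))
  refine (isClassicalSolution_of_radial (one_lt_beta hδ₁ hβ) (v := phase β ψ₀)
    (W := angular u₀) (Q := phaseSlope β ψ₀) (R := R)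
    (P := fun t x => ‖x‖ ^ 2 * radialMean (pressureSlope β u₀ ψ₀ t) x)
    (contDiffOn_phase hδ₁ hβ hA) (contDiffOn_angular hA) (contDiffOn_phaseSlope hδ₁ hβ hA) hPs
    (fun t _ => isRadial_phaseSlope β ψ₀ t)
    (fun t ht => pd_phase_eq_mul_phaseSlope hδ₁ hβ hA ht)
    (fun t ht x => (hasDerivAt_phase_time hδ₁ hβ hA ht x).deriv)
    (fun t ht x => (hR t ht x).1) (fun t ht x => (hR t ht x).2)
    (fun t ht x i => ?_)).congr (fun t _ => funext fun x => velocity_eq u₀ t x)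
    (fun t ht => funext fun x => director_eq hδ₁ hβ hA ht x)
    (fun t ht => funext fun x => pressure_eq hδ₁ hβ hA ht x)
  exact partialDeriv_norm_sq_mul_radialMean (isRadial_pressureSlope β u₀ ψ₀ t)
    (continuous_pressureSlope hδ₁ hβ hA ht)
    ((contDiff_slice (f := fun t x => ‖x‖ ^ 2 * radialMean (pressureSlope β u₀ ψ₀ t) x)
      hPs ht).differentiable (by simp)) x i

end Solution

end LiquidCrystal

end

theorem theorem1 (δ₁ : ℝ) (hδ₁ : δ₁ ∈ Ioo 0 (Real.pi / 2))
    (β : ℝ) (hβ : 1 / Real.sin δ₁ ^ 2 ≤ β) :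
    -- `Φ` is smooth, with the stated derivative
    ContDiffOn ℝ ∞ (Phi β) (Ioo δ₁ (Real.pi - δ₁)) ∧
    (∀ ψ ∈ Ioo δ₁ (Real.pi - δ₁), HasDerivAt (Phi β)
      (1 / (Real.sqrt (β * Real.sin ψ ^ 2 - 1) * Real.sin ψ)) ψ) ∧
    ∀ u₀ ψ₀ : ℝ → ℝ, AdmissibleData δ₁ u₀ ψ₀ →
      -- the explicit fields solve the system globally; the pressure integral converges
      IsClassicalSolution (velocity u₀) (director β ψ₀) (pressure β u₀ ψ₀) ∧
      (∀ t > 0, ∀ r > 0, IntervalIntegrable (pIntegrand β u₀ ψ₀ t) volume 0 r) ∧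
      -- the polar angle stays in the interval, and `F(ψ)` is the heat flow of `F(ψ₀)` on `ℝ²`
      (∀ t > 0, ∀ x : E2, psi β ψ₀ t ‖x‖ ∈ Ioo δ₁ (Real.pi - δ₁) ∧
        hopfCole β (psi β ψ₀ t ‖x‖) = heatFlow (fun y : E2 => hopfCole β (ψ₀ ‖y‖)) t x) ∧
      -- the equation of `ψ`, the heat equation of `F(ψ)`, and the radial 4D heat equation of `u / r`
      (∀ t > 0, ∀ r > 0,
        deriv (fun s => psi β ψ₀ s r) t
          = iteratedDeriv 2 (psi β ψ₀ t) r + 1 / r * deriv (psi β ψ₀ t) r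
            - Real.cos (psi β ψ₀ t r)
              / ((β * Real.sin (psi β ψ₀ t r) ^ 2 - 1) * Real.sin (psi β ψ₀ t r))
              * deriv (psi β ψ₀ t) r ^ 2 ∧
        deriv (fun s => hopfCole β (psi β ψ₀ s r)) t
          = iteratedDeriv 2 (fun ρ => hopfCole β (psi β ψ₀ t ρ)) r
            + 1 / r * deriv (fun ρ => hopfCole β (psi β ψ₀ t ρ)) r ∧
        deriv (fun s => uRad u₀ s r / r) t
          = iteratedDeriv 2 (fun ρ => uRad u₀ t ρ / ρ) r
            + 3 / r * deriv (fun ρ => uRad u₀ t ρ / ρ) r) ∧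
      -- the initial data are attained, and the kinetic energy is finite and bounded by its initial value
      sqNorm (swirl u₀) < ⊤ ∧
      (∀ t > 0, sqNorm (velocity u₀ t) ≤ sqNorm (swirl u₀)) ∧
      Tendsto (fun t => sqNorm fun x => velocity u₀ t x - swirl u₀ x) (𝓝[>] 0) (𝓝 0) ∧
      (∀ x ≠ 0, Tendsto (fun t => director β ψ₀ t x) (𝓝[>] 0) (𝓝 (director₀ β ψ₀ x))) ∧
      -- the elastic energy: finite initially if `β > 1 / sin² δ₁`; if finite initially, then it
      -- stays bounded by its initial value and the initial orientation is attained in `H¹`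
      (1 / Real.sin δ₁ ^ 2 < β → dirichlet (director₀ β ψ₀) < ⊤) ∧
      (dirichlet (director₀ β ψ₀) < ⊤ →
        (∀ t > 0, dirichlet (director β ψ₀ t) ≤ dirichlet (director₀ β ψ₀)) ∧
        Tendsto (fun t => sqNorm fun x => director β ψ₀ t x - director₀ β ψ₀ x) (𝓝[>] 0) (𝓝 0) ∧
        ∀ i : Fin 2, Tendsto
          (fun t => sqNorm fun x => pd i (director β ψ₀ t) x - pd i (director₀ β ψ₀) x)
          (𝓝[>] 0) (𝓝 0)) ∧
      -- the image curve of the orientation has non-increasing length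
      (∀ t > 0, imageLength (director β ψ₀ t) ≤ imageLength (director₀ β ψ₀)) ∧
      (∀ s t, 0 < s → s ≤ t → imageLength (director β ψ₀ t) ≤ imageLength (director β ψ₀ s)) := by
  refine ⟨contDiffOn_Phi hδ₁ hβ, fun ψ hψ => hasDerivAt_Phi hδ₁ hβ hψ, fun u₀ ψ₀ hA => ?_⟩
  have hm := hA.measurable_u
  have he := hA.energy_u
  refine ⟨isClassicalSolution_explicit hδ₁ hβ hA,
    fun t ht r _ => intervalIntegrable_pIntegrand hδ₁ hβ hA ht 0 r, fun t ht x => ?_,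
    fun t ht r hr => ⟨deriv_psi hδ₁ hβ hA ht hr, deriv_hopfCole_psi hδ₁ hβ hA ht hr,
      deriv_uRad_div hA ht hr⟩,
    sqNorm_swirl_lt_top hm he, fun t ht => sqNorm_velocity_le hm he ht,
    tendsto_sqNorm_velocity_sub hm he, fun x hx => tendsto_director hδ₁ hβ hA hx,
    dirichlet_director₀_lt_top hδ₁ hβ hA,
    fun hfin => ⟨fun t ht => dirichlet_director_le hδ₁ hβ hA hfin ht,
      tendsto_sqNorm_director_sub hδ₁ hβ hA hfin,
      tendsto_sqNorm_pd_director_sub hδ₁ hβ hA hfin⟩,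
    fun t ht => imageLength_director_le_initial hδ₁ hβ hA ht,
    fun s t hs hst => imageLength_director_le hδ₁ hβ hA hs hst⟩
  rw [psi_norm]
  exact ⟨hopfColeInv_mem_Ioo hδ₁ hβ (phase_mem_Ioo hδ₁ hβ hA ht x),
    hopfCole_hopfColeInv_phase hδ₁ hβ hA ht x⟩
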